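/- **Setting.** Let $d\ge 3$. Let $W$ be the set of doubly infinite nearest-neighbour paths $w=(w(n))_{n\in\mathbb Z}$ in $\mathbb Z^d$ with $|w(n)|\to\infty$ as $|n|\to\infty$, with the $\sigma$-algebra generated by the coordinates $X_n$. Let $W^*$ be the quotient of $W$ by time shifts, $\pi^*:W\to W^*$ the projection, and give $W^*$ the largest $\sigma$-algebra that makes $\pi^*$ measurable. Let $P_x$ be the law of simple random walk on $\mathbb Z^d$ started at $x$. For finite $K\subset\mathbb Z^d$ put $e_K(x)=P_x[X_n\notin K\text{ for all }n\ge 1]$ if $x\in K$ and $e_K(x)=0$ otherwise. Let $W^*_K\subset W^*$ be the set of trajectories that enter $K$, and let $Q_K$ be the finite measure on $W$ with $$Q_K\big[(X_{-n})_{n\ge0}\in A,\ X_0=x,\ (X_n)_{n\ge0}\in B\big]=P_x\big[A\,\big|\,X_n\notin K\ \forall n\ge1\big]\,e_K(x)\,P_x[B]$$ (read as $0$ when $e_K(x)=0$). Let $\nu$ be the unique $\sigma$-finite measure on $W^*$ with $1_{W^*_K}\nu=\pi^*\circ Q_K$ for all finite $K\subset\mathbb Z^d$. Let $\Omega$ be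 the space of point measures $\omega=\sum_{i\ge0}\delta_{(w_i^*,u_i)}$ on $W^*\times[0,\infty)$ with $\omega(W^*_K\times[0,u])<\infty$ for all finite $K$ and all $u\ge0$, and let $\mathbb P$ be the probability measure on $\Omega$ under which $\omega$ is a Poisson point process with intensity $\nu(dw^*)\,du$. For $u\ge0$ the vacant set at level $u$ is $$\mathcal V^u(\omega)=\mathbb Z^d\setminus\bigcup_{i:\,u_i\le u}\operatorname{range}(w_i^*).$$ Let $\mathrm{Perc}(u)$ be the event that $\mathcal V^u$ contains an infinite (nearest-neighbour) connected component, let $\eta(u)=\mathbb P[0\text{ belongs to an infinite connected component of }\mathcal V^u]$, and let $$u_*=\inf\{u\ge0:\ \eta(u)=0\}\in[0,\infty].$$ Identify $\mathbb Z^2$ with $\{z\in\mathbb Z^d:\ z_3=\dots=z_d=0\}$. **Theorem 4.3.** Let $d\ge7$. Then: 1. $u_*>0$. 2. For every $0\le u<u_*$, $\mathbb P[\mathrm{Perc}(u)]=1$. 3. There is $u_0>0$ such that for every $0<u\le u_0$, $\mathbb P$-almost surely, $\mathcal V^u$ contains an infinite connected component, and already $\mathcal V^u\cap\mathbb Z^2$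 contains an infinite connected component. -/

import Mathlib

open MeasureTheory ProbabilityTheory Filter Set
open scoped ENNReal NNReal

noncomputable section

namespace Interlacement

/-! ### The lattice and its trajectories -/

/-- The lattice `ℤ^d`. -/
abbrev Zd (d : ℕ) : Type := Fin d → ℤ

/-- The nearest neighbour graph of `ℤ^d`: `x` and `y` are adjacent if their Euclidean distance
is `1`. -/
def lattice (d : ℕ) : SimpleGraph (Zd d) where
  Adj x y := ∑ i, (x i - y i) ^ 2 = 1
  symm := ⟨fun x y h => by
    rw [← h]
    exact Finset.sum_congr rfl fun i _ => by ring⟩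
  loopless := ⟨fun x h => by simp at h⟩

/-- A doubly infinite nearest neighbour path in `ℤ^d` that spends finite time in every finite
set, that is, `|w n| → ∞` as `|n| → ∞`. -/
def IsTrajectory {d : ℕ} (w : ℤ → Zd d) : Prop :=
  (∀ n : ℤ, (lattice d).Adj (w n) (w (n + 1))) ∧ Tendsto w cofinite cofinite

/-- The space `W` of doubly infinite transient nearest neighbour trajectories, with the
σ-algebra generated by the canonical coordinates. -/
abbrev Traj (d : ℕ) : Type := {w : ℤ → Zd d // IsTrajectory w}

/-- Equality of trajectories up to a time shift. -/
def shiftSetoid (d : ℕ) : Setoid (Traj d) where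
  r w w' := ∃ k : ℤ, ∀ n : ℤ, w.1 n = w'.1 (n + k)
  iseqv :=
    { refl := fun _ => ⟨0, fun n => by rw [add_zero]⟩
      symm := fun {w w'} ⟨k, h⟩ => ⟨-k, fun n => by rw [h, neg_add_cancel_right]⟩
      trans := fun {w w' w''} ⟨k, h⟩ ⟨l, h'⟩ => ⟨k + l, fun n => by rw [h, h', add_assoc]⟩ }

/-- The space `W^*` of trajectories modulo time shift. Its σ-algebra is Mathlib's quotient
σ-algebra: the largest one for which the projection from `W` is measurable. -/
abbrev TrajMod (d : ℕ) : Type := Quotient (shiftSetoid d)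

/-- The canonical projection `π^* : W → W^*`. -/
def proj {d : ℕ} (w : Traj d) : TrajMod d := Quotient.mk (shiftSetoid d) w

/-- The set of sites visited by a trajectory modulo time shift. -/
def sites {d : ℕ} (q : TrajMod d) : Set (Zd d) :=
  Quotient.lift (fun w : Traj d => Set.range w.1)
    (by
      rintro w w' ⟨k, h⟩
      ext x
      constructor
      · rintro ⟨n, rfl⟩
        exact ⟨n + k, (h n).symm⟩
      · rintro ⟨n, rfl⟩
        exact ⟨n - k, by rw [h, sub_add_cancel]⟩) q

/-- The set `W^*_K` of trajectories modulo time shift that enter the finite set `K`. -/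
def entering {d : ℕ} (K : Finset (Zd d)) : Set (TrajMod d) :=
  {q | ∃ x ∈ K, x ∈ sites q}

/-! ### Simple random walk and the equilibrium measure -/

/-- The `2 d` unit steps of the walk: `(i, true)` is `e_i` and `(i, false)` is `-e_i`. -/
def step {d : ℕ} (s : Fin d × Bool) : Zd d := Pi.single s.1 (if s.2 then 1 else -1)

/-- The uniform law on the `2 d` steps. -/
def stepLaw (d : ℕ) [NeZero d] : Measure (Fin d × Bool) :=
  (PMF.uniformOfFintype (Fin d × Bool)).toMeasure

instance (d : ℕ) [NeZero d] : IsProbabilityMeasure (stepLaw d) := by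
  unfold stepLaw
  infer_instance

/-- The law `P_x` of simple random walk on `ℤ^d` started at `x`, as a measure on the space of
sequences of sites: the law of the partial sums of independent uniform steps. -/
def walkLaw {d : ℕ} [NeZero d] (x : Zd d) : Measure (ℕ → Zd d) :=
  (Measure.infinitePi fun _ : ℕ => stepLaw d).map
    fun s n => x + ∑ k ∈ Finset.range n, step (s k)

/-- The event that the hitting time of `K` is infinite: the walk is outside `K` at all times
`n ≥ 1`. -/
def noReturn {d : ℕ} (K : Finset (Zd d)) : Set (ℕ → Zd d) :=
  {X | ∀ n : ℕ, 1 ≤ n → X n ∉ K}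

/-- The equilibrium measure of the finite set `K`: the escape probability on `K`, and `0`
outside `K`. -/
def equilibrium {d : ℕ} [NeZero d] (K : Finset (Zd d)) (x : Zd d) : ℝ≥0∞ :=
  open Classical in if x ∈ K then walkLaw x (noReturn K) else 0

/-! ### The intensity measure of random interlacements -/

/-- The doubly infinite path that follows `X` at times `n ≥ 0`, and `Y`, run backwards, at times
`n < 0`. -/
def glue {d : ℕ} (p : (ℕ → Zd d) × (ℕ → Zd d)) (n : ℤ) : Zd d :=
  if 0 ≤ n then p.2 n.toNat else p.1 (-n).toNat

/-- The finite measure `Q_K` on `W`: the position at time `0` has law the equilibrium measure of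
`K` and, given that it is `x`, the backward and the forward parts are independent, with law
`P_x[· | no return to K]` and `P_x` respectively. (`comap` restricts to the measurable set of
trajectories, which has full measure when `d ≥ 3`.) -/
def entranceMeasure {d : ℕ} [NeZero d] (K : Finset (Zd d)) : Measure (Traj d) :=
  Measure.comap Subtype.val
    (∑ x ∈ K, equilibrium K x • (((walkLaw x)[|noReturn K]).prod (walkLaw x)).map glue)

/-- The box `{-n, …, n}^d`. -/
def box (d n : ℕ) : Finset (Zd d) := Finset.Icc (fun _ => -(n : ℤ)) (fun _ => (n : ℤ))

/-- The intensity measure `ν` on `W^*`, patched together from the images of the measures `Q_K`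
along the exhausting sequence of boxes `K`: on the set of trajectories that enter the `n`-th box
but no smaller one, it is the image of `Q_K` for `K` the `n`-th box. It is the unique measure
whose restriction to `W^*_K` is the image of `Q_K` for every finite `K`. -/
def intensity (d : ℕ) [NeZero d] : Measure (TrajMod d) :=
  Measure.sum fun n : ℕ =>
    ((entranceMeasure (box d n)).map proj).restrict
      (entering (box d n) \ ⋃ m : Fin n, entering (box d m))

/-- Lebesgue measure on `[0, ∞)`. -/
def levelMeasure : Measure ℝ≥0 := Measure.comap (fun u : ℝ≥0 => (u : ℝ)) volume

/-! ### Poisson point processes -/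

/-- The random measure `N`, defined on the probability space `(Ω, P)`, is a Poisson point process
with intensity measure `μ`: the mass of a set `D` with `μ D < ∞` has the Poisson law of parameter
`μ D`, and the masses of pairwise disjoint sets are independent. -/
structure IsPoissonPointProcess {Ω E : Type*} [MeasurableSpace Ω] [MeasurableSpace E]
    (P : Measure Ω) (N : Ω → Measure E) (μ : Measure E) : Prop where
  measurable : Measurable N
  poisson : ∀ D : Set E, MeasurableSet D → μ D < ∞ →
    P.map (fun ω => N ω D) =
      (poissonMeasure (μ D).toNNReal).map (fun k : ℕ => (k : ℝ≥0∞))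
  indep : ∀ (n : ℕ) (D : Fin n → Set E), (∀ i, MeasurableSet (D i)) →
    Pairwise (fun i j => Disjoint (D i) (D j)) → iIndepFun (fun i ω => N ω (D i)) P

/-- `ω` is a point measure on `W^* × [0, ∞)`, `ω = ∑ i, δ_(w_i, u_i)`, that gives finite mass to
`W^*_K × [0, u]` for all finite `K` and all `u ≥ 0`. -/
def IsConfig {d : ℕ} (ω : Measure (TrajMod d × ℝ≥0)) : Prop :=
  (∃ p : ℕ → TrajMod d × ℝ≥0, ω = Measure.sum fun i => Measure.dirac (p i)) ∧
    ∀ (K : Finset (Zd d)) (u : ℝ≥0), ω (entering K ×ˢ Set.Iic u) < ∞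

/-- The canonical space of point measures on `W^* × [0, ∞)`, with the σ-algebra generated by the
evaluation maps `ω ↦ ω D`, `D` measurable. -/
abbrev Config (d : ℕ) : Type := {ω : Measure (TrajMod d × ℝ≥0) // IsConfig ω}

/-- `P` is the law of random interlacements on `ℤ^d`: under `P`, the canonical point measure is a
Poisson point process with intensity `ν(dw) du`. -/
def IsInterlacementLaw {d : ℕ} [NeZero d] (P : Measure (Config d)) : Prop :=
  IsPoissonPointProcess P (fun ω => ω.1) ((intensity d).prod levelMeasure)

/-! ### The vacant set and its percolation -/

/-- The interlacement at level `u`: the sites visited by some trajectory of the configuration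
whose label is at most `u`. -/
def interlacement {d : ℕ} (ω : Config d) (u : ℝ≥0) : Set (Zd d) :=
  {x | ∃ (q : TrajMod d) (v : ℝ≥0), ω.1 {(q, v)} ≠ 0 ∧ v ≤ u ∧ x ∈ sites q}

/-- The vacant set at level `u`. -/
def vacant {d : ℕ} (ω : Config d) (u : ℝ≥0) : Set (Zd d) := (interlacement ω u)ᶜ

/-- The set `V` of sites contains an infinite connected component. -/
def Percolates {d : ℕ} (V : Set (Zd d)) : Prop :=
  ∃ C : ((lattice d).induce V).ConnectedComponent, C.supp.Infinite

/-- The site `x` belongs to an infinite connected component of `V`. -/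
def InInfiniteComponent {d : ℕ} (V : Set (Zd d)) (x : Zd d) : Prop :=
  ∃ h : x ∈ V, (((lattice d).induce V).connectedComponentMk ⟨x, h⟩).supp.Infinite

/-- The event that the vacant set at level `u` percolates. -/
def Perc (d : ℕ) (u : ℝ≥0) : Set (Config d) := {ω | Percolates (vacant ω u)}

/-- The probability that the origin belongs to an infinite connected component of the vacant set
at level `u`. -/
def eta {d : ℕ} (P : Measure (Config d)) (u : ℝ≥0) : ℝ≥0∞ :=
  P {ω | InInfiniteComponent (vacant ω u) 0}

/-- The critical value `u_* = inf {u ≥ 0 | η(u) = 0}` in `[0, ∞]`. -/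
def criticalLevel {d : ℕ} (P : Measure (Config d)) : ℝ≥0∞ :=
  sInf ((fun u : ℝ≥0 => (u : ℝ≥0∞)) '' {u | eta P u = 0})

/-- The coordinate plane `ℤ^2` in `ℤ^d`: all but the first two coordinates vanish. -/
def plane (d : ℕ) : Set (Zd d) := {x | ∀ i : Fin d, 2 ≤ (i : ℕ) → x i = 0}

end Interlacement

end

/-!
For low levels `u` the vacant set percolates in the plane by a Peierls argument, and a zero-one law
carries percolation up to the critical level.

**Walk.** In dimension at least `7` a plane has codimension at least `5`, where `1 / (3 + dist²)` is
superharmonic for simple random walk, strictly so on the plane. Hence the walk spends a bounded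
expected time in each translate of the plane (`tsum_green_plane_le`). This one bound is the only
place where `7 ≤ d` is needed: it gives transience, a bounded Green function, and the summability of
the Green function along the plane. With the symmetry of the Green function and the last exit
decomposition it yields the sweeping identity for equilibrium measures
(`sum_equilibrium_mul_hitProb`).

**Intensity.** By sweeping, `Q_K` gives mass `cap (K ∪ K') - cap K'` to the trajectories that miss
`K'`. Summing this over an exhaustion shows that the trajectories entering `K` have intensity
`cap K` (`intensity_entering`). Since the events `F ⊆ V` generate the σ-algebra on the random sets `V`
and form a π-system, these masses also show that, seen inside `K`, the trajectories entering `K`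
have the same law under the intensity as under `Q_K` (`lintegral_intensity_entering`), and the void
probabilities of the Poisson process determine the law of the vacant set (`prob_subset_vacant`).

**Peierls.** Divide the plane into boxes of radius `R` and call a box bad if a trajectory visits it.
For well separated boxes, the Green mass of all other boxes seen from one of them is small when `R`
is large, so the number of boxes visited by one walk has a large exponential moment
(`lintegral_expHits_le`). The Poisson process transfers this to all trajectories together
(`prob_all_hit_le`): for small `u`, any `m` boxes are all bad with probability at most `32⁻ᵐ`
(`exists_prob_bad_le`). If the cluster of good boxes containing a segment of the axis is finite, a
`*`-connected path of bad boxes leads around it (`exists_contour`). There are `9 ^ m` paths of `m`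
steps, so with positive probability no such path surrounds the origin, which gives a positive
critical level, and by Borel–Cantelli almost surely only finitely many `m` admit such a path that
starts at `(m, 0)`, which gives percolation in the plane (`exists_percolation_level`).

**Zero-one law.** Capacity is asymptotically additive for sets translated far along the plane, so
the translations are mixing for the law of the vacant set on the events `F ⊆ V`. An invariant event
is then independent of itself (`measure_eq_zero_or_one_of_mixing`). Below the critical level
percolation has positive probability, hence probability one (`prob_perc_eq_zero_or_one`).
-/

noncomputable section

namespace Interlacement

/-! ### One step of the walk -/

/-- The transition operator of simple random walk: the mean of `f` over the neighbours of `x`. -/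
def avg {d : ℕ} [NeZero d] (f : Zd d → ℝ≥0∞) (x : Zd d) : ℝ≥0∞ :=
  ∫⁻ s, f (x + step s) ∂stepLaw d

/-- The path that starts at `x` and then follows `X`. -/
def consPath {d : ℕ} (x : Zd d) (X : ℕ → Zd d) : ℕ → Zd d
  | 0 => x
  | n + 1 => X n

lemma measurable_consPath {d : ℕ} (x : Zd d) : Measurable (consPath x) := by
  refine measurable_pi_iff.2 fun n => ?_
  cases n with
  | zero => exact measurable_const
  | succ n => exact measurable_pi_apply n

lemma measurable_partialSums {d : ℕ} (x : Zd d) :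
    Measurable fun (s : ℕ → Fin d × Bool) (n : ℕ) => x + ∑ k ∈ Finset.range n, step (s k) := by
  refine measurable_pi_iff.2 fun n => ?_
  refine measurable_const.add (Finset.measurable_sum _ fun k _ => ?_)
  exact (measurable_of_countable step).comp (measurable_pi_apply k)

lemma measurableSet_eval_mem {d : ℕ} (n : ℕ) (A : Set (Zd d)) :
    MeasurableSet {X : ℕ → Zd d | X n ∈ A} :=
  (measurable_pi_apply n : Measurable fun X : ℕ → Zd d => X n) (MeasurableSet.of_discrete (s := A))

lemma measurableSet_eval_eq {d : ℕ} (n : ℕ) (z : Zd d) : MeasurableSet {X : ℕ → Zd d | X n = z} :=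
  measurableSet_eval_mem n {z}

section Walk

variable {d : ℕ} [NeZero d]

lemma stepLaw_singleton (s : Fin d × Bool) : stepLaw d {s} = (2 * d : ℝ≥0∞)⁻¹ := by
  rw [stepLaw, PMF.toMeasure_apply_singleton _ _ (measurableSet_singleton _)]
  simp [mul_comm]

lemma avg_eq_sum (f : Zd d → ℝ≥0∞) (x : Zd d) :
    avg f x =
      ∑ i : Fin d, (f (x + Pi.single i 1) + f (x + Pi.single i (-1))) * (2 * d : ℝ≥0∞)⁻¹ := by
  rw [avg, lintegral_fintype, Fintype.sum_prod_type]
  refine Finset.sum_congr rfl fun i _ => ?_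
  simp [stepLaw_singleton, step, add_mul]

lemma avg_mono {f g : Zd d → ℝ≥0∞} (h : ∀ x, f x ≤ g x) (x : Zd d) : avg f x ≤ avg g x :=
  lintegral_mono fun _ => h _

lemma avg_const (c : ℝ≥0∞) (x : Zd d) : avg (fun _ => c) x = c := by
  simp [avg]

lemma avg_add (f g : Zd d → ℝ≥0∞) (x : Zd d) :
    avg (fun y => f y + g y) x = avg f x + avg g x :=
  lintegral_add_left (measurable_of_countable _) _

lemma avg_const_mul (c : ℝ≥0∞) (f : Zd d → ℝ≥0∞) (x : Zd d) :
    avg (fun y => c * f y) x = c * avg f x :=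
  lintegral_const_mul _ (measurable_of_countable _)

lemma avg_sum {ι : Type*} (s : Finset ι) (f : ι → Zd d → ℝ≥0∞) (x : Zd d) :
    avg (fun y => ∑ i ∈ s, f i y) x = ∑ i ∈ s, avg (f i) x :=
  lintegral_finsetSum _ fun _ _ => measurable_of_countable _

lemma avg_tsum (f : ℕ → Zd d → ℝ≥0∞) (x : Zd d) :
    avg (fun y => ∑' n, f n y) x = ∑' n, avg (f n) x :=
  lintegral_tsum fun _ => (measurable_of_countable _).aemeasurable

instance (x : Zd d) : IsProbabilityMeasure (walkLaw x) := by
  unfold walkLaw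
  exact Measure.isProbabilityMeasure_map (measurable_partialSums x).aemeasurable

lemma infinitePi_stepLaw_cons :
    ((stepLaw d).prod (Measure.infinitePi fun _ : ℕ => stepLaw d)).map
      (fun p n => Nat.casesOn n p.1 p.2) = Measure.infinitePi fun _ : ℕ => stepLaw d := by
  have hm : Measurable fun (p : (Fin d × Bool) × (ℕ → Fin d × Bool)) (n : ℕ) =>
      (Nat.casesOn n p.1 p.2 : Fin d × Bool) := by
    refine measurable_pi_iff.2 fun n => ?_
    cases n with
    | zero => exact measurable_fst
    | succ n => exact (measurable_pi_apply n).comp measurable_snd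
  refine Measure.eq_infinitePi _ fun s t ht => ?_
  rw [Measure.map_apply hm (MeasurableSet.pi s.countable_toSet fun i _ => ht i)]
  -- the constraint at time `0` is made vacuous when `0 ∉ s`
  set t' : ℕ → Set (Fin d × Bool) := fun n => if n ∈ s then t n else univ with ht'
  have hS : ((fun (p : (Fin d × Bool) × (ℕ → Fin d × Bool)) (n : ℕ) =>
      (Nat.casesOn n p.1 p.2 : Fin d × Bool)) ⁻¹' (s : Set ℕ).pi t) =
      t' 0 ×ˢ ((s.preimage Nat.succ Nat.succ_injective.injOn : Finset ℕ) : Set ℕ).pi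
        (fun n => t (n + 1)) := by
    ext p
    simp only [mem_preimage, Set.mem_pi, Finset.mem_coe, mem_prod, Finset.mem_preimage]
    constructor
    · intro h
      refine ⟨?_, fun n hn => h (n + 1) hn⟩
      by_cases h0 : 0 ∈ s
      · simpa [ht', h0] using h 0 h0
      · simp [ht', h0]
    · rintro ⟨h0, h1⟩ n hn
      cases n with
      | zero => simpa [ht', hn] using h0
      | succ n => exact h1 n hn
  rw [hS, Measure.prod_prod, Measure.infinitePi_pi _ fun i _ => ht (i + 1)]
  have hL : ∏ i ∈ s, stepLaw d (t i) = ∏ i ∈ insert 0 s, stepLaw d (t' i) := by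
    by_cases h0 : 0 ∈ s
    · rw [Finset.insert_eq_of_mem h0]
      exact Finset.prod_congr rfl fun i hi => by simp [ht', hi]
    · rw [Finset.prod_insert h0]
      simp only [ht', h0, if_false, measure_univ, one_mul]
      exact Finset.prod_congr rfl fun i hi => by simp [hi]
  rw [hL, ← Finset.mul_prod_erase _ _ (Finset.mem_insert_self 0 s)]
  congr 1
  refine Finset.prod_bij (fun n _ => n + 1) ?_ ?_ ?_ ?_
  · intro n hn
    simpa using hn
  · intro a _ b _ h
    simpa using h
  · intro b hb
    obtain ⟨n, rfl⟩ : ∃ n, b = n + 1 := Nat.exists_eq_succ_of_ne_zero (Finset.ne_of_mem_erase hb)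
    refine ⟨n, ?_, rfl⟩
    simpa using hb
  · intro n hn
    have : n + 1 ∈ s := by simpa using hn
    simp [ht', this]

/-- The Markov property at time `1`. -/
lemma lintegral_walkLaw (x : Zd d) {F : (ℕ → Zd d) → ℝ≥0∞} (hF : Measurable F) :
    ∫⁻ X, F X ∂walkLaw x = avg (fun y => ∫⁻ X, F (consPath x X) ∂walkLaw y) x := by
  have hm : Measurable fun (p : (Fin d × Bool) × (ℕ → Fin d × Bool)) (n : ℕ) =>
      (Nat.casesOn n p.1 p.2 : Fin d × Bool) := by
    refine measurable_pi_iff.2 fun n => ?_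
    cases n with
    | zero => exact measurable_fst
    | succ n => exact (measurable_pi_apply n).comp measurable_snd
  have hG : Measurable fun s : ℕ → Fin d × Bool =>
      F fun n => x + ∑ k ∈ Finset.range n, step (s k) := hF.comp (measurable_partialSums x)
  rw [walkLaw, lintegral_map hF (measurable_partialSums x), ← infinitePi_stepLaw_cons,
    lintegral_map hG hm, lintegral_prod _ (by exact (hG.comp hm).aemeasurable), avg]
  refine lintegral_congr fun s => ?_
  rw [walkLaw, lintegral_map (by exact hF.comp (measurable_consPath x)) (measurable_partialSums _)]
  refine lintegral_congr fun t => ?_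
  congr 1
  ext1 n
  cases n with
  | zero => simp [consPath]
  | succ n => simp only [consPath, Finset.sum_range_succ']; abel

lemma walkLaw_apply (x : Zd d) {A : Set (ℕ → Zd d)} (hA : MeasurableSet A) :
    walkLaw x A = avg (fun y => walkLaw y (consPath x ⁻¹' A)) x := by
  rw [← lintegral_indicator_one hA, lintegral_walkLaw x (measurable_one.indicator hA)]
  congr 1
  ext1 y
  rw [← lintegral_indicator_one (measurable_consPath x hA)]
  rfl

lemma walkLaw_map_zero (x : Zd d) : walkLaw x {X | X 0 = x}ᶜ = 0 := by
  have h : MeasurableSet {X : ℕ → Zd d | X 0 = x} :=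
    measurableSet_eval_eq 0 x
  rw [walkLaw, Measure.map_apply (measurable_partialSums x) h.compl]
  simp

lemma ae_walkLaw_zero (x : Zd d) : ∀ᵐ X ∂walkLaw x, X 0 = x := walkLaw_map_zero x

end Walk

/-! ### Visits to a set and the Green function -/

/-- The embedding of `ℤ²` into `ℤ^d` as the coordinate plane. -/
def planeEmb (d : ℕ) (t : ℤ × ℤ) : Zd d :=
  fun i => if (i : ℕ) = 0 then t.1 else if (i : ℕ) = 1 then t.2 else 0

/-- The Green function: the expected number of visits to `z` of the walk started at `x`. -/
def green {d : ℕ} [NeZero d] (x z : Zd d) : ℝ≥0∞ := ∑' n, walkLaw x {X | X n = z}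

section Green

variable {d : ℕ} [NeZero d]

lemma walkLaw_eval_zero (x : Zd d) (A : Set (Zd d)) :
    walkLaw x {X | X 0 ∈ A} = A.indicator 1 x := by
  by_cases h : x ∈ A
  · have : walkLaw x {X | X 0 ∈ A} = walkLaw x univ := by
      refine measure_congr ?_
      filter_upwards [ae_walkLaw_zero x] with X hX
      exact propext ⟨fun _ => trivial, fun _ => show X 0 ∈ A from hX ▸ h⟩
    simp [this, h]
  · have : walkLaw x {X | X 0 ∈ A} = walkLaw x ∅ := by
      refine measure_congr ?_
      filter_upwards [ae_walkLaw_zero x] with X hX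
      exact propext ⟨fun h' => h (hX ▸ (h' : X 0 ∈ A)), fun h' => h'.elim⟩
    simp [this, h]

lemma walkLaw_eval_succ (n : ℕ) (x : Zd d) (A : Set (Zd d)) :
    walkLaw x {X | X (n + 1) ∈ A} = avg (fun y => walkLaw y {X | X n ∈ A}) x :=
  walkLaw_apply x (measurableSet_eval_mem (n + 1) A)

/-- Visits are controlled by a Lyapunov function: if the mean drift of `h` is at most `-κ` on `A`
and nonpositive elsewhere, then `κ` times the expected number of visits to `A` is at most `h`. -/
lemma visits_le {h : Zd d → ℝ≥0∞} {κ : ℝ≥0∞} {A : Set (Zd d)}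
    (hh : ∀ x, avg h x + κ * A.indicator 1 x ≤ h x) (x : Zd d) :
    κ * ∑' n, walkLaw x {X | X n ∈ A} ≤ h x := by
  have key : ∀ N : ℕ, ∀ x, κ * ∑ n ∈ Finset.range N, walkLaw x {X | X n ∈ A} ≤ h x := by
    intro N
    induction N with
    | zero => simp
    | succ N ih =>
      intro x
      rw [Finset.sum_range_succ']
      simp_rw [walkLaw_eval_succ]
      rw [walkLaw_eval_zero, ← avg_sum, mul_add, ← avg_const_mul]
      exact (add_le_add_left (avg_mono ih x) _).trans (hh x)
  rw [ENNReal.tsum_eq_iSup_nat, ENNReal.mul_iSup]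
  exact iSup_le fun N => key N x

/-- The set of coordinates transverse to the plane. -/
def transverse (d : ℕ) : Finset (Fin d) := Finset.univ.filter fun i => 2 ≤ (i : ℕ)

omit [NeZero d] in
lemma card_transverse (hd : 7 ≤ d) : (transverse d).card + 2 = d := by
  have h : (Finset.univ.filter fun i : Fin d => ¬ 2 ≤ (i : ℕ)) =
      {⟨0, by omega⟩, ⟨1, by omega⟩} := by
    ext i
    simp [Fin.ext_iff]
    omega
  have h' := Finset.card_filter_add_card_filter_not (s := (Finset.univ : Finset (Fin d)))
    (fun i => 2 ≤ (i : ℕ))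
  rw [h, Finset.card_pair (by simp)] at h'
  simpa [transverse] using h'

/-- Superharmonicity of `1 / (3 + |y|²)` on `ℤ^k`, `k ≥ 5`. -/
lemma sum_inv_le {ι : Type*} (s : Finset ι) (hs : 5 ≤ s.card) (y : ι → ℝ) (r : ℝ)
    (hr : r = 3 + ∑ i ∈ s, y i ^ 2) :
    ∑ i ∈ s, (1 / (r + 1 + 2 * y i) + 1 / (r + 1 - 2 * y i)) ≤ s.card * (2 / r) := by
  have hr3 : 3 ≤ r := by
    rw [hr]
    linarith [Finset.sum_nonneg fun i (_ : i ∈ s) => sq_nonneg (y i)]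
  have hD : 0 < (r - 1) ^ 2 + 12 := by positivity
  have h1 : ∀ i ∈ s, 1 / (r + 1 + 2 * y i) + 1 / (r + 1 - 2 * y i) ≤
      2 / (r + 1) + 8 / ((r + 1) * ((r - 1) ^ 2 + 12)) * y i ^ 2 := by
    intro i hi
    have hy : y i ^ 2 ≤ r - 3 := by
      rw [hr]
      linarith [Finset.single_le_sum (f := fun i => y i ^ 2) (fun j _ => sq_nonneg (y j)) hi]
    -- `(r + 1) ^ 2 - 4 y² ≥ (r + 1) ^ 2 - 4 (r - 3) = (r - 1) ^ 2 + 12`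
    have hE : (r - 1) ^ 2 + 12 ≤ (r + 1 + 2 * y i) * (r + 1 - 2 * y i) := by nlinarith
    have ha : 0 < r + 1 + 2 * y i := by nlinarith [sq_nonneg (y i + 1)]
    have hb : 0 < r + 1 - 2 * y i := by nlinarith [sq_nonneg (y i - 1)]
    have hE0 : 0 < (r + 1 + 2 * y i) * (r + 1 - 2 * y i) := by positivity
    have e : 1 / (r + 1 + 2 * y i) + 1 / (r + 1 - 2 * y i) =
        2 / (r + 1) + 8 / ((r + 1) * ((r + 1 + 2 * y i) * (r + 1 - 2 * y i))) * y i ^ 2 := by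
      field_simp
      ring
    rw [e]
    gcongr
  refine (Finset.sum_le_sum h1).trans ?_
  rw [Finset.sum_add_distrib, ← Finset.mul_sum, show ∑ i ∈ s, y i ^ 2 = r - 3 by rw [hr]; ring,
    Finset.sum_const, nsmul_eq_mul]
  have hk : (5 : ℝ) ≤ s.card := by exact_mod_cast hs
  have e : (s.card : ℝ) * (2 / r) - (s.card * (2 / (r + 1)) +
      8 / ((r + 1) * ((r - 1) ^ 2 + 12)) * (r - 3)) =
      2 * (s.card * ((r - 1) ^ 2 + 12) - 4 * r * (r - 3)) / (r * (r + 1) * ((r - 1) ^ 2 + 12)) := by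
    field_simp
    ring
  have h2 : 0 ≤ (s.card : ℝ) * ((r - 1) ^ 2 + 12) - 4 * r * (r - 3) := by nlinarith
  have h3 : 0 ≤ 2 * (s.card * ((r - 1) ^ 2 + 12) - 4 * r * (r - 3)) /
      (r * (r + 1) * ((r - 1) ^ 2 + 12)) := by positivity
  linarith

/-- The Lyapunov function for visits to the translate of the plane through `w`: the inverse of
`3` plus the squared distance to that plane. -/
def planePotential (w x : Zd d) : ℝ :=
  1 / (3 + ∑ i ∈ transverse d, ((x i - w i : ℤ) : ℝ) ^ 2)

omit [NeZero d] in
lemma planePotential_pos (w x : Zd d) : 0 < planePotential w x := by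
  have := Finset.sum_nonneg fun i (_ : i ∈ transverse d) => sq_nonneg ((x i - w i : ℤ) : ℝ)
  unfold planePotential
  positivity

omit [NeZero d] in
lemma planePotential_add_single (w x : Zd d) (i : Fin d) (e : ℤ) (he : e ^ 2 = 1) :
    planePotential w (x + Pi.single i e) =
      if i ∈ transverse d then
        1 / (3 + ∑ i ∈ transverse d, ((x i - w i : ℤ) : ℝ) ^ 2 + 1 + 2 * (e * (x i - w i : ℤ) : ℝ))
      else planePotential w x := by
  have he' : (e : ℝ) ^ 2 = 1 := by exact_mod_cast he
  have h0 : ∀ j, j ≠ i → (x + Pi.single i e : Zd d) j = x j := fun j hj => by simp [hj]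
  split_ifs with hi
  · unfold planePotential
    congr 1
    rw [← Finset.add_sum_erase _ _ hi, ← Finset.add_sum_erase _ _ hi]
    have : ∑ j ∈ (transverse d).erase i, (((x + Pi.single i e : Zd d) j - w j : ℤ) : ℝ) ^ 2 =
        ∑ j ∈ (transverse d).erase i, ((x j - w j : ℤ) : ℝ) ^ 2 :=
      Finset.sum_congr rfl fun j hj => by rw [h0 j (Finset.ne_of_mem_erase hj)]
    rw [this]
    simp only [Pi.add_apply, Pi.single_eq_same]
    push_cast
    linear_combination he'
  · unfold planePotential
    congr 2
    exact Finset.sum_congr rfl fun j hj => by rw [h0 j (fun h => hi (h ▸ hj))]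

lemma avg_ofReal {f : Zd d → ℝ} (hf : ∀ x, 0 ≤ f x) (x : Zd d) :
    avg (fun y => ENNReal.ofReal (f y)) x =
      ENNReal.ofReal
        ((∑ i : Fin d, (f (x + Pi.single i 1) + f (x + Pi.single i (-1)))) / (2 * d)) := by
  have hd : (0 : ℝ) < 2 * d := by
    have := NeZero.pos d
    positivity
  rw [avg_eq_sum, ← Finset.sum_mul, div_eq_mul_inv, ENNReal.ofReal_mul
    (Finset.sum_nonneg fun i _ => add_nonneg (hf _) (hf _)),
    ENNReal.ofReal_sum_of_nonneg fun i _ => add_nonneg (hf _) (hf _), ENNReal.ofReal_inv_of_pos hd]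
  congr 1
  · exact Finset.sum_congr rfl fun i _ => (ENNReal.ofReal_add (hf _) (hf _)).symm
  · rw [ENNReal.ofReal_mul (by norm_num)]
    simp

/-- At a site of the plane the potential is `1 / 3`, and it drops to `1 / 4` with probability
`(d - 2) / d ≥ 1 / 2`; this is the drift `1 / 24`. -/
lemma planePotential_drift (hd : 7 ≤ d) (w x : Zd d) :
    avg (fun y => ENNReal.ofReal (planePotential w y)) x +
      24⁻¹ * {y : Zd d | ∀ i ∈ transverse d, y i = w i}.indicator 1 x ≤
      ENNReal.ofReal (planePotential w x) := by
  have hk := card_transverse hd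
  have hd0 : (7 : ℝ) ≤ d := by exact_mod_cast hd
  have hkR : ((transverse d).card : ℝ) = d - 2 := by
    have : (((transverse d).card + 2 : ℕ) : ℝ) = d := by rw [hk]
    push_cast at this
    linarith
  set r : ℝ := 3 + ∑ i ∈ transverse d, ((x i - w i : ℤ) : ℝ) ^ 2 with hr
  have hfx : planePotential w x = 1 / r := rfl
  have hr3 : 3 ≤ r := by
    rw [hr]
    linarith [Finset.sum_nonneg fun i (_ : i ∈ transverse d) => sq_nonneg ((x i - w i : ℤ) : ℝ)]
  rw [avg_ofReal fun y => (planePotential_pos w y).le]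
  have hsum : ∑ i : Fin d, (planePotential w (x + Pi.single i 1) +
      planePotential w (x + Pi.single i (-1))) =
      ∑ i ∈ transverse d, (1 / (r + 1 + 2 * ((x i - w i : ℤ) : ℝ)) +
        1 / (r + 1 - 2 * ((x i - w i : ℤ) : ℝ))) + 2 * (2 / r) := by
    rw [← Finset.sum_filter_add_sum_filter_not Finset.univ (fun i => i ∈ transverse d)]
    congr 1
    · rw [Finset.filter_mem_eq_inter, Finset.univ_inter]
      refine Finset.sum_congr rfl fun i hi => ?_
      rw [planePotential_add_single w x i 1 (by norm_num), if_pos hi,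
        planePotential_add_single w x i (-1) (by norm_num), if_pos hi]
      congr 2
      · rw [← hr]; push_cast; ring
      · rw [← hr]; push_cast; ring
    · have h2 : (Finset.univ.filter fun i => i ∉ transverse d).card = 2 := by
        have := Finset.card_filter_add_card_filter_not (s := (Finset.univ : Finset (Fin d)))
          (fun i => i ∈ transverse d)
        rw [Finset.filter_mem_eq_inter, Finset.univ_inter, Finset.card_univ,
          Fintype.card_fin] at this
        omega
      rw [Finset.sum_congr rfl (g := fun _ => 2 / r), Finset.sum_const, h2]
      · simp
      · intro i hi
        have hi' := (Finset.mem_filter.1 hi).2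
        rw [planePotential_add_single w x i 1 (by norm_num), if_neg hi',
          planePotential_add_single w x i (-1) (by norm_num), if_neg hi', hfx]
        ring
  rw [hsum, hfx]
  by_cases hx : x ∈ {y : Zd d | ∀ i ∈ transverse d, y i = w i}
  · have hz : ∀ i ∈ transverse d, ((x i - w i : ℤ) : ℝ) = 0 := fun i hi => by
      simp [show x i = w i from hx i hi]
    have hr0 : r = 3 := by
      rw [hr, Finset.sum_eq_zero fun i hi => by rw [hz i hi]; norm_num]
      norm_num
    rw [Finset.sum_congr rfl (g := fun _ => (1 / 2 : ℝ)) fun i hi => by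
      rw [hz i hi, hr0]; norm_num, Finset.sum_const, nsmul_eq_mul, hkR, hr0,
      indicator_of_mem hx, Pi.one_apply, mul_one]
    have : (24⁻¹ : ℝ≥0∞) = ENNReal.ofReal (1 / 24) := by
      rw [one_div, ENNReal.ofReal_inv_of_pos (by norm_num)]
      simp
    rw [this, ← ENNReal.ofReal_add (by apply div_nonneg <;> nlinarith) (by norm_num)]
    apply ENNReal.ofReal_le_ofReal
    rw [div_add' _ _ _ (by positivity), div_le_iff₀ (by positivity)]
    nlinarith
  · rw [indicator_of_notMem hx, mul_zero, add_zero]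
    apply ENNReal.ofReal_le_ofReal
    rw [div_le_iff₀ (by positivity)]
    have := sum_inv_le (transverse d) (by omega) (fun i => ((x i - w i : ℤ) : ℝ)) r hr
    rw [hkR] at this
    calc _ ≤ ((d : ℝ) - 2) * (2 / r) + 2 * (2 / r) := by linarith
      _ = _ := by ring

/-- The expected number of visits to a translate of the plane is bounded. -/
lemma tsum_walkLaw_plane_le (hd : 7 ≤ d) (w x : Zd d) :
    ∑' n, walkLaw x {X | X n ∈ {y : Zd d | ∀ i ∈ transverse d, y i = w i}} ≤ 24 := by
  have h := visits_le (planePotential_drift hd w) x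
  have h1 : ENNReal.ofReal (planePotential w x) ≤ 1 := by
    rw [ENNReal.ofReal_le_one]
    have := Finset.sum_nonneg fun i (_ : i ∈ transverse d) => sq_nonneg ((x i - w i : ℤ) : ℝ)
    exact (div_le_one (by linarith)).2 (by linarith)
  have h2 := h.trans h1
  rw [mul_comm, ← div_eq_mul_inv] at h2
  have := (ENNReal.div_le_iff (by norm_num) (by norm_num)).1 h2
  simpa using this

omit [NeZero d] in
lemma planeEmb_injective (hd : 2 ≤ d) : Function.Injective (planeEmb d) := by
  intro s t h
  have h0 := congrFun h ⟨0, by omega⟩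
  have h1 := congrFun h ⟨1, by omega⟩
  simp only [planeEmb] at h0 h1
  exact Prod.ext (by simpa using h0) (by simpa using h1)

/-- The Green function is summable along every translate of the plane, with a uniform bound. -/
lemma tsum_green_plane_le (hd : 7 ≤ d) (w x : Zd d) :
    ∑' t : ℤ × ℤ, green x (w + planeEmb d t) ≤ 24 := by
  refine le_trans ?_ (tsum_walkLaw_plane_le hd w x)
  unfold green
  rw [ENNReal.tsum_comm]
  refine ENNReal.tsum_le_tsum fun n => ?_
  rw [← measure_iUnion]
  · refine measure_mono (iUnion_subset fun t X hX i hi => ?_)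
    have hX' : X n = w + planeEmb d t := hX
    have : 2 ≤ (i : ℕ) := (Finset.mem_filter.1 hi).2
    rw [hX']
    simp [planeEmb, show (i : ℕ) ≠ 0 by omega, show (i : ℕ) ≠ 1 by omega]
  · intro s t hst
    refine Set.disjoint_left.2 fun X hX hX' => hst ?_
    have e : w + planeEmb d s = w + planeEmb d t := (show X n = _ from hX).symm.trans hX'
    exact planeEmb_injective (by omega) (add_left_cancel e)
  · exact fun t => measurableSet_eval_eq n _

lemma green_le (hd : 7 ≤ d) (x z : Zd d) : green x z ≤ 24 := by
  have h := (ENNReal.le_tsum (0 : ℤ × ℤ)).trans (tsum_green_plane_le hd z x)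
  have e : z + planeEmb d 0 = z := by
    ext i
    simp [planeEmb]
  rwa [e] at h

lemma one_le_green (x : Zd d) : 1 ≤ green x x := by
  refine le_trans ?_ (ENNReal.le_tsum 0)
  have := walkLaw_eval_zero x {x}
  simp only [mem_singleton_iff] at this
  rw [this]
  simp

lemma walkLaw_eval_add (n : ℕ) (x z a : Zd d) :
    walkLaw (x + a) {X | X n = z + a} = walkLaw x {X | X n = z} := by
  induction n generalizing x with
  | zero =>
    have h1 := walkLaw_eval_zero x {z}
    have h2 := walkLaw_eval_zero (x + a) {z + a}
    simp only [mem_singleton_iff] at h1 h2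
    rw [h1, h2]
    by_cases h : x = z <;> simp [h]
  | succ n ih =>
    have h1 := walkLaw_eval_succ n x {z}
    have h2 := walkLaw_eval_succ n (x + a) {z + a}
    simp only [mem_singleton_iff] at h1 h2
    rw [h1, h2]
    unfold avg
    refine lintegral_congr fun s => ?_
    rw [add_right_comm]
    exact ih _

lemma green_add (x z a : Zd d) : green (x + a) (z + a) = green x z := by
  simp only [green, walkLaw_eval_add]

/-- Reversibility of the walk. -/
lemma walkLaw_eval_symm (n : ℕ) (x z : Zd d) :
    walkLaw x {X | X n = z} = walkLaw z {X | X n = x} := by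
  induction n generalizing x with
  | zero =>
    have h1 := walkLaw_eval_zero x {z}
    have h2 := walkLaw_eval_zero z {x}
    simp only [mem_singleton_iff] at h1 h2
    rw [h1, h2]
    by_cases h : x = z
    · simp [h]
    · simp [h, Ne.symm h]
  | succ n ih =>
    have h1 := walkLaw_eval_succ n x {z}
    have h2 := walkLaw_eval_succ n z {x}
    simp only [mem_singleton_iff] at h1 h2
    rw [h1, h2, avg_eq_sum, avg_eq_sum]
    refine Finset.sum_congr rfl fun i _ => ?_
    have e : ∀ b : ℤ, walkLaw (x + Pi.single i b) {X | X n = z} =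
        walkLaw (z + Pi.single i (-b)) {X | X n = x} := fun b => by
      have h3 := walkLaw_eval_add n z (x + Pi.single i b) (Pi.single i (-b) : Zd d)
      rw [add_assoc, ← Pi.single_add, add_neg_cancel, Pi.single_zero, add_zero] at h3
      rw [ih, h3]
    rw [e 1, e (-1), neg_neg, add_comm]

lemma green_symm (x z : Zd d) : green x z = green z x := by
  simp only [green, walkLaw_eval_symm _ x z]

lemma avg_green_le (x z : Zd d) : avg (fun y => green y z) x ≤ green x z := by
  unfold green
  rw [avg_tsum, tsum_eq_zero_add' (f := fun n => walkLaw x {X | X n = z}) ENNReal.summable]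
  refine le_add_left (ENNReal.tsum_le_tsum fun n => ?_)
  exact (walkLaw_eval_succ n x {z}).ge

end Green

/-! ### Last exits, capacity and sweeping -/

/-- The capacity of a finite set: the total mass of its equilibrium measure. -/
def capacity {d : ℕ} [NeZero d] (K : Finset (Zd d)) : ℝ≥0∞ := ∑ x ∈ K, equilibrium K x

/-- The probability that the walk started at `x` visits `K`, time `0` included. -/
def hitProb {d : ℕ} [NeZero d] (K : Finset (Zd d)) (x : Zd d) : ℝ≥0∞ :=
  walkLaw x {X | ∃ n, X n ∈ K}

lemma measurableSet_noReturn {d : ℕ} (K : Finset (Zd d)) : MeasurableSet (noReturn K) := by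
  have : noReturn K = ⋂ n : ℕ, ⋂ _ : 1 ≤ n, {X : ℕ → Zd d | X n ∈ (K : Set (Zd d))ᶜ} := by
    ext X
    simp [noReturn]
  rw [this]
  exact MeasurableSet.iInter fun n => MeasurableSet.iInter fun _ => measurableSet_eval_mem n _

lemma measurableSet_hit {d : ℕ} (K : Set (Zd d)) :
    MeasurableSet {X : ℕ → Zd d | ∃ n, X n ∈ K} := by
  simp only [ofPred_exists]
  exact MeasurableSet.iUnion fun n => measurableSet_eval_mem n _

lemma measurable_shiftPath {d : ℕ} (n : ℕ) :
    Measurable fun (X : ℕ → Zd d) k => X (n + k) :=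
  measurable_pi_iff.2 fun k => measurable_pi_apply (n + k)

section Capacity

variable {d : ℕ} [NeZero d]

/-- The Markov property at time `n`. -/
lemma walkLaw_markov (n : ℕ) (x y : Zd d) {A : Set (ℕ → Zd d)} (hA : MeasurableSet A) :
    walkLaw x {X | X n = y ∧ (fun k => X (n + k)) ∈ A} =
      walkLaw x {X | X n = y} * walkLaw y A := by
  induction n generalizing x with
  | zero =>
    have h0 := walkLaw_eval_zero x {y}
    simp only [mem_singleton_iff] at h0
    rw [h0]
    by_cases h : x = y
    · subst h
      simp only [mem_singleton_iff, indicator_of_mem, Pi.one_apply, one_mul]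
      refine measure_congr ?_
      filter_upwards [ae_walkLaw_zero x] with X hX
      refine propext ⟨fun h => ?_, fun h => ⟨hX, ?_⟩⟩
      · have h' := (h : X 0 = x ∧ (fun k => X (0 + k)) ∈ A).2
        simp only [zero_add] at h'
        exact h'
      · simp only [zero_add]
        exact h
    · rw [indicator_of_notMem (by simpa using h), zero_mul, ← nonpos_iff_eq_zero]
      refine (measure_mono (fun X hX => ?_)).trans (walkLaw_map_zero x).le
      exact fun h' => h ((show X 0 = x from h').symm.trans hX.1)
  | succ n ih =>
    have h1 := walkLaw_eval_succ n x {y}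
    simp only [mem_singleton_iff] at h1
    rw [h1, walkLaw_apply x (show MeasurableSet {X : ℕ → Zd d | X (n + 1) = y ∧
      (fun k => X (n + 1 + k)) ∈ A} from (measurableSet_eval_eq (n + 1) y).inter
      (measurable_shiftPath (n + 1) hA)), mul_comm, ← avg_const_mul]
    congr 1
    ext1 z
    rw [mul_comm, ← ih]
    congr 1
    ext X
    have e : (fun k => consPath x X (n + 1 + k)) = fun k => X (n + k) :=
      funext fun k => by rw [add_right_comm]; rfl
    change consPath x X (n + 1) = y ∧ (fun k => consPath x X (n + 1 + k)) ∈ A ↔ _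
    rw [e]
    rfl

lemma hitProb_le (K : Finset (Zd d)) (x : Zd d) : hitProb K x ≤ ∑ z ∈ K, green x z := by
  have : {X : ℕ → Zd d | ∃ n, X n ∈ K} = ⋃ z ∈ K, ⋃ n, {X | X n = z} := by
    ext X
    simp [eq_comm]
  rw [hitProb, this]
  exact (measure_biUnion_finset_le _ _).trans
    (Finset.sum_le_sum fun z _ => measure_iUnion_le _)

lemma equilibrium_of_mem {K : Finset (Zd d)} {x : Zd d} (hx : x ∈ K) :
    equilibrium K x = walkLaw x (noReturn K) := by
  simp [equilibrium, hx]

lemma equilibrium_le_one (K : Finset (Zd d)) (x : Zd d) : equilibrium K x ≤ 1 := by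
  unfold equilibrium
  split_ifs
  · exact prob_le_one
  · exact zero_le_one

lemma capacity_le_card (K : Finset (Zd d)) : capacity K ≤ K.card := by
  unfold capacity
  refine (Finset.sum_le_sum fun x _ => equilibrium_le_one K x).trans ?_
  simp

lemma capacity_ne_top (K : Finset (Zd d)) : capacity K ≠ ∞ :=
  ((capacity_le_card K).trans_lt (ENNReal.natCast_lt_top _)).ne

lemma capacity_empty : capacity (∅ : Finset (Zd d)) = 0 := by simp [capacity]

/-- Transience: the walk visits every site finitely often. -/
lemma ae_walkLaw_eventually_ne (hd : 7 ≤ d) (x : Zd d) :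
    ∀ᵐ X ∂walkLaw x, ∀ z, ∀ᶠ n in atTop, X n ≠ z := by
  refine ae_all_iff.2 fun z => ?_
  have h : ∑' n, walkLaw x {X | X n = z} ≠ ∞ :=
    ((green_le hd x z).trans_lt (by norm_num)).ne
  filter_upwards [ae_eventually_notMem h] with X hX
  exact hX

lemma ae_walkLaw_adj (x : Zd d) : ∀ᵐ X ∂walkLaw x, ∀ n, (lattice d).Adj (X n) (X (n + 1)) := by
  have hm : MeasurableSet {X : ℕ → Zd d | ∀ n, (lattice d).Adj (X n) (X (n + 1))} := by
    simp only [ofPred_forall]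
    refine MeasurableSet.iInter fun n => ?_
    have : Measurable fun X : ℕ → Zd d => (X n, X (n + 1)) :=
      (measurable_pi_apply n).prodMk (measurable_pi_apply (n + 1))
    exact this (MeasurableSet.of_discrete (s := {p : Zd d × Zd d | (lattice d).Adj p.1 p.2}))
  rw [walkLaw, ae_map_iff (measurable_partialSums x).aemeasurable hm]
  refine ae_of_all _ fun s n => ?_
  simp only [Finset.sum_range_succ, ← add_assoc]
  simp only [lattice]
  rw [Finset.sum_eq_single (s n).1]
  · simp only [Pi.add_apply, step, Pi.single_eq_same]
    split_ifs <;> ring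
  · intro i _ hi
    simp [step, hi]
  · simp

/-- Last exit decomposition. -/
lemma hitProb_eq (hd : 7 ≤ d) (K : Finset (Zd d)) (x : Zd d) :
    hitProb K x = ∑ y ∈ K, green x y * equilibrium K y := by
  set E : ℕ → Zd d → Set (ℕ → Zd d) :=
    fun n y => {X | X n = y ∧ (fun k => X (n + k)) ∈ noReturn K} with hE
  have hEm : ∀ n y, MeasurableSet (E n y) := fun n y =>
    (measurableSet_eval_eq n y).inter (measurable_shiftPath n (measurableSet_noReturn K))
  have hlast : ∀ {n m : ℕ} {y z : Zd d} {X : ℕ → Zd d}, z ∈ K → X ∈ E n y → X ∈ E m z →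
      m ≤ n := by
    intro n m y z X hz h1 h2
    by_contra! hlt
    refine h1.2 (m - n) (by omega) ?_
    simp only [show n + (m - n) = m by omega]
    rw [h2.1]
    exact hz
  have h1 : hitProb K x = walkLaw x (⋃ n, ⋃ y ∈ K, E n y) := by
    refine measure_congr ?_
    filter_upwards [ae_walkLaw_eventually_ne hd x] with X hX
    refine propext ⟨fun h => ?_, fun h => ?_⟩
    · obtain ⟨n, hn⟩ : ∃ n, X n ∈ K := h
      have hev : ∀ᶠ n in atTop, X n ∉ K := by
        have : ∀ᶠ n in atTop, ∀ z ∈ K, X n ≠ z :=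
          (Filter.eventually_all_finset K).2 fun z _ => hX z
        exact this.mono fun n hn h => hn _ h rfl
      obtain ⟨M, hM⟩ := eventually_atTop.1 hev
      classical
      have hnM : n ≤ M := by
        by_contra! h'
        exact hM n h'.le hn
      set L := Nat.findGreatest (fun n => X n ∈ K) M with hL
      have hLK : X L ∈ K := Nat.findGreatest_spec (P := fun n => X n ∈ K) hnM hn
      refine mem_iUnion.2 ⟨L, mem_iUnion₂.2 ⟨X L, hLK, rfl, fun k hk hk' => ?_⟩⟩
      by_cases hLM : L + k ≤ M
      · have := Nat.le_findGreatest (P := fun n => X n ∈ K) hLM hk'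
        omega
      · exact hM (L + k) (by omega) hk'
    · obtain ⟨n, hn⟩ := mem_iUnion.1 (h : X ∈ ⋃ n, ⋃ y ∈ K, E n y)
      obtain ⟨y, hy, hX'⟩ := mem_iUnion₂.1 hn
      exact ⟨n, hX'.1 ▸ hy⟩
  rw [h1, measure_iUnion]
  · have h2 : ∀ n, walkLaw x (⋃ y ∈ K, E n y) =
        ∑ y ∈ K, walkLaw x {X | X n = y} * equilibrium K y := by
      intro n
      rw [measure_biUnion_finset]
      · exact Finset.sum_congr rfl fun y hy => by
          rw [equilibrium_of_mem hy, ← walkLaw_markov n x y (measurableSet_noReturn K)]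
      · intro y _ z _ hyz
        exact Set.disjoint_left.2 fun X h h' => hyz (h.1.symm.trans h'.1)
      · exact fun y _ => hEm n y
    simp_rw [h2]
    rw [Summable.tsum_finsetSum fun _ _ => ENNReal.summable]
    exact Finset.sum_congr rfl fun y _ => by rw [ENNReal.tsum_mul_right, green]
  · intro n m hnm
    refine Set.disjoint_left.2 fun X h h' => hnm ?_
    obtain ⟨y, hy, h⟩ := mem_iUnion₂.1 h
    obtain ⟨z, hz, h'⟩ := mem_iUnion₂.1 h'
    exact le_antisymm (hlast hy h' h) (hlast hz h h')
  · exact fun n => MeasurableSet.biUnion (Finset.countable_toSet K) fun y _ => hEm n y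

lemma hitProb_of_mem {K : Finset (Zd d)} {x : Zd d} (hx : x ∈ K) : hitProb K x = 1 := by
  rw [hitProb, ← measure_univ (μ := walkLaw x)]
  refine measure_congr ?_
  filter_upwards [ae_walkLaw_zero x] with X hX
  exact propext ⟨fun _ => trivial, fun _ => ⟨0, hX ▸ hx⟩⟩

/-- The sweeping identity: the walk started from the equilibrium measure of `M` enters a subset
`K` with total mass the capacity of `K`. -/
lemma sum_equilibrium_mul_hitProb (hd : 7 ≤ d) {K M : Finset (Zd d)} (h : K ⊆ M) :
    ∑ x ∈ M, equilibrium M x * hitProb K x = capacity K := by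
  simp_rw [hitProb_eq hd K, Finset.mul_sum]
  rw [Finset.sum_comm]
  refine Finset.sum_congr rfl fun y hy => ?_
  calc ∑ x ∈ M, equilibrium M x * (green x y * equilibrium K y)
      = (∑ x ∈ M, green y x * equilibrium M x) * equilibrium K y := by
        rw [Finset.sum_mul]
        refine Finset.sum_congr rfl fun x _ => ?_
        rw [green_symm x y]
        ring
    _ = equilibrium K y := by rw [← hitProb_eq hd M y, hitProb_of_mem (h hy), one_mul]

/-! ### Exponential moments of the number of visited sets -/

variable {ι : Type*} [DecidableEq ι]

open Classical in
/-- `λ` to the power of the number of sets `b a`, `a ∈ S`, visited by time `n`. -/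
def expHitsBy (lam : ℝ≥0∞) (b : ι → Finset (Zd d)) (S : Finset ι) (n : ℕ) (X : ℕ → Zd d) : ℝ≥0∞ :=
  ∏ a ∈ S, if ∃ m ≤ n, X m ∈ b a then lam else 1

open Classical in
/-- `λ` to the power of the number of sets `b a`, `a ∈ S`, that are visited by `X`. -/
def expHits (lam : ℝ≥0∞) (b : ι → Finset (Zd d)) (S : Finset ι) (X : ℕ → Zd d) : ℝ≥0∞ :=
  ∏ a ∈ S, if ∃ m, X m ∈ b a then lam else 1

omit [NeZero d] [DecidableEq ι] in
lemma measurable_expHitsBy (lam : ℝ≥0∞) (b : ι → Finset (Zd d)) (S : Finset ι) (n : ℕ) :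
    Measurable (expHitsBy lam b S n) := by
  refine Finset.measurable_prod _ fun a _ => Measurable.ite ?_ measurable_const measurable_const
  have : {X : ℕ → Zd d | ∃ m ≤ n, X m ∈ b a} =
      ⋃ m, ⋃ _ : m ≤ n, {X | X m ∈ (b a : Set (Zd d))} := by
    ext X
    simp
  rw [this]
  exact MeasurableSet.iUnion fun m => MeasurableSet.iUnion fun _ => measurableSet_eval_mem m _

/-- Induction on `S` and on the time `n`. Away from the sets one step of the walk is taken, and the
right-hand side is superharmonic. At a site of `b a` the set `b a` is discarded at the cost of a
factor `λ`; the remaining Green mass is at most `ε`, and the term `green x x ≥ 1` absorbs the cost.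
-/
lemma lintegral_expHitsBy_le {lam ε : ℝ≥0∞} (h1 : 1 ≤ lam) (hε : 2 * lam * ε ≤ 1)
    (b : ι → Finset (Zd d)) (n : ℕ) (S : Finset ι)
    (hS : ∀ a ∈ S, ∀ x ∈ b a, ∑ a' ∈ S.erase a, ∑ z ∈ b a', green x z ≤ ε) (x : Zd d) :
    ∫⁻ X, expHitsBy lam b S n X ∂walkLaw x ≤ 1 + 2 * lam * ∑ a ∈ S, ∑ z ∈ b a, green x z := by
  induction S using Finset.strongInduction generalizing n x with
  | H S ih =>
  have visit : ∀ n x, (∃ a ∈ S, x ∈ b a) → ∫⁻ X, expHitsBy lam b S n X ∂walkLaw x ≤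
      1 + 2 * lam * ∑ a ∈ S, ∑ z ∈ b a, green x z := by
    rintro n x ⟨a, ha, hx⟩
    have hS' : ∀ a' ∈ S.erase a, ∀ x ∈ b a',
        ∑ a'' ∈ (S.erase a).erase a', ∑ z ∈ b a'', green x z ≤ ε := fun a' ha' x hx =>
      (Finset.sum_le_sum_of_subset (Finset.erase_subset_erase _ (Finset.erase_subset _ _))).trans
        (hS a' (Finset.mem_of_mem_erase ha') x hx)
    have h2 := ih (S.erase a) (Finset.erase_ssubset ha) n hS' x
    have h3 : ∀ X, expHitsBy lam b S n X ≤ lam * expHitsBy lam b (S.erase a) n X := by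
      intro X
      unfold expHitsBy
      rw [← Finset.mul_prod_erase S _ ha]
      gcongr
      split_ifs
      · exact le_rfl
      · exact h1
    have h4 : 1 ≤ ∑ z ∈ b a, green x z :=
      (one_le_green x).trans (Finset.single_le_sum (f := fun z => green x z)
        (fun _ _ => zero_le) hx)
    calc ∫⁻ X, expHitsBy lam b S n X ∂walkLaw x
        ≤ ∫⁻ X, lam * expHitsBy lam b (S.erase a) n X ∂walkLaw x := lintegral_mono h3
      _ = lam * ∫⁻ X, expHitsBy lam b (S.erase a) n X ∂walkLaw x :=
        lintegral_const_mul _ (measurable_expHitsBy _ _ _ _)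
      _ ≤ lam * (1 + 2 * lam * ε) := by
        gcongr
        exact h2.trans (by gcongr; exact hS a ha x hx)
      _ ≤ lam * (1 + 1) := by gcongr
      _ = 2 * lam * 1 := by ring
      _ ≤ 2 * lam * ∑ z ∈ b a, green x z := by gcongr
      _ ≤ 2 * lam * ∑ a ∈ S, ∑ z ∈ b a, green x z := by
        gcongr
        exact Finset.single_le_sum (f := fun a => ∑ z ∈ b a, green x z) (fun _ _ => zero_le) ha
      _ ≤ _ := le_add_self
  induction n generalizing x with
  | zero =>
    by_cases hx : ∃ a ∈ S, x ∈ b a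
    · exact visit 0 x hx
    · have : ∀ᵐ X ∂walkLaw x, expHitsBy lam b S 0 X = 1 := by
        filter_upwards [ae_walkLaw_zero x] with X hX
        refine Finset.prod_eq_one fun a ha => if_neg ?_
        rintro ⟨m, hm, h⟩
        obtain rfl := Nat.le_zero.1 hm
        exact hx ⟨a, ha, hX ▸ h⟩
      rw [lintegral_congr_ae this]
      simp
  | succ n ihn =>
    by_cases hx : ∃ a ∈ S, x ∈ b a
    · exact visit (n + 1) x hx
    · rw [lintegral_walkLaw x (measurable_expHitsBy _ _ _ _)]
      have e : ∀ X, expHitsBy lam b S (n + 1) (consPath x X) = expHitsBy lam b S n X := by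
        intro X
        refine Finset.prod_congr rfl fun a ha => ?_
        congr 1
        refine propext ⟨?_, ?_⟩
        · rintro ⟨m, hm, h⟩
          cases m with
          | zero => exact (hx ⟨a, ha, h⟩).elim
          | succ m => exact ⟨m, by omega, h⟩
        · rintro ⟨m, hm, h⟩
          exact ⟨m + 1, by omega, h⟩
      simp_rw [e]
      refine (avg_mono ihn x).trans ?_
      rw [avg_add, avg_const, avg_const_mul, avg_sum]
      gcongr with a ha
      rw [avg_sum]
      exact Finset.sum_le_sum fun z _ => avg_green_le x z

/-- If each set `b a` has total Green mass at most `ε` as seen from the others, then the number of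
visited sets has an exponential moment of order `λ ≈ 1 / ε`. -/
lemma lintegral_expHits_le {lam ε : ℝ≥0∞} (h1 : 1 ≤ lam) (hε : 2 * lam * ε ≤ 1)
    (b : ι → Finset (Zd d)) (S : Finset ι)
    (hS : ∀ a ∈ S, ∀ x ∈ b a, ∑ a' ∈ S.erase a, ∑ z ∈ b a', green x z ≤ ε) (x : Zd d) :
    ∫⁻ X, expHits lam b S X ∂walkLaw x ≤ 1 + 2 * lam * ∑ a ∈ S, ∑ z ∈ b a, green x z := by
  have hle : ∀ X, expHits lam b S X ≤ ⨆ n, expHitsBy lam b S n X := by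
    intro X
    have : ∃ n, ∀ a ∈ S, (∃ m, X m ∈ b a) → ∃ m ≤ n, X m ∈ b a := by
      have : ∀ᶠ n in atTop, ∀ a ∈ S, (∃ m, X m ∈ b a) → ∃ m ≤ n, X m ∈ b a := by
        refine (Filter.eventually_all_finset S).2 fun a _ => ?_
        by_cases h : ∃ m, X m ∈ b a
        · obtain ⟨m, hm⟩ := h
          exact (eventually_ge_atTop m).mono fun n hn _ => ⟨m, hn, hm⟩
        · exact Eventually.of_forall fun n h' => (h h').elim
      exact this.exists
    obtain ⟨n, hn⟩ := this
    refine le_trans (Finset.prod_le_prod' fun a ha => ?_)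
      (le_iSup (fun n => expHitsBy lam b S n X) n)
    by_cases h : ∃ m, X m ∈ b a
    · rw [if_pos h, if_pos (hn a ha h)]
    · rw [if_neg h]
      split_ifs
      · exact h1
      · exact le_rfl
  have hmono : Monotone fun n => expHitsBy lam b S n := by
    intro n n' hnn X
    refine Finset.prod_le_prod' fun a _ => ?_
    by_cases h : ∃ m ≤ n, X m ∈ b a
    · obtain ⟨m, hm, h⟩ := h
      rw [if_pos ⟨m, hm, h⟩, if_pos ⟨m, hm.trans hnn, h⟩]
    · rw [if_neg h]
      split_ifs
      · exact h1
      · exact le_rfl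
  refine (lintegral_mono hle).trans ?_
  rw [lintegral_iSup (fun n => measurable_expHitsBy _ _ _ _) hmono]
  exact iSup_le fun n => lintegral_expHitsBy_le h1 hε b n S hS x

end Capacity

/-! ### The entrance measures and the intensity -/

/-- The law of the doubly infinite path underlying `entranceMeasure K`, on the space of all
sequences: both halves are unconditioned walks, and the backward half is restricted to the event
that it does not return to `K`. -/
def glueLaw {d : ℕ} [NeZero d] (K : Finset (Zd d)) : Measure (ℤ → Zd d) :=
  ∑ x ∈ K, (((walkLaw x).restrict (noReturn K)).prod (walkLaw x)).map glue

lemma measurable_glue {d : ℕ} : Measurable (glue (d := d)) := by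
  refine measurable_pi_iff.2 fun n => ?_
  unfold glue
  by_cases h : 0 ≤ n
  · simp only [h, if_true]
    exact (measurable_pi_apply _).comp measurable_snd
  · simp only [h, if_false]
    exact (measurable_pi_apply _).comp measurable_fst

lemma isTrajectory_glue {d : ℕ} {p : (ℕ → Zd d) × (ℕ → Zd d)} (h0 : p.1 0 = p.2 0)
    (h1 : ∀ n, (lattice d).Adj (p.1 n) (p.1 (n + 1)))
    (h2 : ∀ n, (lattice d).Adj (p.2 n) (p.2 (n + 1)))
    (h1' : ∀ z, ∀ᶠ n in atTop, p.1 n ≠ z) (h2' : ∀ z, ∀ᶠ n in atTop, p.2 n ≠ z) :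
    IsTrajectory (glue p) := by
  have hpos : ∀ n : ℕ, glue p n = p.2 n := fun n => by simp [glue]
  have hneg : ∀ n : ℕ, glue p (-(n : ℤ)) = p.1 n := fun n => by
    cases n with
    | zero => simp [glue, h0]
    | succ n =>
      rw [glue, if_neg (by omega), neg_neg, Int.toNat_natCast]
  constructor
  · intro n
    rcases le_or_gt 0 n with hn | hn
    · obtain ⟨k, rfl⟩ := Int.eq_ofNat_of_zero_le hn
      have e : ((k : ℤ) + 1) = ((k + 1 : ℕ) : ℤ) := by push_cast; ring
      rw [e, hpos, hpos]
      exact h2 k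
    · obtain ⟨k, hk⟩ := Int.eq_ofNat_of_zero_le (show 0 ≤ -n - 1 by omega)
      obtain rfl : n = -((k + 1 : ℕ) : ℤ) := by push_cast; omega
      have e : -((k + 1 : ℕ) : ℤ) + 1 = -(k : ℤ) := by push_cast; ring
      rw [e, hneg, hneg]
      exact (h1 k).symm
  · refine le_cofinite_iff_compl_singleton_mem.2 fun z => ?_
    rw [mem_map, mem_cofinite]
    have f1 : {n : ℕ | p.1 n = z}.Finite := by
      have := h1' z
      rw [← Nat.cofinite_eq_atTop, eventually_cofinite] at this
      simpa using this
    have f2 : {n : ℕ | p.2 n = z}.Finite := by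
      have := h2' z
      rw [← Nat.cofinite_eq_atTop, eventually_cofinite] at this
      simpa using this
    refine ((f1.image fun n : ℕ => -(n : ℤ)).union (f2.image fun n : ℕ => (n : ℤ))).subset ?_
    intro n hn
    have hn' : glue p n = z := by simpa using hn
    rcases le_total 0 n with h | h
    · obtain ⟨k, rfl⟩ := Int.eq_ofNat_of_zero_le h
      exact Or.inr ⟨k, (hpos k).symm.trans hn', rfl⟩
    · obtain ⟨k, hk⟩ := Int.eq_ofNat_of_zero_le (neg_nonneg.2 h)
      obtain rfl : n = -(k : ℤ) := by omega
      exact Or.inl ⟨k, (hneg k).symm.trans hn', rfl⟩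

lemma measurableSet_path_eval {d : ℕ} (n : ℤ) (A : Set (Zd d)) :
    MeasurableSet {w : ℤ → Zd d | w n ∈ A} :=
  (measurable_pi_apply n : Measurable fun w : ℤ → Zd d => w n) (MeasurableSet.of_discrete (s := A))

lemma measurableSet_isTrajectory (d : ℕ) : MeasurableSet {w : ℤ → Zd d | IsTrajectory w} := by
  have e : {w : ℤ → Zd d | IsTrajectory w} =
      (⋂ n : ℤ, {w | (lattice d).Adj (w n) (w (n + 1))}) ∩
        ⋂ z : Zd d, ⋃ F : Finset ℤ, ⋂ n : ℤ, ⋂ _ : n ∉ F, {w | w n ∈ ({z}ᶜ : Set (Zd d))} := by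
    ext w
    simp only [mem_inter_iff, mem_iInter, mem_iUnion]
    refine and_congr Iff.rfl (le_cofinite_iff_compl_singleton_mem.trans (forall_congr' fun z => ?_))
    rw [mem_map, mem_cofinite]
    constructor
    · intro h
      refine ⟨h.toFinset, fun n hn => ?_⟩
      rw [Set.Finite.mem_toFinset] at hn
      exact not_not.1 hn
    · rintro ⟨F, hF⟩
      exact F.finite_toSet.subset fun n hn => by_contra fun h => hn (hF n h)
  rw [e]
  refine (MeasurableSet.iInter fun n => ?_).inter (MeasurableSet.iInter fun z =>
    MeasurableSet.iUnion fun F => MeasurableSet.iInter fun n => MeasurableSet.iInter fun _ =>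
      measurableSet_path_eval n _)
  have : Measurable fun X : ℤ → Zd d => (X n, X (n + 1)) :=
    (measurable_pi_apply n).prodMk (measurable_pi_apply (n + 1))
  exact this (MeasurableSet.of_discrete (s := {p : Zd d × Zd d | (lattice d).Adj p.1 p.2}))

/-- The doubly infinite paths that do not visit `K`. -/
def avoids {d : ℕ} (K : Finset (Zd d)) : Set (ℤ → Zd d) := {w | ∀ n, w n ∉ K}

lemma mem_avoids {d : ℕ} {K : Finset (Zd d)} {w : ℤ → Zd d} : w ∈ avoids K ↔ ∀ n, w n ∉ K :=
  Iff.rfl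

lemma avoids_union {d : ℕ} (K K' : Finset (Zd d)) : avoids (K ∪ K') = avoids K ∩ avoids K' := by
  ext w
  simp only [mem_avoids, mem_inter_iff, Finset.mem_union, not_or, forall_and]

lemma measurableSet_avoids {d : ℕ} (K : Finset (Zd d)) : MeasurableSet (avoids K) := by
  have : avoids K = ⋂ n : ℤ, {w | w n ∈ (K : Set (Zd d))ᶜ} := by
    ext w
    simp [mem_avoids]
  rw [this]
  exact MeasurableSet.iInter fun n => measurableSet_path_eval n _

section Entrance

variable {d : ℕ} [NeZero d]

lemma sum_smul_glue_eq_glueLaw (K : Finset (Zd d)) :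
    ∑ x ∈ K, equilibrium K x • (((walkLaw x)[|noReturn K]).prod (walkLaw x)).map glue =
      glueLaw K := by
  refine Finset.sum_congr rfl fun x hx => ?_
  rw [equilibrium_of_mem hx, ProbabilityTheory.cond, Measure.prod_smul_left,
    Measure.map_smul, smul_smul]
  by_cases h : walkLaw x (noReturn K) = 0
  · rw [Measure.restrict_eq_zero.2 h]
    simp
  · rw [ENNReal.mul_inv_cancel h (measure_ne_top _ _), one_smul]

lemma ae_glueLaw_isTrajectory (hd : 7 ≤ d) (K : Finset (Zd d)) :
    glueLaw K {w | IsTrajectory w}ᶜ = 0 := by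
  rw [glueLaw, Measure.finsetSum_apply]
  refine Finset.sum_eq_zero fun x _ => ?_
  have hX : ∀ᵐ X ∂walkLaw x, X 0 = x ∧ (∀ n, (lattice d).Adj (X n) (X (n + 1))) ∧
      ∀ z, ∀ᶠ n in atTop, X n ≠ z :=
    (ae_walkLaw_zero x).and ((ae_walkLaw_adj x).and (ae_walkLaw_eventually_ne hd x))
  rw [Measure.map_apply measurable_glue (measurableSet_isTrajectory d).compl]
  have h1 := Measure.quasiMeasurePreserving_fst (μ := (walkLaw x).restrict (noReturn K))
    (ν := walkLaw x) |>.ae (ae_restrict_of_ae hX)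
  have h2 := Measure.quasiMeasurePreserving_snd (μ := (walkLaw x).restrict (noReturn K))
    (ν := walkLaw x) |>.ae hX
  have h3 : ∀ᵐ p ∂((walkLaw x).restrict (noReturn K)).prod (walkLaw x), IsTrajectory (glue p) := by
    filter_upwards [h1, h2] with p hp hq
    exact isTrajectory_glue (hp.1.trans hq.1.symm) hp.2.1 hq.2.1 hp.2.2 hq.2.2
  exact h3

lemma entranceMeasure_apply (hd : 7 ≤ d) (K : Finset (Zd d)) (E : Set (ℤ → Zd d)) :
    entranceMeasure K (Subtype.val ⁻¹' E : Set (Traj d)) = glueLaw K E := by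
  have hemb : MeasurableEmbedding (Subtype.val : Traj d → ℤ → Zd d) :=
    MeasurableEmbedding.subtype_coe (measurableSet_isTrajectory d)
  have hrange : range (Subtype.val : Traj d → ℤ → Zd d) = {w | IsTrajectory w} :=
    Subtype.range_coe
  rw [entranceMeasure, sum_smul_glue_eq_glueLaw, hemb.comap_apply, image_preimage_eq_inter_range,
    hrange]
  refine le_antisymm (measure_mono inter_subset_left) ?_
  refine (measure_le_inter_add_sdiff _ E {w | IsTrajectory w}).trans ?_
  have h0 : glueLaw K (E \ {w | IsTrajectory w}) = 0 :=
    measure_mono_null (fun w hw => hw.2) (ae_glueLaw_isTrajectory hd K)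
  rw [h0, add_zero]

/-- The mass of the trajectories of `Q_K` that miss `K'`. The backward half must not return to
`K ∪ K'`, which turns `e_K` into `e_{K ∪ K'}`, and the forward half must miss `K'`; sweeping from
`K ∪ K'` evaluates the sum. The sites of `K'` contribute nothing. -/
lemma glueLaw_misses (hd : 7 ≤ d) (K K' : Finset (Zd d)) :
    glueLaw K (avoids K') + capacity K' = capacity (K ∪ K') := by
  have hmiss : ∀ x, walkLaw x {X | ∃ n, X n ∈ K'}ᶜ + hitProb K' x = 1 := fun x => by
    rw [hitProb, add_comm]
    exact prob_add_prob_compl (measurableSet_hit (K' : Set (Zd d)))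
  have h1 : glueLaw K (avoids K') =
      ∑ x ∈ K, equilibrium (K ∪ K') x * walkLaw x {X | ∃ n, X n ∈ K'}ᶜ := by
    rw [glueLaw, Measure.finsetSum_apply]
    refine Finset.sum_congr rfl fun x hx => ?_
    rw [Measure.map_apply measurable_glue (measurableSet_avoids _)]
    have e : glue ⁻¹' avoids K' =
        noReturn K' ×ˢ {X : ℕ → Zd d | ∃ n, X n ∈ K'}ᶜ := by
      ext p
      simp only [mem_preimage, mem_prod, mem_compl_iff, noReturn, mem_avoids]
      constructor
      · intro h
        refine ⟨fun n hn => ?_, ?_⟩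
        · have := h (-(n : ℤ))
          rwa [glue, if_neg (by omega), neg_neg, Int.toNat_natCast] at this
        · rintro ⟨n, hn⟩
          have := h (n : ℤ)
          rw [glue, if_pos (by omega), Int.toNat_natCast] at this
          exact this hn
      · rintro ⟨h1, h2⟩ n
        unfold glue
        split_ifs with hn
        · exact fun h => h2 ⟨_, h⟩
        · exact h1 _ (by omega)
    rw [e, Measure.prod_prod, Measure.restrict_apply (measurableSet_noReturn K'),
      equilibrium_of_mem (Finset.mem_union_left _ hx)]
    congr 2
    ext X
    simp only [noReturn, Finset.mem_union, mem_inter_iff, mem_ofPred_eq]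
    exact ⟨fun h n hn h' => h'.elim (h.2 n hn) (h.1 n hn),
      fun h => ⟨fun n hn h' => h n hn (Or.inr h'), fun n hn h' => h n hn (Or.inl h')⟩⟩
  have h2 : ∑ x ∈ K, equilibrium (K ∪ K') x * walkLaw x {X | ∃ n, X n ∈ K'}ᶜ =
      ∑ x ∈ K ∪ K', equilibrium (K ∪ K') x * walkLaw x {X | ∃ n, X n ∈ K'}ᶜ := by
    refine Finset.sum_subset Finset.subset_union_left fun x hx hxK => ?_
    have hx' : x ∈ K' := (Finset.mem_union.1 hx).resolve_left hxK
    have := hmiss x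
    rw [hitProb_of_mem hx'] at this
    have h0 : walkLaw x {X | ∃ n, X n ∈ K'}ᶜ = 0 :=
      (ENNReal.add_left_inj ENNReal.one_ne_top).1 (this.trans (zero_add 1).symm)
    rw [h0, mul_zero]
  rw [h1, h2, ← sum_equilibrium_mul_hitProb hd Finset.subset_union_right, ← Finset.sum_add_distrib]
  exact Finset.sum_congr rfl fun x _ => by rw [← mul_add, hmiss, mul_one]

lemma glueLaw_misses_self (hd : 7 ≤ d) (K : Finset (Zd d)) :
    glueLaw K (avoids K) = 0 := by
  have := glueLaw_misses hd K K
  rw [Finset.union_self] at this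
  exact (ENNReal.add_left_inj (capacity_ne_top K)).1 (this.trans (zero_add _).symm)

/-! ### The intensity of the trajectories entering a finite set -/

omit [NeZero d] in
lemma mem_entering {K : Finset (Zd d)} {q : TrajMod d} :
    q ∈ entering K ↔ ∃ x ∈ K, x ∈ sites q := Iff.rfl

omit [NeZero d] in
lemma proj_mem_entering {K : Finset (Zd d)} {w : Traj d} :
    proj w ∈ entering K ↔ w.1 ∉ avoids K := by
  constructor
  · rintro ⟨x, hx, n, rfl⟩ h
    exact h n hx
  · intro h
    simp only [mem_avoids, not_forall, not_not] at h
    obtain ⟨n, hn⟩ := h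
    exact ⟨w.1 n, hn, n, rfl⟩

omit [NeZero d] in
lemma measurable_proj : Measurable (proj (d := d)) := measurable_quotient_mk''

omit [NeZero d] in
lemma measurableSet_entering (K : Finset (Zd d)) : MeasurableSet (entering K) := by
  rw [measurableSet_quotient]
  have : (Quotient.mk'' ⁻¹' entering K : Set (Traj d)) = Subtype.val ⁻¹' (avoids K)ᶜ := by
    ext w
    exact proj_mem_entering
  rw [this]
  exact measurable_subtype_coe (measurableSet_avoids _).compl

omit [NeZero d] in
lemma measurableSet_mem_sites (x : Zd d) : MeasurableSet {q : TrajMod d | x ∈ sites q} := by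
  convert! measurableSet_entering ({x} : Finset (Zd d)) using 1
  ext q
  simp [mem_entering]

/-- The union of the boxes of size less than `n`. -/
def boxesBelow (d n : ℕ) : Finset (Zd d) := (Finset.range n).biUnion (box d)

omit [NeZero d] in
lemma boxesBelow_succ (n : ℕ) : boxesBelow d (n + 1) = box d n ∪ boxesBelow d n := by
  rw [boxesBelow, Finset.range_add_one, Finset.biUnion_insert, boxesBelow]

omit [NeZero d] in
lemma exists_subset_boxesBelow (K : Finset (Zd d)) : ∃ N, ∀ n, N ≤ n → K ⊆ boxesBelow d n := by
  refine ⟨(K.sup fun x => Finset.univ.sup fun i => (x i).natAbs) + 1, fun n hn x hx => ?_⟩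
  refine Finset.mem_biUnion.2 ⟨K.sup fun x => Finset.univ.sup fun i => (x i).natAbs,
    Finset.mem_range.2 (by omega), ?_⟩
  have h : ∀ i, (x i).natAbs ≤ K.sup fun x => Finset.univ.sup fun i => (x i).natAbs := fun i =>
    (Finset.le_sup (f := fun i => (x i).natAbs) (Finset.mem_univ i)).trans
      (Finset.le_sup (f := fun x : Zd d => Finset.univ.sup fun i => (x i).natAbs) hx)
  rw [box, Finset.mem_Icc]
  constructor <;> intro i <;> have := h i <;> simp only <;> omega

/-- The intensity is defined by the first box that a trajectory enters. The contribution of box `n`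
is a difference of capacities, and the sum over `n` telescopes. -/
lemma intensity_entering (hd : 7 ≤ d) (K : Finset (Zd d)) :
    intensity d (entering K) = capacity K := by
  set q : ℕ → ℝ≥0∞ := fun n => glueLaw (box d n)
    (avoids (boxesBelow d n) \ avoids (K ∪ boxesBelow d n)) with hq
  have h1 : intensity d (entering K) = ∑' n, q n := by
    rw [intensity, Measure.sum_apply _ (measurableSet_entering K)]
    refine tsum_congr fun n => ?_
    rw [Measure.restrict_apply (measurableSet_entering K), Measure.map_apply measurable_proj
      ((measurableSet_entering K).inter ((measurableSet_entering _).diff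
        (MeasurableSet.iUnion fun m => measurableSet_entering _)))]
    have e : (proj ⁻¹' (entering K ∩ (entering (box d n) \ ⋃ m : Fin n, entering (box d m))) :
        Set (Traj d)) = Subtype.val ⁻¹' ((avoids (boxesBelow d n) \
          avoids (K ∪ boxesBelow d n)) \ avoids (box d n)) := by
      ext w
      have hU : w.1 ∈ avoids (boxesBelow d n) ↔ proj w ∉ ⋃ m : Fin n, entering (box d m) := by
        simp only [mem_iUnion, not_exists, proj_mem_entering, not_not, mem_avoids, boxesBelow,
          Finset.mem_biUnion, Finset.mem_range, not_and]
        exact ⟨fun h m k => h k m m.2, fun h k m hm => h ⟨m, hm⟩ k⟩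
      rw [mem_preimage, mem_preimage, avoids_union, sdiff_inter_self_eq_sdiff, mem_inter_iff,
        Set.mem_sdiff, Set.mem_sdiff, Set.mem_sdiff, hU, proj_mem_entering, proj_mem_entering]
      tauto
    rw [e, entranceMeasure_apply hd]
    exact measure_sdiff_null (glueLaw_misses_self hd _)
  have hstep : ∀ n, q n + capacity (K ∪ boxesBelow d (n + 1)) + capacity (boxesBelow d n) =
      capacity (boxesBelow d (n + 1)) + capacity (K ∪ boxesBelow d n) := by
    intro n
    have h2 := glueLaw_misses hd (box d n) (boxesBelow d n)
    have h3 := glueLaw_misses hd (box d n) (K ∪ boxesBelow d n)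
    have h4 : q n + glueLaw (box d n) (avoids (K ∪ boxesBelow d n)) =
        glueLaw (box d n) (avoids (boxesBelow d n)) := by
      have := measure_sdiff_add_inter (μ := glueLaw (box d n)) (avoids (boxesBelow d n))
        (measurableSet_avoids (K ∪ boxesBelow d n))
      rwa [inter_eq_right.2 (by rw [avoids_union]; exact inter_subset_right)] at this
    rw [boxesBelow_succ, ← h2, ← h4, Finset.union_left_comm, ← h3]
    ring
  have hsum : ∀ N, ∑ n ∈ Finset.range N, q n + capacity (K ∪ boxesBelow d N) =
      capacity K + capacity (boxesBelow d N) := by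
    intro N
    induction N with
    | zero => simp [boxesBelow, capacity_empty]
    | succ N ih =>
      refine (ENNReal.add_left_inj (capacity_ne_top (boxesBelow d N))).1 ?_
      rw [Finset.sum_range_succ, add_assoc, add_assoc, ← add_assoc (q N), hstep]
      calc _ = ∑ n ∈ Finset.range N, q n + capacity (K ∪ boxesBelow d N) +
            capacity (boxesBelow d (N + 1)) := by ring
        _ = _ := by rw [ih]; ring
  obtain ⟨N, hN⟩ := exists_subset_boxesBelow K
  rw [h1, tsum_eq_sum (s := Finset.range N)]
  · have := hsum N
    rw [Finset.union_eq_right.2 (hN N le_rfl)] at this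
    exact (ENNReal.add_left_inj (capacity_ne_top _)).1 this
  · intro n hn
    have : K ∪ boxesBelow d n = boxesBelow d n :=
      Finset.union_eq_right.2 (hN n (by simpa using hn))
    simp [hq, this]

end Entrance

/-! ### Laws of random sets -/

lemma measurableSet_subset {α : Type*} (F : Finset α) :
    MeasurableSet {V : Set α | (F : Set α) ⊆ V} := by
  have : {V : Set α | (F : Set α) ⊆ V} = ⋂ a ∈ F, {V | a ∈ V} := by
    ext V
    simp [subset_def]
  rw [this]
  exact F.measurableSet_biInter fun a _ => measurableSet_mem a

/-- The σ-algebra on the subsets of `α` is generated by the events of containing a given finite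
set. -/
lemma setMeasurableSpace_eq_generateFrom (α : Type*) :
    (Set.instMeasurableSpace : MeasurableSpace (Set α)) =
      MeasurableSpace.generateFrom (range fun F : Finset α => {V : Set α | (F : Set α) ⊆ V}) := by
  refine le_antisymm ?_ (MeasurableSpace.generateFrom_le ?_)
  · have h : @Measurable _ _ (MeasurableSpace.generateFrom
        (range fun F : Finset α => {V : Set α | (F : Set α) ⊆ V})) _ (id : Set α → Set α) := by
      refine @measurable_set_iff _ _ (_) _ |>.2 fun a => ?_
      refine (@measurableSet_setOfPred _ (_) _).1
        (MeasurableSpace.measurableSet_generateFrom ⟨{a}, ?_⟩)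
      ext V
      simp
    simpa using measurable_iff_comap_le.1 h
  · rintro _ ⟨F, rfl⟩
    exact measurableSet_subset F

lemma isPiSystem_subset (α : Type*) :
    IsPiSystem (range fun F : Finset α => {V : Set α | (F : Set α) ⊆ V}) := by
  classical
  rintro _ ⟨F, rfl⟩ _ ⟨F', rfl⟩ _
  refine ⟨F ∪ F', ?_⟩
  ext V
  simp

/-- A finite measure on the subsets of a type is determined by the masses of the events that the
random set contains a given finite set. -/
lemma setMeasure_ext {α : Type*} {μ ν : Measure (Set α)} [IsFiniteMeasure μ]
    (h : ∀ F : Finset α, μ {V | (F : Set α) ⊆ V} = ν {V | (F : Set α) ⊆ V}) : μ = ν := by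
  refine ext_of_generate_finite _ (setMeasurableSpace_eq_generateFrom α) (isPiSystem_subset α) ?_ ?_
  · rintro _ ⟨F, rfl⟩
    exact h F
  · simpa using h ∅

section Trace

variable {d : ℕ} [NeZero d]

omit [NeZero d] in
lemma measurable_vacantTrace (K : Finset (Zd d)) :
    Measurable fun w : ℤ → Zd d => {x | x ∈ K → ∀ n, w n ≠ x} := by
  refine measurable_set_iff.2 fun x => measurableSet_setOfPred.1 ?_
  by_cases hx : x ∈ K
  · simp only [mem_ofPred_eq, hx, true_imp_iff, ofPred_forall]
    exact MeasurableSet.iInter fun n => measurableSet_path_eval n {x}ᶜ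
  · simp [hx]

/-- Seen inside `K`, the trajectories that enter `K` have the same trace under the intensity and
under the entrance measure. -/
lemma lintegral_intensity_entering (hd : 7 ≤ d) (K : Finset (Zd d)) {Φ : Set (Zd d) → ℝ≥0∞}
    (hΦ : Measurable Φ) :
    ∫⁻ q in entering K, Φ {x | x ∈ K → x ∉ sites q} ∂intensity d =
      ∫⁻ w, Φ {x | x ∈ K → ∀ n, w n ≠ x} ∂glueLaw K := by
  have m1 : Measurable fun q : TrajMod d => {x | x ∈ K → x ∉ sites q} := by
    refine measurable_set_iff.2 fun x => measurableSet_setOfPred.1 ?_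
    by_cases hx : x ∈ K
    · simp only [mem_ofPred_eq, hx, true_imp_iff]
      exact (measurableSet_mem_sites x).compl
    · simp [hx]
  have m2 := measurable_vacantTrace K
  rw [← lintegral_map hΦ m1, ← lintegral_map hΦ m2]
  congr 1
  have : IsFiniteMeasure (((intensity d).restrict (entering K)).map
      fun q : TrajMod d => {x | x ∈ K → x ∉ sites q}) := by
    refine ⟨?_⟩
    rw [Measure.map_apply m1 MeasurableSet.univ, preimage_univ, Measure.restrict_apply_univ,
      intensity_entering hd]
    exact (capacity_ne_top K).lt_top
  refine setMeasure_ext fun F => ?_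
  rw [Measure.map_apply m1 (measurableSet_subset F), Measure.map_apply m2 (measurableSet_subset F)]
  have e1 : (fun q : TrajMod d => {x | x ∈ K → x ∉ sites q}) ⁻¹' {V | (F : Set (Zd d)) ⊆ V} =
      (entering (F ∩ K))ᶜ := by
    ext q
    simp only [mem_preimage, mem_ofPred_eq, subset_def, mem_compl_iff, mem_entering, not_exists,
      Finset.mem_inter, Finset.mem_coe, not_and]
    tauto
  have e2 : (fun w : ℤ → Zd d => {x | x ∈ K → ∀ n, w n ≠ x}) ⁻¹' {V | (F : Set (Zd d)) ⊆ V} =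
      avoids (F ∩ K) := by
    ext w
    simp only [mem_preimage, mem_ofPred_eq, subset_def, mem_avoids, Finset.mem_inter,
      Finset.mem_coe, not_and]
    exact ⟨fun h n h1 h2 => h _ h1 h2 n rfl, fun h x h1 h2 n hn => h n (hn ▸ h1) (hn ▸ h2)⟩
  rw [e1, e2, Measure.restrict_apply (measurableSet_entering _).compl]
  have h1 := measure_inter_add_sdiff (μ := intensity d) (entering K)
    (measurableSet_entering (F ∩ K))
  have h2 := glueLaw_misses hd K (F ∩ K)
  have hsub : entering (F ∩ K) ⊆ entering K := fun q ⟨x, hx, h⟩ =>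
    ⟨x, Finset.mem_of_mem_inter_right hx, h⟩
  rw [inter_eq_right.2 hsub, intensity_entering hd, intensity_entering hd] at h1
  rw [Finset.union_eq_left.2 Finset.inter_subset_right] at h2
  rw [inter_comm, ← sdiff_eq]
  refine (ENNReal.add_left_inj (capacity_ne_top (F ∩ K))).1 ?_
  rw [h2, ← h1, add_comm]

variable {ι : Type*} [DecidableEq ι]

open Classical in
/-- The number of sets `b a` visited by a trajectory has an exponential moment under the intensity,
proportional to the number of sites of `⋃ b a`. -/
lemma lintegral_intensity_hits_le (hd : 7 ≤ d) {lam ε G : ℝ≥0∞} (h1 : 1 ≤ lam)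
    (hε : 2 * lam * ε ≤ 1) (b : ι → Finset (Zd d)) (S : Finset ι)
    (hS : ∀ a ∈ S, ∀ x ∈ b a, ∑ a' ∈ S.erase a, ∑ z ∈ b a', green x z ≤ ε)
    (hG : ∀ a ∈ S, ∀ x ∈ b a, ∑ a' ∈ S, ∑ z ∈ b a', green x z ≤ G) :
    ∫⁻ q in entering (S.biUnion b), ∏ a ∈ S, (if q ∈ entering (b a) then lam else 1) ∂intensity d ≤
      (S.biUnion b).card * (1 + 2 * lam * G) := by
  set K := S.biUnion b with hK
  set Φ : Set (Zd d) → ℝ≥0∞ := fun V => ∏ a ∈ S, if (b a : Set (Zd d)) ⊆ V then 1 else lam with hΦ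
  have mΦ : Measurable Φ := Finset.measurable_prod _ fun a _ =>
    Measurable.ite (measurableSet_subset (b a)) measurable_const measurable_const
  have e1 : ∀ q : TrajMod d, ∏ a ∈ S, (if q ∈ entering (b a) then lam else 1) =
      Φ {x | x ∈ K → x ∉ sites q} := by
    intro q
    refine Finset.prod_congr rfl fun a ha => ?_
    have : q ∈ entering (b a) ↔ ¬ (b a : Set (Zd d)) ⊆ {x | x ∈ K → x ∉ sites q} := by
      simp only [mem_entering, subset_def, mem_ofPred_eq, Finset.mem_coe, not_forall, not_not]
      exact ⟨fun ⟨x, hx, h⟩ => ⟨x, hx, Finset.mem_biUnion.2 ⟨a, ha, hx⟩, h⟩,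
        fun ⟨x, hx, _, h⟩ => ⟨x, hx, h⟩⟩
    rw [if_congr this rfl rfl, ite_not]
  simp_rw [e1]
  rw [lintegral_intensity_entering hd K mΦ, glueLaw, lintegral_finsetSum_measure]
  have m2 := measurable_vacantTrace K
  have hx : ∀ x ∈ K, ∫⁻ w, Φ {y | y ∈ K → ∀ n, w n ≠ y}
      ∂(((walkLaw x).restrict (noReturn K)).prod (walkLaw x)).map glue ≤ 1 + 2 * lam * G := by
    intro x hx
    obtain ⟨a, ha, hxa⟩ := Finset.mem_biUnion.1 hx
    rw [lintegral_map (by exact mΦ.comp m2) measurable_glue]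
    have hmE : Measurable (expHits lam b S) :=
      Finset.measurable_prod _ fun a _ =>
        Measurable.ite (measurableSet_hit (b a : Set (Zd d))) measurable_const measurable_const
    have hae : ∀ᵐ p ∂((walkLaw x).restrict (noReturn K)).prod (walkLaw x),
        Φ {y | y ∈ K → ∀ n, glue p n ≠ y} = expHits lam b S p.2 := by
      have := Measure.quasiMeasurePreserving_fst (μ := (walkLaw x).restrict (noReturn K))
        (ν := walkLaw x) |>.ae (ae_restrict_mem (measurableSet_noReturn K))
      filter_upwards [this] with p hp
      refine Finset.prod_congr rfl fun a ha => ?_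
      have : (∃ m, p.2 m ∈ b a) ↔ ¬ (b a : Set (Zd d)) ⊆ {y | y ∈ K → ∀ n, glue p n ≠ y} := by
        simp only [subset_def, mem_ofPred_eq, Finset.mem_coe, not_forall, not_not, ne_eq]
        constructor
        · rintro ⟨m, hm⟩
          exact ⟨p.2 m, hm, Finset.mem_biUnion.2 ⟨a, ha, hm⟩, m, by simp [glue]⟩
        · rintro ⟨y, hy, hyK, n, rfl⟩
          unfold glue at hy hyK
          split_ifs at hy hyK with hn
          · exact ⟨_, hy⟩
          · exact (hp _ (by omega) hyK).elim
      rw [if_congr this rfl rfl, ite_not]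
    rw [lintegral_congr_ae hae, lintegral_prod _ (by exact (hmE.comp measurable_snd).aemeasurable)]
    simp only [lintegral_const, Measure.restrict_apply_univ]
    calc _ ≤ (1 + 2 * lam * G) * 1 := by
          gcongr
          · exact (lintegral_expHits_le h1 hε b S hS x).trans (by gcongr; exact hG a ha x hxa)
          · exact prob_le_one
      _ = _ := mul_one _
  refine (Finset.sum_le_sum hx).trans ?_
  rw [Finset.sum_const, nsmul_eq_mul]

end Trace

/-! ### The Poisson point process of trajectories -/

lemma levelMeasure_Iic (u : ℝ≥0) : levelMeasure (Iic u) = u := by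
  have hemb : MeasurableEmbedding (fun u : ℝ≥0 => (u : ℝ)) :=
    NNReal.isClosedEmbedding_coe.measurableEmbedding
  have e : (fun u : ℝ≥0 => (u : ℝ)) '' Iic u = Icc 0 (u : ℝ) := by
    ext x
    constructor
    · rintro ⟨v, hv, rfl⟩
      exact ⟨v.2, hv⟩
    · rintro ⟨h0, h1⟩
      exact ⟨⟨x, h0⟩, h1, rfl⟩
  rw [levelMeasure, hemb.comap_apply, e, Real.volume_Icc]
  simp

instance : SFinite levelMeasure := by
  have : IsFiniteMeasureOnCompacts levelMeasure :=
    IsFiniteMeasureOnCompacts.comap' _ NNReal.continuous_coe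
      NNReal.isClosedEmbedding_coe.measurableEmbedding
  infer_instance

instance {d : ℕ} : MeasurableSingletonClass (TrajMod d) := by
  refine ⟨fun q => ?_⟩
  induction q using Quotient.inductionOn with
  | h w =>
    rw [measurableSet_quotient]
    have : (Quotient.mk'' ⁻¹' {Quotient.mk (shiftSetoid d) w} : Set (Traj d)) =
        ⋃ k : ℤ, {w' | ∀ n, w'.1 n = w.1 (n + k)} := by
      ext w'
      simp only [mem_preimage, mem_singleton_iff, mem_iUnion]
      exact Quotient.eq
    rw [this]
    refine MeasurableSet.iUnion fun k => ?_
    have : {w' : Traj d | ∀ n, w'.1 n = w.1 (n + k)} =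
        Subtype.val ⁻¹' {fun n => w.1 (n + k)} := by
      ext w'
      simp [funext_iff]
    rw [this]
    exact measurable_subtype_coe (measurableSet_singleton _)

section Config

variable {d : ℕ}

/-- A set charged by a point measure contains one of its atoms. -/
lemma config_ne_zero_iff (ω : Config d) {D : Set (TrajMod d × ℝ≥0)} (hD : MeasurableSet D) :
    ω.1 D ≠ 0 ↔ ∃ p ∈ D, ω.1 {p} ≠ 0 := by
  obtain ⟨p, hp⟩ := ω.2.1
  constructor
  · intro h
    rw [hp, Measure.sum_apply _ hD] at h
    obtain ⟨i, hi⟩ : ∃ i, Measure.dirac (p i) D ≠ 0 := by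
      by_contra! h'
      exact h (by simp [h'])
    have hpi : p i ∈ D := by
      by_contra h'
      exact hi (by rw [Measure.dirac_apply' _ hD, indicator_of_notMem h'])
    refine ⟨p i, hpi, ?_⟩
    rw [hp, Measure.sum_apply _ (measurableSet_singleton _)]
    refine ((zero_lt_one.trans_le ?_).trans_le (ENNReal.le_tsum i)).ne'
    simp
  · rintro ⟨x, hx, h⟩ h0
    exact h (measure_mono_null (singleton_subset_iff.2 hx) h0)

lemma one_le_config_of_ne_zero (ω : Config d) {D : Set (TrajMod d × ℝ≥0)} (hD : MeasurableSet D)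
    (h : ω.1 D ≠ 0) : 1 ≤ ω.1 D := by
  obtain ⟨p, hp⟩ := ω.2.1
  rw [hp, Measure.sum_apply _ hD] at h ⊢
  obtain ⟨i, hi⟩ : ∃ i, Measure.dirac (p i) D ≠ 0 := by
    by_contra! h'
    exact h (by simp [h'])
  refine le_trans ?_ (ENNReal.le_tsum i)
  by_contra! h'
  have hpi : p i ∉ D := fun hpi => by
    rw [Measure.dirac_apply' _ hD, indicator_of_mem hpi] at h'
    exact lt_irrefl _ h'
  exact hi (by rw [Measure.dirac_apply' _ hD, indicator_of_notMem hpi])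

lemma measurableSet_entering_prod (K : Finset (Zd d)) (u : ℝ≥0) :
    MeasurableSet (entering K ×ˢ Iic u) :=
  (measurableSet_entering K).prod measurableSet_Iic

lemma config_entering_ne_zero_iff (ω : Config d) (K : Finset (Zd d)) (u : ℝ≥0) :
    ω.1 (entering K ×ˢ Iic u) ≠ 0 ↔ ∃ x ∈ K, x ∈ interlacement ω u := by
  rw [config_ne_zero_iff ω (measurableSet_entering_prod K u)]
  constructor
  · rintro ⟨⟨q, v⟩, ⟨⟨x, hx, hxq⟩, hv⟩, h⟩
    exact ⟨x, hx, q, v, h, hv, hxq⟩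
  · rintro ⟨x, hx, q, v, h, hv, hxq⟩
    exact ⟨(q, v), ⟨⟨x, hx, hxq⟩, hv⟩, h⟩

lemma subset_vacant_iff (ω : Config d) (K : Finset (Zd d)) (u : ℝ≥0) :
    (K : Set (Zd d)) ⊆ vacant ω u ↔ ω.1 (entering K ×ˢ Iic u) = 0 := by
  rw [← not_iff_not, ← ne_eq (ω.1 _), config_entering_ne_zero_iff]
  simp only [subset_def, Finset.mem_coe, vacant, mem_compl_iff, not_forall, not_not, exists_prop]

lemma measurable_config_apply {D : Set (TrajMod d × ℝ≥0)} (hD : MeasurableSet D) :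
    Measurable fun ω : Config d => ω.1 D :=
  (Measure.measurable_coe hD).comp measurable_subtype_coe

lemma measurable_vacant (u : ℝ≥0) : Measurable fun ω : Config d => vacant ω u := by
  refine measurable_set_iff.2 fun x => measurableSet_setOfPred.1 ?_
  have : {ω : Config d | x ∈ vacant ω u} = {ω | ω.1 (entering {x} ×ˢ Iic u) = 0} := by
    ext ω
    rw [mem_ofPred_eq, mem_ofPred_eq, ← subset_vacant_iff]
    simp
  rw [this]
  exact measurable_config_apply (measurableSet_entering_prod _ u) (measurableSet_singleton 0)

variable [NeZero d] {P : Measure (Config d)}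

lemma intensity_prod_entering (hd : 7 ≤ d) (K : Finset (Zd d)) (u : ℝ≥0) :
    ((intensity d).prod levelMeasure) (entering K ×ˢ Iic u) = capacity K * u := by
  rw [Measure.prod_prod, intensity_entering hd, levelMeasure_Iic]

lemma poisson_apply_zero (hP : IsInterlacementLaw P) {D : Set (TrajMod d × ℝ≥0)}
    (hD : MeasurableSet D) (h : ((intensity d).prod levelMeasure) D < ∞) :
    P {ω | ω.1 D = 0} =
      ENNReal.ofReal (Real.exp (-(((intensity d).prod levelMeasure) D).toReal)) := by
  have h1 := DFunLike.congr_fun (hP.poisson D hD h) {(0 : ℝ≥0∞)}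
  rw [Measure.map_apply (measurable_config_apply hD) (measurableSet_singleton 0),
    Measure.map_apply (measurable_of_countable _) (measurableSet_singleton 0)] at h1
  have e : (fun k : ℕ => (k : ℝ≥0∞)) ⁻¹' {0} = {0} := by
    ext k
    simp
  rw [e, poissonMeasure_singleton] at h1
  refine Eq.trans h1 ?_
  simp [ENNReal.coe_toNNReal_eq_toReal]

/-- The law of the vacant set: a finite set is vacant at level `u` with probability
`exp (-u cap)`. -/
lemma prob_subset_vacant (hd : 7 ≤ d) (hP : IsInterlacementLaw P) (K : Finset (Zd d)) (u : ℝ≥0) :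
    P {ω | (K : Set (Zd d)) ⊆ vacant ω u} =
      ENNReal.ofReal (Real.exp (-((capacity K).toReal * u))) := by
  simp_rw [subset_vacant_iff]
  rw [poisson_apply_zero hP (measurableSet_entering_prod K u), intensity_prod_entering hd,
    ENNReal.toReal_mul, ENNReal.coe_toReal]
  rw [intensity_prod_entering hd]
  exact ENNReal.mul_lt_top (capacity_ne_top K).lt_top ENNReal.coe_lt_top

/-- A bound for the generating function of a Poisson variable, in which the factor `exp (-r)` is
dropped. The count is read as a natural number through the floor, which is exact on its values. -/
lemma lintegral_pow_le (hP : IsInterlacementLaw P) {D : Set (TrajMod d × ℝ≥0)}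
    (hD : MeasurableSet D) (h : ((intensity d).prod levelMeasure) D < ∞) (c : ℝ≥0) :
    ∫⁻ ω, (c : ℝ≥0∞) ^ ⌊(ω.1 D).toReal⌋₊ ∂P ≤
      ENNReal.ofReal (Real.exp ((((intensity d).prod levelMeasure) D).toReal * c)) := by
  set r : ℝ≥0 := (((intensity d).prod levelMeasure) D).toNNReal with hr
  have hm : Measurable fun t : ℝ≥0∞ => (c : ℝ≥0∞) ^ ⌊t.toReal⌋₊ :=
    (measurable_of_countable fun n : ℕ => (c : ℝ≥0∞) ^ n).comp
      (Nat.measurable_floor.comp ENNReal.measurable_toReal)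
  calc ∫⁻ ω, (c : ℝ≥0∞) ^ ⌊(ω.1 D).toReal⌋₊ ∂P
      = ∫⁻ t, (c : ℝ≥0∞) ^ ⌊t.toReal⌋₊ ∂P.map (fun ω => ω.1 D) :=
        (lintegral_map hm (measurable_config_apply hD)).symm
    _ = ∫⁻ k : ℕ, (c : ℝ≥0∞) ^ k ∂poissonMeasure r := by
        rw [hP.poisson D hD h, lintegral_map hm (measurable_of_countable _)]
        simp [hr]
    _ = ∑' k : ℕ, (c : ℝ≥0∞) ^ k * ENNReal.ofReal (Real.exp (-r) * r ^ k / k.factorial) := by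
        rw [lintegral_countable']
        simp_rw [poissonMeasure_singleton]
    _ ≤ ∑' k : ℕ, ENNReal.ofReal ((r * c : ℝ) ^ k / k.factorial) := by
        refine ENNReal.tsum_le_tsum fun k => ?_
        rw [← ENNReal.ofReal_coe_nnreal, ← ENNReal.ofReal_pow (NNReal.coe_nonneg c),
          ← ENNReal.ofReal_mul (by positivity)]
        apply ENNReal.ofReal_le_ofReal
        have : Real.exp (-r) ≤ 1 := Real.exp_le_one_iff.2 (by simp)
        rw [mul_pow, ← mul_div_assoc]
        refine div_le_div_of_nonneg_right ?_ (by positivity)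
        calc (c : ℝ) ^ k * (Real.exp (-r) * r ^ k) ≤ c ^ k * (1 * r ^ k) := by gcongr
          _ = r ^ k * c ^ k := by ring
    _ = ENNReal.ofReal (Real.exp (r * c)) := by
        rw [← ENNReal.ofReal_tsum_of_nonneg (fun k => by positivity)
          (Real.summable_pow_div_factorial _), Real.exp_eq_exp_ℝ,
          NormedSpace.exp_eq_tsum_div]

open Classical in
/-- The probability that all the sets `b a`, `a ∈ S`, are visited, by Markov's inequality for `λ` to
the power of the number of pairs of a trajectory and a set that it visits. The trajectories are
sorted by the subset of `S` that they visit; the numbers of trajectories of the various sorts are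
independent Poisson variables. -/
lemma prob_all_hit_le (hd : 7 ≤ d) (hP : IsInterlacementLaw P) {ι : Type*}
    (b : ι → Finset (Zd d)) (S : Finset ι) (u lam c : ℝ≥0) (hlam : 1 ≤ lam)
    (hc : ∫⁻ q in entering (S.biUnion b),
      ∏ a ∈ S, (if q ∈ entering (b a) then (lam : ℝ≥0∞) else 1) ∂intensity d ≤ c) :
    P {ω | ∀ a ∈ S, ω.1 (entering (b a) ×ˢ Iic u) ≠ 0} * (lam : ℝ≥0∞) ^ S.card ≤
      ENNReal.ofReal (Real.exp (u * c)) := by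
  set K := S.biUnion b with hK
  set T : Finset ι → Set (TrajMod d) :=
    fun A => {q | q ∈ entering K ∧ ∀ a ∈ S, q ∈ entering (b a) ↔ a ∈ A} with hT
  have hTm : ∀ A, MeasurableSet (T A) := by
    intro A
    have : T A = entering K ∩ ⋂ a ∈ S, {q | q ∈ entering (b a) ↔ a ∈ A} := by
      ext q
      simp [hT]
    rw [this]
    refine (measurableSet_entering K).inter (S.measurableSet_biInter fun a _ => ?_)
    by_cases h : a ∈ A
    · simpa [h] using measurableSet_entering (b a)
    · have : {q | q ∈ entering (b a) ↔ a ∈ A} = (entering (b a))ᶜ := by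
        ext q
        simp [h]
      rw [this]
      exact (measurableSet_entering (b a)).compl
  have hTK : ∀ A, T A ⊆ entering K := fun A q hq => hq.1
  have hTdisj : ∀ A ∈ S.powerset, ∀ B ∈ S.powerset, A ≠ B → Disjoint (T A) (T B) := by
    intro A hA B hB hAB
    refine Set.disjoint_left.2 fun q hqA hqB => hAB ?_
    ext a
    by_cases ha : a ∈ S
    · exact (hqA.2 a ha).symm.trans (hqB.2 a ha)
    · exact ⟨fun h => (ha (Finset.mem_powerset.1 hA h)).elim,
        fun h => (ha (Finset.mem_powerset.1 hB h)).elim⟩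
  set μ := (intensity d).prod levelMeasure with hμ
  have hD : ∀ A, MeasurableSet (T A ×ˢ Iic u) := fun A => (hTm A).prod measurableSet_Iic
  have hfin : ∀ A, intensity d (T A) < ∞ := fun A =>
    (measure_mono (hTK A)).trans_lt
      (by rw [intensity_entering hd]; exact (capacity_ne_top K).lt_top)
  have hμD : ∀ A, μ (T A ×ˢ Iic u) = intensity d (T A) * u := fun A => by
    rw [hμ, Measure.prod_prod, levelMeasure_Iic]
  have hμfin : ∀ A, μ (T A ×ˢ Iic u) < ∞ := fun A => by
    rw [hμD]
    exact ENNReal.mul_lt_top (hfin A) ENNReal.coe_lt_top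
  -- independence of the numbers of trajectories of the various sorts
  set e := S.powerset.equivFin.symm with he
  have hind := hP.indep _ (fun i => T (e i) ×ˢ Iic u) (fun i => hD _) (fun i j hij => by
    refine Disjoint.set_prod_left (hTdisj _ (e i).2 _ (e j).2 fun h => hij ?_) _ _
    exact e.injective (Subtype.ext h))
  have hm : ∀ c : ℝ≥0, Measurable fun t : ℝ≥0∞ => (c : ℝ≥0∞) ^ ⌊t.toReal⌋₊ := fun c =>
    (measurable_of_countable fun n : ℕ => (c : ℝ≥0∞) ^ n).comp
      (Nat.measurable_floor.comp ENNReal.measurable_toReal)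
  set Y : Finset ι → Config d → ℝ≥0∞ := fun A ω =>
    ((lam ^ A.card : ℝ≥0) : ℝ≥0∞) ^ ⌊(ω.1 (T A ×ˢ Iic u)).toReal⌋₊ with hY
  have hYm : ∀ A, Measurable (Y A) := fun A => (hm _).comp (measurable_config_apply (hD A))
  have hprod : ∫⁻ ω, ∏ A ∈ S.powerset, Y A ω ∂P = ∏ A ∈ S.powerset, ∫⁻ ω, Y A ω ∂P := by
    have h := lintegral_prod_eq_prod_lintegral_of_indepFun Finset.univ
      (fun i ω => Y (e i) ω) (hind.comp (fun i t =>
        ((lam ^ (e i).1.card : ℝ≥0) : ℝ≥0∞) ^ ⌊t.toReal⌋₊) fun i => hm _) (fun i => hYm _)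
    rw [e.prod_comp (fun A => ∫⁻ ω, Y A ω ∂P),
      Finset.prod_coe_sort S.powerset (fun A => ∫⁻ ω, Y A ω ∂P)] at h
    rw [← h]
    refine lintegral_congr fun ω => ?_
    rw [e.prod_comp (fun A => Y A ω), Finset.prod_coe_sort S.powerset (fun A => Y A ω)]
  -- on the event, the exponent is at least the number of sets
  have hev : ∀ ω ∈ {ω : Config d | ∀ a ∈ S, ω.1 (entering (b a) ×ˢ Iic u) ≠ 0},
      (lam : ℝ≥0∞) ^ S.card ≤ ∏ A ∈ S.powerset, Y A ω := by
    intro ω hω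
    have hex : ∀ a ∈ S, 1 ≤ ∑ A ∈ S.powerset, if a ∈ A then
        ⌊(ω.1 (T A ×ˢ Iic u)).toReal⌋₊ else 0 := by
      intro a ha
      obtain ⟨⟨q, v⟩, ⟨hq, hv⟩, hqv⟩ :=
        (config_ne_zero_iff ω (measurableSet_entering_prod _ u)).1 (hω a ha)
      set A := S.filter fun a => q ∈ entering (b a) with hA
      have hqT : q ∈ T A := by
        obtain ⟨x, hx, hxq⟩ := hq
        exact ⟨⟨x, Finset.mem_biUnion.2 ⟨a, ha, hx⟩, hxq⟩, fun a' ha' => by simp [hA, ha']⟩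
      have h1 : 1 ≤ ω.1 (T A ×ˢ Iic u) := one_le_config_of_ne_zero ω (hD A)
        ((config_ne_zero_iff ω (hD A)).2 ⟨(q, v), ⟨hqT, hv⟩, hqv⟩)
      have h2 : ω.1 (T A ×ˢ Iic u) ≠ ∞ :=
        ((measure_mono (prod_mono (hTK A) le_rfl)).trans_lt (ω.2.2 K u)).ne
      refine le_trans ?_ (Finset.single_le_sum (f := fun A => if a ∈ A then
        ⌊(ω.1 (T A ×ˢ Iic u)).toReal⌋₊ else 0) (fun _ _ => Nat.zero_le _)
        (Finset.mem_powerset.2 (Finset.filter_subset _ _) : A ∈ S.powerset))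
      rw [if_pos (by simp [hA, ha, hq]), Nat.one_le_floor_iff]
      simpa using ENNReal.toReal_mono h2 h1
    have hsum : S.card ≤ ∑ A ∈ S.powerset, A.card * ⌊(ω.1 (T A ×ˢ Iic u)).toReal⌋₊ := by
      calc S.card = ∑ a ∈ S, 1 := by simp
        _ ≤ ∑ a ∈ S, ∑ A ∈ S.powerset, (if a ∈ A then ⌊(ω.1 (T A ×ˢ Iic u)).toReal⌋₊ else 0) :=
          Finset.sum_le_sum hex
        _ = ∑ A ∈ S.powerset, ∑ a ∈ S, (if a ∈ A then ⌊(ω.1 (T A ×ˢ Iic u)).toReal⌋₊ else 0) :=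
          Finset.sum_comm
        _ = _ := by
          refine Finset.sum_congr rfl fun A hA => ?_
          rw [← Finset.sum_filter, Finset.filter_mem_eq_inter,
            Finset.inter_eq_right.2 (Finset.mem_powerset.1 hA), Finset.sum_const, smul_eq_mul]
    calc (lam : ℝ≥0∞) ^ S.card
        ≤ lam ^ ∑ A ∈ S.powerset, A.card * ⌊(ω.1 (T A ×ˢ Iic u)).toReal⌋₊ :=
          pow_le_pow_right₀ (by exact_mod_cast hlam) hsum
      _ = _ := by
          rw [← Finset.prod_pow_eq_pow_sum]
          refine Finset.prod_congr rfl fun A _ => ?_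
          simp only [hY]
          rw [pow_mul, ENNReal.coe_pow]
  have hmarkov := mul_meas_ge_le_lintegral₀ (μ := P)
    (f := fun ω => ∏ A ∈ S.powerset, Y A ω)
    (Finset.measurable_prod _ fun A _ => hYm A).aemeasurable ((lam : ℝ≥0∞) ^ S.card)
  rw [mul_comm]
  refine (mul_le_mul_right (measure_mono hev) _).trans (hmarkov.trans ?_)
  rw [hprod]
  calc ∏ A ∈ S.powerset, ∫⁻ ω, Y A ω ∂P
      ≤ ∏ A ∈ S.powerset, ENNReal.ofReal (Real.exp ((μ (T A ×ˢ Iic u)).toReal *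
          (lam ^ A.card : ℝ≥0))) :=
        Finset.prod_le_prod' fun A _ => lintegral_pow_le hP (hD A) (hμfin A) _
    _ = ENNReal.ofReal (Real.exp (∑ A ∈ S.powerset, (μ (T A ×ˢ Iic u)).toReal *
          (lam ^ A.card : ℝ≥0))) := by
        rw [Real.exp_sum, ENNReal.ofReal_prod_of_nonneg fun _ _ => (Real.exp_pos _).le]
    _ ≤ _ := by
        apply ENNReal.ofReal_le_ofReal
        apply Real.exp_le_exp.2
        have h1 : ∑ A ∈ S.powerset, intensity d (T A) * (lam : ℝ≥0∞) ^ A.card ≤ c := by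
          refine le_trans ?_ hc
          have h2 : ∀ A ∈ S.powerset, intensity d (T A) * (lam : ℝ≥0∞) ^ A.card =
              ∫⁻ q in T A, ∏ a ∈ S, (if q ∈ entering (b a) then (lam : ℝ≥0∞) else 1)
                ∂intensity d := by
            intro A hA
            rw [setLIntegral_congr_fun (g := fun _ => (lam : ℝ≥0∞) ^ A.card) (hTm A),
              setLIntegral_const, mul_comm]
            intro q hq
            simp only
            rw [Finset.prod_congr rfl (g := fun a => if a ∈ A then (lam : ℝ≥0∞) else 1)
              fun a ha => if_congr (hq.2 a ha) rfl rfl, ← Finset.prod_filter,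
              Finset.filter_mem_eq_inter, Finset.inter_eq_right.2 (Finset.mem_powerset.1 hA),
              Finset.prod_const]
          rw [Finset.sum_congr rfl h2, ← lintegral_biUnion_finset (fun A hA B hB h =>
            hTdisj A hA B hB h) fun A _ => hTm A]
          exact lintegral_mono_set (iUnion₂_subset fun A _ => hTK A)
        have h3 : ∑ A ∈ S.powerset, (μ (T A ×ˢ Iic u)).toReal * ((lam ^ A.card : ℝ≥0) : ℝ) =
            u * (∑ A ∈ S.powerset, intensity d (T A) * (lam : ℝ≥0∞) ^ A.card).toReal := by
          rw [ENNReal.toReal_sum fun A _ =>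
            ENNReal.mul_ne_top (hfin A).ne (ENNReal.pow_ne_top ENNReal.coe_ne_top), Finset.mul_sum]
          refine Finset.sum_congr rfl fun A _ => ?_
          rw [hμD, ENNReal.toReal_mul, ENNReal.toReal_mul, ENNReal.toReal_pow, ENNReal.coe_toReal,
            ENNReal.coe_toReal]
          push_cast
          ring
        rw [h3]
        gcongr
        exact ENNReal.toReal_le_coe_of_le_coe h1

end Config

/-! ### Contours in the planar lattice -/

/-- `y` is reached from `x` by a path whose steps satisfy `r` and end in `V`. -/
def Linked {α : Type*} (r : α → α → Prop) (V : Set α) : α → α → Prop :=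
  Relation.ReflTransGen fun a b => r a b ∧ b ∈ V

/-- Nearest neighbours in `ℤ²`. -/
def PlanarAdj (p q : ℤ × ℤ) : Prop := |q.1 - p.1| + |q.2 - p.2| = 1

/-- Points of `ℤ²` at sup distance at most `1`. -/
def StarAdj (p q : ℤ × ℤ) : Prop := |q.1 - p.1| ≤ 1 ∧ |q.2 - p.2| ≤ 1

lemma Linked.mem {α : Type*} {r : α → α → Prop} {V : Set α} {x y : α} (hx : x ∈ V)
    (h : Linked r V x y) : y ∈ V := by
  cases h with
  | refl => exact hx
  | tail _ h => exact h.2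

lemma exists_antidifference {M : Type*} [AddCommGroup M] (g : ℤ → M) :
    ∃ A : ℤ → M, A 0 = 0 ∧ ∀ x, A (x + 1) = A x + g x := by
  refine ⟨fun x => match x with
    | Int.ofNat n => ∑ i ∈ Finset.range n, g i
    | Int.negSucc n => -∑ i ∈ Finset.range (n + 1), g (-(i + 1)), by simp, fun x => ?_⟩
  match x with
  | Int.ofNat n => exact Finset.sum_range_succ (fun i : ℕ => g i) n
  | Int.negSucc 0 => simp
  | Int.negSucc (n + 1) =>
    have e : Int.negSucc (n + 1) + 1 = Int.negSucc n := by omega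
    rw [e]
    simp only [Finset.sum_range_succ _ (n + 1)]
    have e' : (-(((n + 1 : ℕ) : ℤ) + 1)) = Int.negSucc (n + 1) := by omega
    rw [e']
    abel

/-- A closed `1`-cochain mod `2` on `ℤ²` is a coboundary: `a` and `b` are its values on horizontal
and vertical edges, and the hypothesis says that it vanishes on the boundary of every unit square.
-/
lemma exists_potential (a b : ℤ → ℤ → ZMod 2)
    (hab : ∀ x y, a x y + b (x + 1) y = b x y + a x (y + 1)) :
    ∃ f : ℤ × ℤ → ZMod 2, (∀ x y, f (x + 1, y) = f (x, y) + a x y) ∧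
      ∀ x y, f (x, y + 1) = f (x, y) + b x y := by
  obtain ⟨A, -, hA⟩ := exists_antidifference fun x => a x 0
  choose B hB0 hB using fun x => exists_antidifference (b x)
  refine ⟨fun p => A p.1 + B p.1 p.2, fun x y => ?_, fun x y => ?_⟩
  · have key : B (x + 1) y + a x 0 = B x y + a x y := by
      induction y using Int.induction_on with
      | zero => simp [hB0]
      | succ y ih =>
        rw [hB, hB]
        linear_combination ih + hab x y
      | pred y ih =>
        have h1 := hB (x + 1) (-y - 1)
        have h2 := hB x (-y - 1)
        have h3 := hab x (-y - 1)
        rw [sub_add_cancel] at h1 h2 h3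
        linear_combination ih - h1 + h2 - h3
    simp only [hA]
    linear_combination key
  · simp only [hB]
    ring

lemma eq_of_forall_eq_succ {β : Type*} (g : ℤ → β) {a b : ℤ} (hab : a ≤ b)
    (h : ∀ i, a ≤ i → i < b → g i = g (i + 1)) : g a = g b := by
  induction b, hab using Int.leInduction with
  | base => rfl
  | succ n hn ih => exact (ih fun i h1 h2 => h i h1 (by omega)).trans (h n hn (by omega))

/-- If the cluster `C` of the origin in `V ⊆ ℤ²` is finite, then a `*`-path in the complement of `V`
joins the right half of the first axis to the left half; it starts beyond every initial segment of
the axis contained in `V`.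

Let `S` be the `*`-cluster in `Vᶜ` of the site that follows the last site of `C` on the right
half-axis. The edges between `C` and `S` form a closed cochain mod `2`, hence the coboundary of a
function `f`, which is constant on `C` and far away from the origin. It takes different values
there, because exactly one of these edges is crossed on the right half-axis beyond the last site of
`C`. So one of these edges lies on the left half-axis too. -/
lemma exists_contour {V : Set (ℤ × ℤ)} {n : ℕ} (hV : ∀ i : ℤ, 0 ≤ i → i ≤ n → (i, 0) ∈ V)
    (hfin : {p | Linked PlanarAdj V (0, 0) p}.Finite) :
    ∃ k : ℤ, n < k ∧ (k, 0) ∈ Vᶜ ∧ ∃ x ≤ 0, Linked StarAdj Vᶜ (k, 0) (x, 0) := by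
  classical
  set C : Set (ℤ × ℤ) := {p | Linked PlanarAdj V (0, 0) p} with hC
  have h0 : ((0 : ℤ), (0 : ℤ)) ∈ V := hV 0 le_rfl (by omega)
  have hCV : C ⊆ V := fun p hp => Linked.mem h0 hp
  have hCadj : ∀ p q, p ∈ C → PlanarAdj p q → q ∉ C → q ∉ V := fun p q hp hpq hq hqV =>
    hq (Relation.ReflTransGen.tail hp ⟨hpq, hqV⟩)
  obtain ⟨L, hL0, hL⟩ : ∃ L : ℤ, 0 < L ∧ ∀ p ∈ C, |p.1| < L ∧ |p.2| < L := by
    obtain ⟨M, hM⟩ := (hfin.image fun p => |p.1| + |p.2|).bddAbove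
    refine ⟨max M 0 + 1, by positivity, fun p hp => ?_⟩
    have := hM ⟨p, hp, rfl⟩
    simp only at this
    have h1 := abs_nonneg p.1
    have h2 := abs_nonneg p.2
    have h3 := le_max_left M 0
    constructor <;> linarith
  have hout1 : ∀ x y : ℤ, L ≤ |x| → (x, y) ∉ C := fun x y hx h => by
    have := (hL _ h).1
    simp only at this
    omega
  have hout2 : ∀ x y : ℤ, L ≤ |y| → (x, y) ∉ C := fun x y hx h => by
    have := (hL _ h).2
    simp only at this
    omega
  -- the last site of the cluster on the right half-axis
  obtain ⟨k, hkC, hkmax⟩ : ∃ k : ℤ, (k, 0) ∈ C ∧ ∀ j, (j, 0) ∈ C → j ≤ k := by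
    have hb : ∃ b : ℤ, ∀ z : ℤ, (z, (0 : ℤ)) ∈ C → z ≤ b :=
      ⟨L, fun z hz => by have := (hL _ hz).1; simp only [abs_lt] at this; omega⟩
    obtain ⟨k, h1, h2⟩ := Int.exists_greatest_of_bdd hb ⟨0, Relation.ReflTransGen.refl⟩
    exact ⟨k, h1, h2⟩
  have hseg : ∀ i : ℕ, i ≤ n → ((i : ℤ), (0 : ℤ)) ∈ C := by
    intro i
    induction i with
    | zero => exact fun _ => Relation.ReflTransGen.refl
    | succ i ih =>
      intro hi
      refine Relation.ReflTransGen.tail (ih (by omega)) ⟨?_, hV _ (by positivity) (by omega)⟩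
      simp [PlanarAdj]
  have hkn : (n : ℤ) ≤ k := hkmax _ (hseg n le_rfl)
  have hk1 : (k + 1, (0 : ℤ)) ∉ C := fun h => by have := hkmax _ h; omega
  have hk1V : (k + 1, (0 : ℤ)) ∉ V := hCadj _ _ hkC (by simp [PlanarAdj]) hk1
  -- the `*`-cluster of vacancies that contains the site just beyond
  set S : Set (ℤ × ℤ) := {p | Linked StarAdj Vᶜ (k + 1, 0) p} with hS
  have hSV : ∀ p ∈ S, p ∉ V := fun p hp => Linked.mem (V := Vᶜ) hk1V hp
  have hSstar : ∀ p q, p ∈ S → StarAdj p q → q ∉ V → q ∈ S := fun p q hp hpq hq =>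
    Relation.ReflTransGen.tail hp ⟨hpq, hq⟩
  set ψ : ℤ × ℤ → ZMod 2 := fun p => if p ∈ C then 1 else 0 with hψ
  set σ : ℤ × ℤ → ZMod 2 := fun p => if p ∈ S then 1 else 0 with hσ
  have hψσ : ∀ p q, (p ∈ C → q ∉ C → q ∈ S) → ψ p * σ q = ψ p * (1 - ψ q) := by
    intro p q h
    by_cases hp : p ∈ C
    · by_cases hq : q ∈ C
      · have : q ∉ S := fun h' => hSV q h' (hCV hq)
        simp [hψ, hσ, hq, this]
      · simp [hψ, hσ, hp, hq, h hp hq]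
    · simp [hψ, hp]
  -- the cochain that counts the edges between `C` and `S`
  set F : ℤ × ℤ → ℤ × ℤ → ZMod 2 := fun p q => ψ p * σ q + ψ q * σ p with hF
  have hclosed : ∀ x y : ℤ, F (x, y) (x + 1, y) + F (x + 1, y) (x + 1, y + 1) =
      F (x, y) (x, y + 1) + F (x, y + 1) (x + 1, y + 1) := by
    intro x y
    by_cases hno : ∃ i j : ℤ, x ≤ i ∧ i ≤ x + 1 ∧ y ≤ j ∧ j ≤ y + 1 ∧ (i, j) ∈ S
    -- on a square that meets `S`, every boundary edge of `C` leads to `S`, so that `F` is the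
    -- coboundary of `ψ` there
    · obtain ⟨i, j, hi, hi', hj, hj', hij⟩ := hno
      have hsq : ∀ a b a' b' : ℤ, PlanarAdj (a, b) (a', b') → x ≤ a' → a' ≤ x + 1 → y ≤ b' →
          b' ≤ y + 1 → ψ (a, b) * σ (a', b') = ψ (a, b) * (1 - ψ (a', b')) := by
        intro a b a' b' hadj h1 h2 h3 h4
        refine hψσ _ _ fun hp hq => hSstar _ _ hij ?_ (hCadj _ _ hp hadj hq)
        constructor <;> rw [abs_le] <;> constructor <;> simp only <;> omega
      have two : (2 : ZMod 2) = 0 := by decide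
      simp only [hF]
      rw [hsq x y (x + 1) y, hsq (x + 1) y x y, hsq (x + 1) y (x + 1) (y + 1),
        hsq (x + 1) (y + 1) (x + 1) y, hsq x y x (y + 1), hsq x (y + 1) x y,
        hsq x (y + 1) (x + 1) (y + 1), hsq (x + 1) (y + 1) x (y + 1)]
      · linear_combination (ψ (x + 1, y) - ψ (x, y + 1) - ψ (x, y) * ψ (x + 1, y) -
          ψ (x + 1, y) * ψ (x + 1, y + 1) + ψ (x, y) * ψ (x, y + 1) +
          ψ (x, y + 1) * ψ (x + 1, y + 1)) * two
      all_goals first | omega | simp [PlanarAdj]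
    · push Not at hno
      have z1 : σ (x, y) = 0 := if_neg (hno x y le_rfl (by omega) le_rfl (by omega))
      have z2 : σ (x + 1, y) = 0 := if_neg (hno _ _ (by omega) le_rfl le_rfl (by omega))
      have z3 : σ (x, y + 1) = 0 := if_neg (hno _ _ le_rfl (by omega) (by omega) le_rfl)
      have z4 : σ (x + 1, y + 1) = 0 := if_neg (hno _ _ (by omega) le_rfl (by omega) le_rfl)
      simp [hF, z1, z2, z3, z4]
  obtain ⟨f, hf1, hf2⟩ := exists_potential (fun x y => F (x, y) (x + 1, y))
    (fun x y => F (x, y) (x, y + 1)) hclosed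
  have hFout : ∀ p q, p ∉ C → q ∉ C → F p q = 0 := fun p q hp hq => by simp [hF, hψ, hp, hq]
  have hFin : ∀ p q, p ∈ C → q ∈ C → F p q = 0 := fun p q hp hq => by
    have h1 : p ∉ S := fun h => hSV p h (hCV hp)
    have h2 : q ∉ S := fun h => hSV q h (hCV hq)
    simp [hF, hσ, h1, h2]
  have hFsymm : ∀ p q, F p q = F q p := fun p q => add_comm _ _
  -- `f` is constant on the cluster
  have hfC : ∀ p ∈ C, f p = f (0, 0) := by
    intro p hp
    induction hp with
    | refl => rfl
    | @tail b c hb hbc ih =>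
      rw [← ih]
      have hcC : c ∈ C := Relation.ReflTransGen.tail hb hbc
      have h0 : F b c = 0 := hFin b c hb hcC
      obtain ⟨b1, b2⟩ := b
      obtain ⟨c1, c2⟩ := c
      have hadj : |c1 - b1| + |c2 - b2| = 1 := hbc.1
      have hcases : (c1 = b1 + 1 ∧ c2 = b2) ∨ (b1 = c1 + 1 ∧ c2 = b2) ∨
          (c1 = b1 ∧ c2 = b2 + 1) ∨ (c1 = b1 ∧ b2 = c2 + 1) := by
        rcases abs_cases (c1 - b1) with h1 | h1 <;> rcases abs_cases (c2 - b2) with h2 | h2 <;>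
          omega
      rcases hcases with ⟨rfl, rfl⟩ | ⟨rfl, rfl⟩ | ⟨rfl, rfl⟩ | ⟨rfl, rfl⟩
      · rw [hf1, h0, add_zero]
      · rw [hf1, hFsymm, h0, add_zero]
      · rw [hf2, h0, add_zero]
      · rw [hf2, hFsymm, h0, add_zero]
  have hkL : k + 1 ≤ L := by
    have := (hL _ hkC).1
    simp only [abs_lt] at this
    omega
  -- `f` jumps on the edge out of `(k, 0)` and is then constant along the axis and around the
  -- cluster
  have e1 : f (k + 1, 0) = f (0, 0) + 1 := by
    have hkS : (k + 1, (0 : ℤ)) ∈ S := Relation.ReflTransGen.refl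
    have hk' : (k, (0 : ℤ)) ∉ S := fun h => hSV _ h (hCV hkC)
    rw [hf1, hfC _ hkC]
    simp [hF, hψ, hσ, hkC, hkS, hk']
  have e2 : f (k + 1, 0) = f (L, 0) :=
    eq_of_forall_eq_succ (fun i => f (i, 0)) hkL fun i h1 h2 => by
      have h3 : (i, (0 : ℤ)) ∉ C := fun h => by have := hkmax _ h; omega
      have h4 : (i + 1, (0 : ℤ)) ∉ C := fun h => by have := hkmax _ h; omega
      rw [hf1, hFout _ _ h3 h4, add_zero]
  have habsL : L ≤ |L| := le_abs_self L
  have habsL' : L ≤ |-L| := by rw [abs_neg]; exact habsL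
  have e3 : f (L, 0) = f (L, L) :=
    eq_of_forall_eq_succ (fun i => f (L, i)) hL0.le fun i _ _ => by
      rw [hf2, hFout _ _ (hout1 _ _ habsL) (hout1 _ _ habsL), add_zero]
  have e4 : f (-L, L) = f (L, L) :=
    eq_of_forall_eq_succ (fun i => f (i, L)) (by omega) fun i _ _ => by
      rw [hf1, hFout _ _ (hout2 _ _ habsL) (hout2 _ _ habsL), add_zero]
  have e5 : f (-L, 0) = f (-L, L) :=
    eq_of_forall_eq_succ (fun i => f (-L, i)) hL0.le fun i _ _ => by
      rw [hf2, hFout _ _ (hout1 _ _ habsL') (hout1 _ _ habsL'), add_zero]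
  -- hence `f` jumps once more on the negative half-axis
  obtain ⟨x, hx0, hxF⟩ : ∃ x : ℤ, x < 0 ∧ F (x, 0) (x + 1, 0) ≠ 0 := by
    by_contra! h
    have e6 : f (-L, 0) = f (0, 0) :=
      eq_of_forall_eq_succ (fun i => f (i, 0)) (by omega) fun i _ h2 => by
        rw [hf1, h i h2, add_zero]
    have : f (0, 0) + 1 = f (0, 0) := by rw [← e1, e2, e3, ← e4, ← e5, e6]
    exact one_ne_zero (add_eq_left.1 this)
  refine ⟨k + 1, by omega, hk1V, ?_⟩
  by_cases h1 : (x, (0 : ℤ)) ∈ S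
  · exact ⟨x, hx0.le, h1⟩
  · by_cases h2 : (x + 1, (0 : ℤ)) ∈ S
    · exact ⟨x + 1, by omega, h2⟩
    · exact (hxF (by simp [hF, hσ, h1, h2])).elim

/-- A `*`-path from `(m, 0)` to the left half-plane contains `m + 1` distinct sites in succession.
-/
lemma exists_injective_starPath {B : Set (ℤ × ℤ)} {m : ℕ} (hm : ((m : ℤ), (0 : ℤ)) ∈ B)
    {x : ℤ} (hx : x ≤ 0) (h : Linked StarAdj B (m, 0) (x, 0)) :
    ∃ q : ℕ → ℤ × ℤ, q 0 = ((m : ℤ), 0) ∧ (∀ i < m, StarAdj (q i) (q (i + 1))) ∧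
      InjOn q (Iic m) ∧ ∀ i ≤ m, q i ∈ B := by
  classical
  let H : SimpleGraph (ℤ × ℤ) :=
    { Adj := fun p q => p ≠ q ∧ StarAdj p q ∧ p ∈ B ∧ q ∈ B
      symm := ⟨fun p q ⟨h1, h2, h3, h4⟩ =>
        ⟨h1.symm, ⟨by rw [abs_sub_comm]; exact h2.1, by rw [abs_sub_comm]; exact h2.2⟩, h4, h3⟩⟩
      loopless := ⟨fun p h => h.1 rfl⟩ }
  have hreach : ∀ p, Linked StarAdj B ((m : ℤ), 0) p → H.Reachable ((m : ℤ), 0) p := by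
    intro p hp
    induction hp with
    | refl => exact SimpleGraph.Reachable.refl _
    | @tail b c hb hbc ih =>
      by_cases hne : b = c
      · exact hne ▸ ih
      · exact ih.trans (SimpleGraph.Adj.reachable
          (show H.Adj b c from ⟨hne, hbc.1, Linked.mem hm hb, hbc.2⟩))
  obtain ⟨w, hw⟩ := (hreach _ h).exists_isPath
  have hlip : ∀ {p q : ℤ × ℤ} (w : H.Walk p q), p.1 - q.1 ≤ w.length := by
    intro p q w
    induction w with
    | nil => simp
    | @cons u v t huv w ih =>
      have := huv.2.1.1
      rw [abs_le] at this
      rw [SimpleGraph.Walk.length_cons]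
      push_cast
      omega
  have hlen : m ≤ w.length := by
    have := hlip w
    simp only at this
    omega
  have hadj : ∀ i < m, H.Adj (w.getVert i) (w.getVert (i + 1)) := fun i hi =>
    w.adj_getVert_succ (by omega)
  refine ⟨w.getVert, by simp, fun i hi => (hadj i hi).2.1, ?_, fun i hi => ?_⟩
  · exact hw.getVert_injOn.mono fun i (hi : i ≤ m) => (hi.trans hlen : i ≤ w.length)
  · cases i with
    | zero => simpa using hm
    | succ i => exact (hadj i (by omega)).2.2.2

/-! ### Infinite components -/

lemma Linked.mono {α : Type*} {r : α → α → Prop} {V W : Set α} (h : V ⊆ W) {x y : α}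
    (hxy : Linked r V x y) : Linked r W x y :=
  Relation.ReflTransGen.mono (fun _ _ h' => ⟨h'.1, h h'.2⟩) _ _ hxy

section Components

variable {d : ℕ}

lemma reachable_induce_iff {V : Set (Zd d)} {x y : Zd d} (hx : x ∈ V) (hy : y ∈ V) :
    ((lattice d).induce V).Reachable ⟨x, hx⟩ ⟨y, hy⟩ ↔ Linked (lattice d).Adj V x y := by
  constructor
  · rintro ⟨w⟩
    have key : ∀ {a b : V} (w : ((lattice d).induce V).Walk a b),
        Linked (lattice d).Adj V a.1 b.1 := by
      intro a b w
      induction w with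
      | nil => exact Relation.ReflTransGen.refl
      | @cons a b c hab w ih => exact Relation.ReflTransGen.head ⟨hab, b.2⟩ ih
    exact key w
  · intro h
    induction h with
    | refl => exact SimpleGraph.Reachable.refl _
    | @tail b c hb hbc ih =>
      have hbV : b ∈ V := Linked.mem hx hb
      refine (ih hbV).trans (SimpleGraph.Adj.reachable ?_)
      exact hbc.1

lemma inInfiniteComponent_iff {V : Set (Zd d)} {x : Zd d} :
    InInfiniteComponent V x ↔ x ∈ V ∧ {y | Linked (lattice d).Adj V x y}.Infinite := by
  have key : ∀ hx : x ∈ V, Subtype.val '' (((lattice d).induce V).connectedComponentMk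
      ⟨x, hx⟩).supp = {y | Linked (lattice d).Adj V x y} := by
    intro hx
    ext y
    constructor
    · rintro ⟨⟨y, hy⟩, h, rfl⟩
      exact (reachable_induce_iff hx hy).1 (SimpleGraph.ConnectedComponent.exact h).symm
    · intro h
      have hy : y ∈ V := Linked.mem hx h
      exact ⟨⟨y, hy⟩, SimpleGraph.ConnectedComponent.sound
        ((reachable_induce_iff hx hy).2 h).symm, rfl⟩
  constructor
  · rintro ⟨hx, h⟩
    exact ⟨hx, key hx ▸ h.image Subtype.val_injective.injOn⟩
  · rintro ⟨hx, h⟩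
    rw [← key hx] at h
    exact ⟨hx, h.of_image _⟩

lemma percolates_iff {V : Set (Zd d)} : Percolates V ↔ ∃ x, InInfiniteComponent V x := by
  constructor
  · rintro ⟨C, hC⟩
    induction C using SimpleGraph.ConnectedComponent.ind with
    | h v => exact ⟨v.1, v.2, hC⟩
  · rintro ⟨x, hx, h⟩
    exact ⟨_, h⟩

lemma InInfiniteComponent.mono {V W : Set (Zd d)} (h : V ⊆ W) {x : Zd d}
    (hx : InInfiniteComponent V x) : InInfiniteComponent W x := by
  rw [inInfiniteComponent_iff] at hx ⊢
  exact ⟨h hx.1, hx.2.mono fun y hy => Linked.mono h hy⟩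

lemma Percolates.mono {V W : Set (Zd d)} (h : V ⊆ W) (hV : Percolates V) : Percolates W := by
  rw [percolates_iff] at hV ⊢
  exact hV.imp fun x hx => hx.mono h

/-! ### Coarse graining of the plane -/

/-- The planar square of side `2 R` centred at `R a`. -/
def planarBox (R : ℕ) (a : ℤ × ℤ) : Finset (ℤ × ℤ) :=
  Finset.Icc (R * a.1 - R) (R * a.1 + R) ×ˢ Finset.Icc (R * a.2 - R) (R * a.2 + R)

/-- The square of side `2 R` centred at `R a` in the coordinate plane of `ℤ^d`. -/
def coarseBox (d R : ℕ) (a : ℤ × ℤ) : Finset (Zd d) :=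
  open Classical in (planarBox R a).image (planeEmb d)

lemma planeEmb_mem_plane (t : ℤ × ℤ) : planeEmb d t ∈ plane d := by
  intro i hi
  simp [planeEmb, show (i : ℕ) ≠ 0 by omega, show (i : ℕ) ≠ 1 by omega]

lemma planeEmb_add (s t : ℤ × ℤ) : planeEmb d (s + t) = planeEmb d s + planeEmb d t := by
  ext i
  simp only [planeEmb, Pi.add_apply, Prod.fst_add, Prod.snd_add]
  split_ifs <;> simp

lemma card_planarBox (R : ℕ) (a : ℤ × ℤ) : (planarBox R a).card = (2 * R + 1) ^ 2 := by
  rw [planarBox, Finset.card_product, Int.card_Icc, Int.card_Icc, sq]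
  congr 1 <;> omega

lemma mem_planarBox {R : ℕ} {a s : ℤ × ℤ} :
    s ∈ planarBox R a ↔ (R * a.1 - R ≤ s.1 ∧ s.1 ≤ R * a.1 + R) ∧
      (R * a.2 - R ≤ s.2 ∧ s.2 ≤ R * a.2 + R) := by
  simp [planarBox, Finset.mem_product]

/-- Coarse sites whose squares are at distance at least `R`. -/
def Separated (S : Finset (ℤ × ℤ)) : Prop :=
  ∀ a ∈ S, ∀ b ∈ S, a ≠ b → 3 ≤ |a.1 - b.1| ∨ 3 ≤ |a.2 - b.2|

lemma le_dist_of_mem_planarBox {R : ℕ} {a b s t : ℤ × ℤ}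
    (h : 3 ≤ |a.1 - b.1| ∨ 3 ≤ |a.2 - b.2|) (hs : s ∈ planarBox R a) (ht : t ∈ planarBox R b) :
    (R : ℤ) ≤ |t.1 - s.1| ∨ (R : ℤ) ≤ |t.2 - s.2| := by
  rw [mem_planarBox] at hs ht
  have hR : (0 : ℤ) ≤ R := by positivity
  have key : ∀ x y : ℤ, 3 ≤ |x - y| → 3 * (R : ℤ) ≤ |R * x - R * y| := by
    intro x y h
    rw [← mul_sub, abs_mul, abs_of_nonneg hR]
    nlinarith
  rcases h with h | h
  · left
    have := key _ _ h
    rw [le_abs] at this ⊢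
    omega
  · right
    have := key _ _ h
    rw [le_abs] at this ⊢
    omega

/-- An adjacent pair of good coarse sites gives a path in the plane. -/
lemma linked_of_planarAdj {V : Set (Zd d)} {R : ℕ} {a b : ℤ × ℤ} (hab : PlanarAdj a b)
    (ha : (coarseBox d R a : Set (Zd d)) ⊆ V) (hd : 2 ≤ d) :
    Linked (lattice d).Adj (V ∩ plane d) (planeEmb d ((R : ℤ) • a)) (planeEmb d ((R : ℤ) • b)) := by
  have key : ∀ i : ℕ, i ≤ R → Linked (lattice d).Adj (V ∩ plane d) (planeEmb d ((R : ℤ) • a))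
      (planeEmb d ((R : ℤ) • a + (i : ℤ) • (b - a))) := by
    intro i
    induction i with
    | zero =>
      intro _
      simp only [Nat.cast_zero, zero_smul, add_zero]
      exact Relation.ReflTransGen.refl
    | succ i ih =>
      intro hi
      have h1 : |b.1 - a.1| + |b.2 - a.2| = 1 := hab
      have hb1 : |b.1 - a.1| ≤ 1 := by linarith [abs_nonneg (b.2 - a.2)]
      have hb2 : |b.2 - a.2| ≤ 1 := by linarith [abs_nonneg (b.1 - a.1)]
      rw [abs_le] at hb1 hb2
      refine Relation.ReflTransGen.tail (ih (by omega)) ⟨?_, ha ?_, planeEmb_mem_plane _⟩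
      · have e : (R : ℤ) • a + ((i + 1 : ℕ) : ℤ) • (b - a) =
            (R : ℤ) • a + (i : ℤ) • (b - a) + (b - a) := by
          push_cast
          rw [add_smul, one_smul, add_assoc]
        rw [e, planeEmb_add ((R : ℤ) • a + (i : ℤ) • (b - a)) (b - a)]
        simp only [lattice, Pi.add_apply, sub_add_cancel_left, neg_sq]
        have h2 : ∑ j : Fin d, planeEmb d (b - a) j ^ 2 =
            ∑ j ∈ {(⟨0, by omega⟩ : Fin d), ⟨1, by omega⟩}, planeEmb d (b - a) j ^ 2 := by
          symm
          refine Finset.sum_subset (Finset.subset_univ _) fun j _ hj => ?_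
          simp only [Finset.mem_insert, Finset.mem_singleton, Fin.ext_iff, not_or] at hj
          simp [planeEmb, hj.1, hj.2]
        rw [h2, Finset.sum_pair (by simp)]
        simp only [planeEmb, Prod.fst_sub, Prod.snd_sub]
        simp only [if_true, one_ne_zero, if_false]
        rcases abs_cases (b.1 - a.1) with h3 | h3 <;> rcases abs_cases (b.2 - a.2) with h4 | h4 <;>
          have h5 : (b.1 - a.1 = 0 ∨ b.1 - a.1 = 1 ∨ b.1 - a.1 = -1) := by omega
        all_goals
          rcases h5 with h5 | h5 | h5
          · have h6 : b.2 - a.2 = 1 ∨ b.2 - a.2 = -1 := by omega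
            rcases h6 with h6 | h6 <;> rw [h5, h6] <;> norm_num
          · have h6 : b.2 - a.2 = 0 := by omega
            rw [h5, h6]; norm_num
          · have h6 : b.2 - a.2 = 0 := by omega
            rw [h5, h6]; norm_num
      · refine Finset.mem_coe.2 (Finset.mem_image_of_mem _ (mem_planarBox.2 ?_))
        have hi0 : (0 : ℤ) ≤ ((i + 1 : ℕ) : ℤ) := by positivity
        have hiR : ((i + 1 : ℕ) : ℤ) ≤ R := by exact_mod_cast hi
        simp only [Prod.fst_add, Prod.snd_add, Prod.smul_fst, Prod.smul_snd, Prod.fst_sub,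
          Prod.snd_sub, smul_eq_mul]
        refine ⟨⟨?_, ?_⟩, ?_, ?_⟩ <;> nlinarith
  have := key R le_rfl
  rwa [← smul_add, add_sub_cancel] at this

/-- The coarse sites whose squares are contained in `V`. -/
def goodSites (V : Set (Zd d)) (R : ℕ) : Set (ℤ × ℤ) := {a | (coarseBox d R a : Set (Zd d)) ⊆ V}

lemma inInfiniteComponent_of_goodSites {V : Set (Zd d)} {R : ℕ} (hR : 0 < R) (hd : 2 ≤ d)
    {a : ℤ × ℤ} (ha : a ∈ goodSites V R)
    (h : {b | Linked PlanarAdj (goodSites V R) a b}.Infinite) :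
    InInfiniteComponent (V ∩ plane d) (planeEmb d ((R : ℤ) • a)) := by
  have hR' : (R : ℤ) ≠ 0 := by exact_mod_cast hR.ne'
  rw [inInfiniteComponent_iff]
  refine ⟨⟨ha (Finset.mem_coe.2 (Finset.mem_image_of_mem _ (mem_planarBox.2 ?_))),
    planeEmb_mem_plane _⟩, ?_⟩
  · simp only [Prod.smul_fst, Prod.smul_snd, smul_eq_mul]
    omega
  have hinj : Function.Injective fun b : ℤ × ℤ => planeEmb d ((R : ℤ) • b) :=
    (planeEmb_injective hd).comp (smul_right_injective _ hR')
  refine (h.image hinj.injOn).mono ?_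
  rintro _ ⟨b, hb, rfl⟩
  change Linked PlanarAdj (goodSites V R) a b at hb
  change Linked _ _ _ _
  induction hb with
  | refl => exact Relation.ReflTransGen.refl
  | @tail b c hb hbc ih =>
    exact Relation.ReflTransGen.trans ih
      (linked_of_planarAdj hbc.1 (Linked.mem (V := goodSites V R) ha hb) hd)

/-- `m + 1` distinct sites of `B` in succession, starting at `(m, 0)`. -/
def HasStarPath (B : Set (ℤ × ℤ)) (m : ℕ) : Prop :=
  ∃ q : ℕ → ℤ × ℤ, q 0 = ((m : ℤ), 0) ∧ (∀ i < m, StarAdj (q i) (q (i + 1))) ∧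
    InjOn q (Iic m) ∧ ∀ i ≤ m, q i ∈ B

lemma exists_hasStarPath {G V : Set (ℤ × ℤ)} {n : ℕ} (hGV : G ⊆ V)
    (hV : ∀ i : ℤ, 0 ≤ i → i ≤ n → (i, 0) ∈ V)
    (hfin : {p | Linked PlanarAdj V (0, 0) p}.Finite) : ∃ m, n < m ∧ HasStarPath Gᶜ m := by
  obtain ⟨k, hk, hkV, x, hx, h⟩ := exists_contour hV hfin
  obtain ⟨m, rfl⟩ := Int.eq_ofNat_of_zero_le (show 0 ≤ k by omega)
  exact ⟨m, by exact_mod_cast hk, exists_injective_starPath (fun h => hkV (hGV h)) hx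
    (Linked.mono (compl_subset_compl.2 hGV) h)⟩

lemma infinite_cluster_zero {G : Set (ℤ × ℤ)} (h : ∀ m, ¬ HasStarPath Gᶜ m) :
    (0, 0) ∈ G ∧ {p | Linked PlanarAdj G (0, 0) p}.Infinite := by
  have h0 : ((0 : ℤ), (0 : ℤ)) ∈ G := by
    by_contra h0
    exact h 0 ⟨fun _ => (0, 0), rfl, fun i hi => absurd hi (Nat.not_lt_zero i),
      fun i hi j hj _ => (Nat.le_zero.1 hi).trans (Nat.le_zero.1 hj).symm, fun _ _ => h0⟩
  refine ⟨h0, fun hfin => ?_⟩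
  obtain ⟨m, -, hm⟩ := exists_hasStarPath (n := 0) le_rfl (fun i h1 h2 => by
    rwa [show i = 0 from le_antisymm (by exact_mod_cast h2) h1]) hfin
  exact h m hm

/-- Filling in the segment from `0` to `(n, 0)` creates an infinite cluster, since there is no
contour around it; the finitely many sites filled in join finitely many clusters of `G`, so that one
of these is infinite. -/
lemma exists_infinite_cluster {G : Set (ℤ × ℤ)} {n : ℕ} (h : ∀ m, n ≤ m → ¬ HasStarPath Gᶜ m) :
    ∃ p ∈ G, {q | Linked PlanarAdj G p q}.Infinite := by
  by_contra! hcon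
  set I : Set (ℤ × ℤ) := (Icc (0 : ℤ) n) ×ˢ {0} with hI
  set N : Set (ℤ × ℤ) := (Icc (-1 : ℤ) (n + 1)) ×ˢ (Icc (-1 : ℤ) 1) with hN
  have hIfin : I.Finite := (finite_Icc _ _).prod (finite_singleton _)
  have hNfin : N.Finite := (finite_Icc _ _).prod (finite_Icc _ _)
  have hfin : {p | Linked PlanarAdj (G ∪ I) (0, 0) p}.Finite := by
    refine (hIfin.union ((hNfin.inter_of_left G).biUnion fun p hp => hcon p hp.2)).subset ?_
    intro p hp
    change Linked PlanarAdj (G ∪ I) (0, 0) p at hp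
    induction hp with
    | refl => exact Or.inl ⟨⟨le_rfl, by simp⟩, rfl⟩
    | @tail b c hb hbc ih =>
      by_cases hcI : c ∈ I
      · exact Or.inl hcI
      · have hcG : c ∈ G := hbc.2.resolve_right hcI
        refine Or.inr ?_
        rcases ih with hbI | hb'
        · refine mem_iUnion₂.2 ⟨c, ⟨?_, hcG⟩, Relation.ReflTransGen.refl⟩
          have h1 : |c.1 - b.1| + |c.2 - b.2| = 1 := hbc.1
          have hb1 : |c.1 - b.1| ≤ 1 := by linarith [abs_nonneg (c.2 - b.2)]
          have hb2 : |c.2 - b.2| ≤ 1 := by linarith [abs_nonneg (c.1 - b.1)]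
          rw [abs_le] at hb1 hb2
          obtain ⟨⟨h2, h3⟩, h4⟩ := hbI
          simp only [mem_singleton_iff] at h4
          refine ⟨⟨?_, ?_⟩, ?_, ?_⟩ <;> omega
        · obtain ⟨z, hz, hzb⟩ := mem_iUnion₂.1 hb'
          exact mem_iUnion₂.2 ⟨z, hz, Relation.ReflTransGen.tail hzb ⟨hbc.1, hcG⟩⟩
  obtain ⟨m, hm, hm'⟩ := exists_hasStarPath (n := n) (G := G) (V := G ∪ I) subset_union_left
    (fun i h1 h2 => Or.inr ⟨⟨h1, h2⟩, rfl⟩) hfin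
  exact h m hm.le hm'

end Components

/-! ### The Peierls estimate -/

section Peierls

variable {d : ℕ} [NeZero d]

lemma sum_green_planeEmb_le (T : Finset (ℤ × ℤ)) (s : ℤ × ℤ) {A : Set (ℤ × ℤ)}
    (hT : ∀ t ∈ T, t - s ∈ A) :
    ∑ t ∈ T, green (planeEmb d s) (planeEmb d t) ≤ ∑' a : A, green 0 (planeEmb d a) := by
  classical
  have h1 : ∑ t ∈ T, green (planeEmb d s) (planeEmb d t) =
      ∑ t ∈ T.attach, green 0 (planeEmb d (⟨t.1 - s, hT t.1 t.2⟩ : A).1) := by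
    rw [← Finset.sum_attach]
    refine Finset.sum_congr rfl fun t _ => ?_
    have := green_add (0 : Zd d) (planeEmb d (t.1 - s)) (planeEmb d s)
    rw [zero_add, ← planeEmb_add, sub_add_cancel] at this
    exact this
  have hinj : Function.Injective fun t : {t // t ∈ T} => (⟨t.1 - s, hT t.1 t.2⟩ : A) := by
    intro t t' h
    exact Subtype.ext (sub_left_injective (congrArg Subtype.val h))
  rw [h1, ← Finset.sum_image (s := T.attach) (g := fun t => (⟨t.1 - s, hT t.1 t.2⟩ : A))
    (f := fun a : A => green 0 (planeEmb d a.1)) hinj.injOn]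
  exact ENNReal.sum_le_tsum _

lemma tsum_green_planeEmb_le (hd : 7 ≤ d) : ∑' a : ℤ × ℤ, green 0 (planeEmb d a) ≤ 24 := by
  simpa using tsum_green_plane_le hd 0 0

/-- The Green function is summable over the plane, so its mass far away is small. -/
lemma exists_tail_green_le (hd : 7 ≤ d) {ε : ℝ≥0∞} (hε : 0 < ε) :
    ∃ R : ℕ, 0 < R ∧ ∑' a : {a : ℤ × ℤ | (R : ℤ) ≤ |a.1| ∨ (R : ℤ) ≤ |a.2|},
      green 0 (planeEmb d a) ≤ ε := by
  have h := ENNReal.tendsto_tsum_compl_atTop_zero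
    (((tsum_green_planeEmb_le hd).trans_lt (by norm_num)).ne)
  obtain ⟨F, hF⟩ := (h.eventually (ge_mem_nhds hε)).exists
  refine ⟨(F.sup fun a => a.1.natAbs + a.2.natAbs) + 1, Nat.succ_pos _, le_trans ?_ hF⟩
  refine ENNReal.tsum_mono_subtype (t := {a | a ∉ F}) (fun a => green 0 (planeEmb d a)) ?_
  intro a ha haF
  have := Finset.le_sup (f := fun a : ℤ × ℤ => a.1.natAbs + a.2.natAbs) haF
  rcases ha with ha | ha <;> push_cast at ha <;> rw [Int.abs_eq_natAbs] at ha <;> omega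

omit [NeZero d] in
lemma sum_coarseBox (hd : 2 ≤ d) (R : ℕ) (a : ℤ × ℤ) (f : Zd d → ℝ≥0∞) :
    ∑ z ∈ coarseBox d R a, f z = ∑ t ∈ planarBox R a, f (planeEmb d t) :=
  Finset.sum_image (planeEmb_injective hd).injOn

omit [NeZero d] in
lemma sum_sum_coarseBox (hd : 2 ≤ d) {R : ℕ} (hR : 0 < R) {S : Finset (ℤ × ℤ)} (hS : Separated S)
    (f : Zd d → ℝ≥0∞) :
    ∑ a ∈ S, ∑ z ∈ coarseBox d R a, f z = ∑ t ∈ S.biUnion (planarBox R), f (planeEmb d t) := by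
  rw [Finset.sum_biUnion]
  · exact Finset.sum_congr rfl fun a _ => sum_coarseBox hd R a f
  · intro a ha b hb hab
    refine Finset.disjoint_left.2 fun t hta htb => ?_
    have := le_dist_of_mem_planarBox (hS a ha b hb hab) hta htb
    simp only [sub_self, abs_zero] at this
    omega

lemma Separated.subset {S T : Finset (ℤ × ℤ)} (h : Separated T) (hST : S ⊆ T) : Separated S :=
  fun a ha b hb => h a (hST ha) b (hST hb)

/-- The rate `32⁻⁹` of the Peierls estimate. Extracting a separated set from an arbitrary one costs
a power `9`, and the remaining rate `32⁻¹` beats the number `9 ^ m` of `*`-paths of `m` steps. -/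
lemma exists_prob_separated_le (hd : 7 ≤ d) :
    ∃ R : ℕ, 0 < R ∧ ∃ u₀ : ℝ≥0, 0 < u₀ ∧ ∀ (P : Measure (Config d)), IsInterlacementLaw P →
      ∀ u ≤ u₀, ∀ S : Finset (ℤ × ℤ), Separated S →
        P {ω | ∀ a ∈ S, a ∉ goodSites (vacant ω u) R} ≤ ((32 ^ 9)⁻¹ : ℝ≥0∞) ^ S.card := by
  set lam : ℝ≥0 := 3 * 32 ^ 9 with hlam
  have hlam1 : (1 : ℝ≥0) ≤ lam := by rw [hlam]; norm_num
  obtain ⟨R, hR, hε⟩ := exists_tail_green_le hd (ε := (2 * (lam : ℝ≥0∞))⁻¹)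
    (ENNReal.inv_pos.2 (ENNReal.mul_ne_top (by norm_num) ENNReal.coe_ne_top))
  have hd2 : 2 ≤ d := by omega
  -- `v` bounds the exponential moment per box; the level `1 / v` makes the Poisson factor at most
  -- `exp 1 ≤ 3` per box, which the factor `3` in `lam` compensates
  set v : ℝ≥0 := (2 * R + 1) ^ 2 * (1 + 2 * lam * 24) with hv
  have hv0 : 0 < v := by positivity
  refine ⟨R, hR, v⁻¹, inv_pos.2 hv0, fun P hP u hu S hS => ?_⟩
  have hc := lintegral_intensity_hits_le hd (lam := lam) (ε := (2 * (lam : ℝ≥0∞))⁻¹) (G := 24)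
    (by exact_mod_cast hlam1) (by
      rw [ENNReal.mul_inv_cancel]
      · simp [hlam]
      · exact ENNReal.mul_ne_top (by norm_num) ENNReal.coe_ne_top) (coarseBox d R) S
    (by
      intro a ha x hx
      obtain ⟨s, hs, rfl⟩ := Finset.mem_image.1 hx
      rw [sum_sum_coarseBox hd2 hR (hS.subset (Finset.erase_subset _ _))]
      refine (sum_green_planeEmb_le _ s fun t ht => ?_).trans hε
      obtain ⟨b, hb, htb⟩ := Finset.mem_biUnion.1 ht
      exact le_dist_of_mem_planarBox
        (hS a ha b (Finset.mem_of_mem_erase hb) (Finset.ne_of_mem_erase hb).symm) hs htb)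
    (by
      intro a ha x hx
      obtain ⟨s, hs, rfl⟩ := Finset.mem_image.1 hx
      rw [sum_sum_coarseBox hd2 hR hS]
      refine (sum_green_planeEmb_le (A := univ) _ s fun t ht => mem_univ _).trans ?_
      rw [tsum_univ (fun a => green 0 (planeEmb d a))]
      exact tsum_green_planeEmb_le hd)
  have hcard : (S.biUnion (coarseBox d R)).card ≤ S.card * (2 * R + 1) ^ 2 := by
    refine Finset.card_biUnion_le_card_mul _ _ _ fun a _ => ?_
    exact Finset.card_image_le.trans (card_planarBox R a).le
  have hc' := hc.trans (b := _) (c := ((S.card * v : ℝ≥0) : ℝ≥0∞)) (by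
    calc ((S.biUnion (coarseBox d R)).card : ℝ≥0∞) * (1 + 2 * lam * 24)
        ≤ ((S.card * (2 * R + 1) ^ 2 : ℕ) : ℝ≥0∞) * (1 + 2 * lam * 24) := by
          gcongr
      _ = ((S.card * v : ℝ≥0) : ℝ≥0∞) := by
          rw [hv]
          push_cast
          ring)
  have h := prob_all_hit_le hd hP (coarseBox d R) S u lam _ hlam1 hc'
  have hev : {ω : Config d | ∀ a ∈ S, a ∉ goodSites (vacant ω u) R} =
      {ω | ∀ a ∈ S, ω.1 (entering (coarseBox d R a) ×ˢ Iic u) ≠ 0} := by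
    ext ω
    simp only [mem_ofPred_eq, goodSites, subset_vacant_iff, ne_eq]
  rw [hev]
  have hexp : ENNReal.ofReal (Real.exp (u * (S.card * v : ℝ≥0))) ≤ 3 ^ S.card := by
    have h1 : (u : ℝ) * v ≤ 1 := by
      have : u * v ≤ 1 := (mul_le_mul_left hu v).trans (inv_mul_cancel₀ hv0.ne').le
      exact_mod_cast this
    have h2 : Real.exp (u * (S.card * v : ℝ≥0)) ≤ 3 ^ S.card := by
      calc Real.exp (u * (S.card * v : ℝ≥0)) ≤ Real.exp (S.card * 1) := by
            apply Real.exp_le_exp.2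
            push_cast
            nlinarith [(Nat.cast_nonneg S.card : (0 : ℝ) ≤ S.card)]
        _ = Real.exp 1 ^ S.card := by rw [Real.exp_nat_mul]
        _ ≤ 3 ^ S.card := by
            gcongr
            exact Real.exp_one_lt_three.le
    refine (ENNReal.ofReal_le_ofReal h2).trans ?_
    rw [ENNReal.ofReal_pow (by norm_num)]
    simp
  have h3 := h.trans hexp
  have hlam' : (lam : ℝ≥0∞) ^ S.card = 3 ^ S.card * (32 ^ 9) ^ S.card := by
    rw [← mul_pow, hlam]
    push_cast
    rfl
  rw [hlam', mul_left_comm] at h3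
  have h4 := (ENNReal.mul_le_mul_iff_right (a := 3 ^ S.card) (c := 1) (by positivity)
    (ENNReal.pow_ne_top (by norm_num))).1 (h3.trans (mul_one _).ge)
  rw [← ENNReal.inv_pow]
  exact (ENNReal.le_inv_iff_mul_le).2 h4

/-- A ninth of any finite set of coarse sites is separated: sort the sites by their residues
modulo `3`. -/
lemma exists_separated_subset (A : Finset (ℤ × ℤ)) :
    ∃ S ⊆ A, Separated S ∧ A.card ≤ 9 * S.card := by
  classical
  let f : ℤ × ℤ → ZMod 3 × ZMod 3 := fun a => ((a.1 : ZMod 3), (a.2 : ZMod 3))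
  have hsum : A.card = ∑ r : ZMod 3 × ZMod 3, (A.filter fun a => f a = r).card :=
    Finset.card_eq_sum_card_fiberwise fun _ _ => Finset.mem_coe.2 (Finset.mem_univ _)
  obtain ⟨r, -, hr⟩ : ∃ r ∈ (Finset.univ : Finset (ZMod 3 × ZMod 3)),
      ∀ r' ∈ (Finset.univ : Finset (ZMod 3 × ZMod 3)),
        (A.filter fun a => f a = r').card ≤ (A.filter fun a => f a = r).card :=
    Finset.exists_max_image _ _ Finset.univ_nonempty
  refine ⟨A.filter fun a => f a = r, Finset.filter_subset _ _, ?_, ?_⟩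
  · intro a ha b hb hab
    have hfa := (Finset.mem_filter.1 ha).2
    have hfb := (Finset.mem_filter.1 hb).2
    have h1 : (3 : ℤ) ∣ a.1 - b.1 := by
      have := congrArg Prod.fst (hfa.trans hfb.symm)
      exact (ZMod.intCast_eq_intCast_iff_dvd_sub b.1 a.1 3).1 this.symm
    have h2 : (3 : ℤ) ∣ a.2 - b.2 := by
      have := congrArg Prod.snd (hfa.trans hfb.symm)
      exact (ZMod.intCast_eq_intCast_iff_dvd_sub b.2 a.2 3).1 this.symm
    by_cases h : a.1 - b.1 = 0
    · have : a.2 - b.2 ≠ 0 := fun h' => hab (Prod.ext (by omega) (by omega))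
      exact Or.inr (Int.le_of_dvd (abs_pos.2 this) ((dvd_abs _ _).2 h2))
    · exact Or.inl (Int.le_of_dvd (abs_pos.2 h) ((dvd_abs _ _).2 h1))
  · calc A.card ≤ ∑ _r : ZMod 3 × ZMod 3, (A.filter fun a => f a = r).card :=
          hsum.le.trans (Finset.sum_le_sum fun r' hr' => hr r' hr')
      _ = 9 * _ := by
        rw [Finset.sum_const, smul_eq_mul, Finset.card_univ, Fintype.card_prod, ZMod.card]

lemma exists_prob_bad_le (hd : 7 ≤ d) :
    ∃ R : ℕ, 0 < R ∧ ∃ u₀ : ℝ≥0, 0 < u₀ ∧ ∀ (P : Measure (Config d)), IsInterlacementLaw P →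
      ∀ u ≤ u₀, ∀ A : Finset (ℤ × ℤ),
        P {ω | ∀ a ∈ A, a ∉ goodSites (vacant ω u) R} ≤ (32⁻¹ : ℝ≥0∞) ^ A.card := by
  obtain ⟨R, hR, u₀, hu₀, h⟩ := exists_prob_separated_le hd
  refine ⟨R, hR, u₀, hu₀, fun P hP u hu A => ?_⟩
  obtain ⟨S, hSA, hS, hcard⟩ := exists_separated_subset A
  calc P {ω | ∀ a ∈ A, a ∉ goodSites (vacant ω u) R}
      ≤ P {ω | ∀ a ∈ S, a ∉ goodSites (vacant ω u) R} :=
        measure_mono fun ω hω a ha => hω a (hSA ha)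
    _ ≤ ((32 ^ 9)⁻¹ : ℝ≥0∞) ^ S.card := h P hP u hu S hS
    _ = (32⁻¹ : ℝ≥0∞) ^ (9 * S.card) := by rw [pow_mul, ENNReal.inv_pow]
    _ ≤ (32⁻¹ : ℝ≥0∞) ^ A.card := pow_le_pow_right_of_le_one' (by norm_num) hcard

omit [NeZero d] in
/-- Union bound over the `9 ^ m` possible sequences of `m` steps. -/
lemma prob_hasStarPath_le {P : Measure (Config d)} {B : Config d → Set (ℤ × ℤ)}
    (h : ∀ A : Finset (ℤ × ℤ), P {ω | ∀ a ∈ A, a ∈ B ω} ≤ (32⁻¹ : ℝ≥0∞) ^ A.card) (m : ℕ) :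
    P {ω | HasStarPath (B ω) m} ≤ 32⁻¹ * 2⁻¹ ^ m := by
  classical
  set Δ : Finset (ℤ × ℤ) := Finset.Icc (-1) 1 ×ˢ Finset.Icc (-1) 1 with hΔ
  set Γ : Finset (Fin m → ℤ × ℤ) := Fintype.piFinset fun _ => Δ with hΓ
  let path : (Fin m → ℤ × ℤ) → ℕ → ℤ × ℤ := fun γ i =>
    ((m : ℤ), 0) + ∑ j ∈ Finset.range i, if h : j < m then γ ⟨j, h⟩ else 0
  let A : (Fin m → ℤ × ℤ) → Finset (ℤ × ℤ) := fun γ => (Finset.range (m + 1)).image (path γ)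
  have hcover : {ω | HasStarPath (B ω) m} ⊆
      ⋃ γ ∈ Γ.filter fun γ => (A γ).card = m + 1, {ω | ∀ a ∈ A γ, a ∈ B ω} := by
    rintro ω ⟨q, hq0, hstep, hinj, hqB⟩
    let γ : Fin m → ℤ × ℤ := fun j => q (j + 1) - q j
    have hpath : ∀ i ≤ m, path γ i = q i := by
      intro i
      induction i with
      | zero => intro _; simp [path, hq0]
      | succ i ih =>
        intro hi
        have := ih (by omega)
        simp only [path] at this ⊢
        rw [Finset.sum_range_succ, ← add_assoc, this, dif_pos (show i < m by omega)]
        exact add_sub_cancel _ _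
    have hA : A γ = (Finset.range (m + 1)).image q :=
      Finset.image_congr fun i hi => hpath i (by simpa [Nat.lt_succ_iff] using hi)
    refine mem_iUnion₂.2 ⟨γ, Finset.mem_filter.2 ⟨?_, ?_⟩, ?_⟩
    · refine Fintype.mem_piFinset.2 fun j => ?_
      obtain ⟨h1, h2⟩ := hstep j j.2
      rw [abs_le] at h1 h2
      simp only [hΔ, Finset.mem_product, Finset.mem_Icc, γ, Prod.fst_sub, Prod.snd_sub]
      exact ⟨h1, h2⟩
    · rw [hA, Finset.card_image_of_injOn, Finset.card_range]
      exact hinj.mono fun i hi => by simpa [Nat.lt_succ_iff] using hi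
    · intro a ha
      rw [hA] at ha
      obtain ⟨i, hi, rfl⟩ := Finset.mem_image.1 ha
      exact hqB i (by simpa [Nat.lt_succ_iff] using hi)
  have hΓcard : Γ.card = 9 ^ m := by
    rw [hΓ, Fintype.card_piFinset, Finset.prod_const, Finset.card_univ, Fintype.card_fin]
    rfl
  calc P {ω | HasStarPath (B ω) m}
      ≤ ∑ γ ∈ Γ.filter fun γ => (A γ).card = m + 1, P {ω | ∀ a ∈ A γ, a ∈ B ω} :=
        (measure_mono hcover).trans (measure_biUnion_finset_le _ _)
    _ ≤ ∑ γ ∈ Γ.filter fun γ => (A γ).card = m + 1, (32⁻¹ : ℝ≥0∞) ^ (m + 1) :=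
        Finset.sum_le_sum fun γ hγ => (h _).trans_eq (by rw [(Finset.mem_filter.1 hγ).2])
    _ ≤ ∑ γ ∈ Γ, (32⁻¹ : ℝ≥0∞) ^ (m + 1) :=
        Finset.sum_le_sum_of_subset (Finset.filter_subset _ _)
    _ = 32⁻¹ * (9 * 32⁻¹) ^ m := by
        rw [Finset.sum_const, hΓcard, nsmul_eq_mul, mul_pow, pow_succ]
        push_cast
        ring
    _ ≤ _ := by
        gcongr
        rw [← div_eq_mul_inv]
        refine ENNReal.div_le_of_le_mul ?_
        calc (9 : ℝ≥0∞) ≤ 16 := by norm_num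
          _ = 2⁻¹ * (2 * 16) := by
            rw [← mul_assoc, ENNReal.inv_mul_cancel (by norm_num) (by norm_num), one_mul]
          _ = _ := by norm_num

/-- Percolation at low levels, in the plane and at the origin. -/
theorem exists_percolation_level (hd : 7 ≤ d) :
    ∃ u₀ : ℝ≥0, 0 < u₀ ∧ ∀ (P : Measure (Config d)) [IsProbabilityMeasure P],
      IsInterlacementLaw P → ∀ u ≤ u₀, eta P u ≠ 0 ∧
        ∀ᵐ ω ∂P, Percolates (vacant ω u ∩ plane d) := by
  obtain ⟨R, hR, u₀, hu₀, h⟩ := exists_prob_bad_le hd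
  refine ⟨u₀, hu₀, fun P _ hP u hu => ?_⟩
  have hd2 : 2 ≤ d := by omega
  have hpath := prob_hasStarPath_le (P := P) (B := fun ω => (goodSites (vacant ω u) R)ᶜ)
    (h P hP u hu)
  have hsum : ∑' m, P {ω | HasStarPath (goodSites (vacant ω u) R)ᶜ m} ≤ 16⁻¹ := by
    refine (ENNReal.tsum_le_tsum hpath).trans ?_
    rw [ENNReal.tsum_mul_left, ENNReal.tsum_geometric, ENNReal.one_sub_inv_two, inv_inv, mul_comm,
      ← div_eq_mul_inv]
    refine ENNReal.div_le_of_le_mul ?_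
    rw [show (32 : ℝ≥0∞) = 16 * 2 by norm_num, ← mul_assoc,
      ENNReal.inv_mul_cancel (by norm_num) (by norm_num), one_mul]
  constructor
  -- with probability at least `15 / 16` no `*`-path of bad boxes separates the origin from infinity
  · intro h0
    have hcover : (univ : Set (Config d)) ⊆ {ω | InInfiniteComponent (vacant ω u) 0} ∪
        ⋃ m, {ω | HasStarPath (goodSites (vacant ω u) R)ᶜ m} := by
      intro ω _
      by_cases hω : ∀ m, ¬ HasStarPath (goodSites (vacant ω u) R)ᶜ m
      · obtain ⟨hg, hinf⟩ := infinite_cluster_zero hω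
        have := inInfiniteComponent_of_goodSites hR hd2 hg hinf
        have e : planeEmb d ((R : ℤ) • ((0 : ℤ), (0 : ℤ))) = 0 := by
          ext i
          simp [planeEmb]
        rw [e] at this
        exact Or.inl (this.mono inter_subset_left)
      · push Not at hω
        exact Or.inr (mem_iUnion.2 hω)
    have h1 := (measure_mono (μ := P) hcover).trans (measure_union_le _ _)
    rw [measure_univ, show P {ω | InInfiniteComponent (vacant ω u) 0} = 0 from h0, zero_add] at h1
    have h2 := h1.trans ((measure_iUnion_le _).trans hsum)
    rw [ENNReal.one_le_inv] at h2
    norm_num at h2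
  -- Borel–Cantelli over the starting points of the `*`-paths
  · have hfin : ∑' m, P {ω | HasStarPath (goodSites (vacant ω u) R)ᶜ m} ≠ ∞ :=
      (hsum.trans_lt (by norm_num)).ne
    filter_upwards [ae_eventually_notMem hfin] with ω hω
    obtain ⟨n, hn⟩ := eventually_atTop.1 hω
    obtain ⟨a, ha, hinf⟩ := exists_infinite_cluster (G := goodSites (vacant ω u) R) hn
    exact percolates_iff.2 ⟨_, inInfiniteComponent_of_goodSites hR hd2 ha hinf⟩

end Peierls

/-! ### Mixing of the vacant set and the zero-one law -/

section Mixing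

variable {d : ℕ} [NeZero d]

lemma walkLaw_add (x a : Zd d) : walkLaw (x + a) = (walkLaw x).map fun X n => X n + a := by
  have hm : Measurable fun (X : ℕ → Zd d) (n : ℕ) => X n + a :=
    measurable_pi_iff.2 fun n => (measurable_pi_apply n).add measurable_const
  rw [walkLaw, walkLaw, Measure.map_map hm (measurable_partialSums x)]
  congr 1
  ext s n
  simp only [Function.comp, add_right_comm]

/-- The translate `K + a`. -/
def translate {d : ℕ} (K : Finset (Zd d)) (a : Zd d) : Finset (Zd d) :=
  K.map (Equiv.addRight a).toEmbedding

omit [NeZero d] in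
lemma add_mem_translate {K : Finset (Zd d)} {x a : Zd d} : x + a ∈ translate K a ↔ x ∈ K := by
  simp [translate]

lemma capacity_translate (K : Finset (Zd d)) (a : Zd d) :
    capacity (translate K a) = capacity K := by
  rw [capacity, translate, Finset.sum_map]
  refine Finset.sum_congr rfl fun x hx => ?_
  have hm : Measurable fun (X : ℕ → Zd d) (n : ℕ) => X n + a :=
    measurable_pi_iff.2 fun n => (measurable_pi_apply n).add measurable_const
  change equilibrium (translate K a) (x + a) = _
  rw [equilibrium_of_mem (add_mem_translate.2 hx), equilibrium_of_mem hx, walkLaw_add,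
    Measure.map_apply hm (measurableSet_noReturn _)]
  congr 1
  ext X
  simp only [mem_preimage, noReturn, mem_ofPred_eq, add_mem_translate]

lemma equilibrium_anti {K M : Finset (Zd d)} (h : K ⊆ M) {x : Zd d} (hx : x ∈ K) :
    equilibrium M x ≤ equilibrium K x := by
  rw [equilibrium_of_mem hx, equilibrium_of_mem (h hx)]
  exact measure_mono fun X hX n hn hXn => hX n hn (h hXn)

lemma equilibrium_le_union_add (K K' : Finset (Zd d)) {x : Zd d} (hx : x ∈ K) :
    equilibrium K x ≤ equilibrium (K ∪ K') x + ∑ z ∈ K', green x z := by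
  refine le_trans ?_ (add_le_add_right (hitProb_le K' x) _)
  rw [equilibrium_of_mem hx, equilibrium_of_mem (Finset.mem_union_left _ hx), hitProb]
  refine (measure_mono fun X hX => ?_).trans (measure_union_le _ _)
  by_cases h : ∃ n, X n ∈ K'
  · exact Or.inr h
  · exact Or.inl fun n hn hn' =>
      (Finset.mem_union.1 hn').elim (hX n hn) fun h' => h ⟨n, h'⟩

lemma capacity_union_le (K K' : Finset (Zd d)) :
    capacity (K ∪ K') ≤ capacity K + capacity K' := by
  calc capacity (K ∪ K') ≤ ∑ x ∈ K ∪ K', equilibrium (K ∪ K') x +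
        ∑ x ∈ K ∩ K', equilibrium (K ∪ K') x := le_self_add
    _ = ∑ x ∈ K, equilibrium (K ∪ K') x + ∑ x ∈ K', equilibrium (K ∪ K') x :=
      Finset.sum_union_inter
    _ ≤ _ := add_le_add
      (Finset.sum_le_sum fun x hx => equilibrium_anti Finset.subset_union_left hx)
      (Finset.sum_le_sum fun x hx => equilibrium_anti Finset.subset_union_right hx)

/-- Capacity is almost additive for sets that are far apart. -/
lemma capacity_add_le (K K' : Finset (Zd d)) :
    capacity K + capacity K' ≤ capacity (K ∪ K') + 3 * ∑ x ∈ K, ∑ z ∈ K', green x z := by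
  have h1 : capacity K ≤ ∑ x ∈ K, equilibrium (K ∪ K') x + ∑ x ∈ K, ∑ z ∈ K', green x z := by
    rw [← Finset.sum_add_distrib]
    exact Finset.sum_le_sum fun x hx => equilibrium_le_union_add K K' hx
  have h2 : capacity K' ≤ ∑ x ∈ K', equilibrium (K ∪ K') x + ∑ x ∈ K, ∑ z ∈ K', green x z := by
    rw [Finset.sum_comm, ← Finset.sum_add_distrib]
    refine Finset.sum_le_sum fun x hx => ?_
    have := equilibrium_le_union_add K' K hx
    simp_rw [Finset.union_comm K K', green_symm _ x]
    exact this
  have h3 : ∑ x ∈ K ∩ K', equilibrium (K ∪ K') x ≤ ∑ x ∈ K, ∑ z ∈ K', green x z := by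
    calc ∑ x ∈ K ∩ K', equilibrium (K ∪ K') x ≤ ∑ x ∈ K ∩ K', ∑ z ∈ K', green x z := by
          refine Finset.sum_le_sum fun x hx => ?_
          exact (equilibrium_le_one _ x).trans ((one_le_green x).trans
            (Finset.single_le_sum (f := fun z => green x z) (fun _ _ => zero_le)
              (Finset.mem_inter.1 hx).2))
      _ ≤ _ := Finset.sum_le_sum_of_subset Finset.inter_subset_left
  calc capacity K + capacity K'
      ≤ (∑ x ∈ K, equilibrium (K ∪ K') x + ∑ x ∈ K, ∑ z ∈ K', green x z) +
        (∑ x ∈ K', equilibrium (K ∪ K') x + ∑ x ∈ K, ∑ z ∈ K', green x z) := add_le_add h1 h2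
    _ = (∑ x ∈ K ∪ K', equilibrium (K ∪ K') x + ∑ x ∈ K ∩ K', equilibrium (K ∪ K') x) +
        2 * ∑ x ∈ K, ∑ z ∈ K', green x z := by
      rw [Finset.sum_union_inter]
      ring
    _ ≤ (capacity (K ∪ K') + ∑ x ∈ K, ∑ z ∈ K', green x z) +
        2 * ∑ x ∈ K, ∑ z ∈ K', green x z := by
      gcongr
      exact le_rfl
    _ = _ := by ring

/-- The Green function tends to `0` along the plane, because it is summable there. -/
lemma tendsto_capacity_union (hd : 7 ≤ d) (K K' : Finset (Zd d)) :
    Tendsto (fun n : ℕ => capacity (K ∪ translate K' (planeEmb d ((n : ℤ), 0)))) atTop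
      (nhds (capacity K + capacity K')) := by
  have hg : ∀ x z : Zd d, Tendsto (fun n : ℕ => green x (z + planeEmb d ((n : ℤ), 0))) atTop
      (nhds 0) := by
    intro x z
    refine ENNReal.tendsto_atTop_zero_of_tsum_ne_top
      (ne_top_of_le_ne_top (by norm_num) (le_trans ?_ (tsum_green_plane_le hd z x)))
    have hinj : Function.Injective fun n : ℕ => ((n : ℤ), (0 : ℤ)) := fun n m h => by simpa using h
    exact ENNReal.tsum_comp_le_tsum_of_injective hinj
      (fun t : ℤ × ℤ => green x (z + planeEmb d t))
  have herr : Tendsto (fun n : ℕ => 3 * ∑ x ∈ K, ∑ z ∈ translate K' (planeEmb d ((n : ℤ), 0)),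
      green x z) atTop (nhds 0) := by
    simp_rw [translate, Finset.sum_map]
    have : Tendsto (fun n : ℕ => ∑ x ∈ K, ∑ z ∈ K', green x (z + planeEmb d ((n : ℤ), 0))) atTop
        (nhds (∑ x ∈ K, ∑ z ∈ K', 0)) :=
      tendsto_finsetSum _ fun x _ => tendsto_finsetSum _ fun z _ => hg x z
    have h3 := ENNReal.Tendsto.const_mul (a := 3) this (Or.inr (by norm_num))
    simpa using h3
  have hfin : capacity K + capacity K' ≠ ∞ :=
    ENNReal.add_ne_top.2 ⟨capacity_ne_top K, capacity_ne_top K'⟩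
  have hlow : Tendsto (fun n : ℕ => capacity K + capacity K' - 3 * ∑ x ∈ K,
      ∑ z ∈ translate K' (planeEmb d ((n : ℤ), 0)), green x z) atTop
      (nhds (capacity K + capacity K')) := by
    simpa using ENNReal.Tendsto.sub (tendsto_const_nhds (x := capacity K + capacity K')) herr
      (Or.inl hfin)
  refine tendsto_of_tendsto_of_tendsto_of_le_of_le hlow tendsto_const_nhds (fun n => ?_) fun n => ?_
  · refine tsub_le_iff_right.2 ?_
    have := capacity_add_le K (translate K' (planeEmb d ((n : ℤ), 0)))
    rwa [capacity_translate] at this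
  · have := capacity_union_le K (translate K' (planeEmb d ((n : ℤ), 0)))
    rwa [capacity_translate] at this

end Mixing

/-- Convergence of dominated finite measures on a generating π-system extends to all measurable
sets. -/
lemma tendsto_measure_of_piSystem {Ω : Type*} {m : MeasurableSpace Ω} {C : Set (Set Ω)}
    (hgen : m = MeasurableSpace.generateFrom C) (hC : IsPiSystem C) {κ : ℕ → Measure Ω}
    {κ' μ : Measure Ω} [IsFiniteMeasure μ] (hle : ∀ n, κ n ≤ μ) (hle' : κ' ≤ μ)
    (huniv : Tendsto (fun n => κ n univ) atTop (nhds (κ' univ)))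
    (h : ∀ s ∈ C, Tendsto (fun n => κ n s) atTop (nhds (κ' s))) {s : Set Ω}
    (hs : MeasurableSet s) : Tendsto (fun n => κ n s) atTop (nhds (κ' s)) := by
  have hfin : ∀ (ν : Measure Ω), ν ≤ μ → ∀ t, ν t ≠ ∞ := fun ν hν t =>
    ne_top_of_le_ne_top (measure_ne_top μ t) (hν t)
  induction s, hs using MeasurableSpace.induction_on_inter hgen hC with
  | empty => simp
  | basic t ht => exact h t ht
  | compl t ht ih =>
    have e : ∀ ν : Measure Ω, ν ≤ μ → ν tᶜ = ν univ - ν t := fun ν hν =>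
      measure_compl ht (hfin ν hν t)
    simp_rw [e _ (hle _), e _ hle']
    exact ENNReal.Tendsto.sub huniv ih (Or.inl (hfin _ hle' _))
  | iUnion f hd hf ih =>
    simp_rw [measure_iUnion hd hf, ← lintegral_count]
    refine tendsto_lintegral_of_dominated_convergence (fun i => μ (f i))
      (fun n => measurable_of_countable _) (fun n => ae_of_all _ fun i => hle n _) ?_
      (ae_of_all _ ih)
    rw [lintegral_count, ← measure_iUnion hd hf]
    exact measure_ne_top _ _

/-- A shift invariant event has probability `0` or `1` if the shifts `T n` are asymptotically
independent on a generating π-system. -/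
lemma measure_eq_zero_or_one_of_mixing {Ω : Type*} {m : MeasurableSpace Ω} {C : Set (Set Ω)}
    (hgen : m = MeasurableSpace.generateFrom C) (hC : IsPiSystem C) {μ : Measure Ω}
    [IsProbabilityMeasure μ] {T : ℕ → Ω → Ω} (hT : ∀ n, MeasurePreserving (T n) μ μ)
    (hmix : ∀ s ∈ C, ∀ t ∈ C,
      Tendsto (fun n => μ (s ∩ T n ⁻¹' t)) atTop (nhds (μ s * μ t)))
    {A : Set Ω} (hA : MeasurableSet A) (hinv : ∀ n, T n ⁻¹' A = A) : μ A = 0 ∨ μ A = 1 := by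
  have hCm : ∀ s ∈ C, MeasurableSet s := fun s hs => by
    rw [hgen]
    exact MeasurableSpace.measurableSet_generateFrom hs
  have hsmul : ∀ s : Set Ω, (μ s • μ : Measure Ω) ≤ μ := fun s =>
      Measure.le_iff.2 fun t _ => by
    rw [Measure.smul_apply, smul_eq_mul]
    exact mul_le_of_le_one_left' prob_le_one
  -- mixing extends from `t ∈ C` to the invariant event `A`, and then from `s ∈ C` to `A`
  have hCA : ∀ s ∈ C, Tendsto (fun _ : ℕ => μ (s ∩ A)) atTop (nhds (μ s * μ A)) := by
    intro s hs
    have e : ∀ n t, MeasurableSet t → ((μ.restrict s).map (T n)) t = μ (s ∩ T n ⁻¹' t) := by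
      intro n t ht
      rw [Measure.map_apply (hT n).measurable ht,
        Measure.restrict_apply ((hT n).measurable ht), inter_comm]
    have := tendsto_measure_of_piSystem hgen hC (κ := fun n => (μ.restrict s).map (T n))
      (κ' := μ s • μ) (μ := μ)
      (fun n => (Measure.map_mono Measure.restrict_le_self (hT n).measurable).trans
        (hT n).map_eq.le) (hsmul s) (by simp [e _ _ MeasurableSet.univ])
      (fun t ht => by
        simpa only [e _ _ (hCm t ht), Measure.smul_apply, smul_eq_mul] using hmix s hs t ht) hA
    simpa only [e _ _ hA, hinv, Measure.smul_apply, smul_eq_mul] using this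
  have hAA := tendsto_measure_of_piSystem hgen hC (κ := fun _ => μ.restrict A)
      (κ' := μ A • μ) (μ := μ) (fun n => Measure.restrict_le_self) (hsmul A) (by simp)
      (fun t ht => by
        simp only [Measure.restrict_apply (hCm t ht), Measure.smul_apply, smul_eq_mul]
        rw [mul_comm]
        exact hCA t ht) hA
  have h := tendsto_nhds_unique tendsto_const_nhds hAA
  rw [Measure.restrict_apply_self, Measure.smul_apply, smul_eq_mul] at h
  by_cases h0 : μ A = 0
  · exact Or.inl h0
  · refine Or.inr ((ENNReal.mul_right_inj h0 (measure_ne_top _ _)).1 ?_).symm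
    rw [mul_one]
    exact h

/-! ### Percolation as an event -/

lemma linked_iff_exists_finset {α : Type*} {r : α → α → Prop} {V : Set α} {x y : α} :
    Linked r V x y ↔ ∃ F : Finset α, (F : Set α) ⊆ V ∧ Linked r F x y := by
  classical
  constructor
  · intro h
    induction h with
    | refl => exact ⟨∅, by simp, Relation.ReflTransGen.refl⟩
    | @tail b c hb hbc ih =>
      obtain ⟨F, hF, h⟩ := ih
      refine ⟨insert c F, ?_, Relation.ReflTransGen.tail
        (Linked.mono (by simp) h) ⟨hbc.1, by simp⟩⟩
      rw [Finset.coe_insert]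
      exact insert_subset hbc.2 hF
  · rintro ⟨F, hF, h⟩
    exact h.mono hF

section Event

variable {d : ℕ}

lemma measurableSet_inInfiniteComponent (x : Zd d) :
    MeasurableSet {V : Set (Zd d) | InInfiniteComponent V x} := by
  have e : {V : Set (Zd d) | InInfiniteComponent V x} = {V | x ∈ V} ∩ ⋂ F : Finset (Zd d),
      ⋃ y : Zd d, ⋃ _ : y ∉ F, ⋃ F' : Finset (Zd d), ⋃ _ : Linked (lattice d).Adj F' x y,
        {V | (F' : Set (Zd d)) ⊆ V} := by
    ext V
    simp only [mem_ofPred_eq, inInfiniteComponent_iff, mem_inter_iff, mem_iInter, mem_iUnion]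
    refine and_congr_right fun _ => ⟨fun h F => ?_, fun h hfin => ?_⟩
    · obtain ⟨y, hy, hyF⟩ := h.exists_notMem_finset F
      obtain ⟨F', hF', h'⟩ := linked_iff_exists_finset.1 hy
      exact ⟨y, hyF, F', h', hF'⟩
    · obtain ⟨y, hyF, F', h', hF'⟩ := h hfin.toFinset
      exact hyF (hfin.mem_toFinset.2 (h'.mono hF'))
  rw [e]
  exact (measurableSet_mem x).inter (MeasurableSet.iInter fun F => MeasurableSet.iUnion fun y =>
    MeasurableSet.iUnion fun _ => MeasurableSet.iUnion fun F' => MeasurableSet.iUnion fun _ =>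
      measurableSet_subset F')

lemma measurableSet_percolates : MeasurableSet {V : Set (Zd d) | Percolates V} := by
  have e : {V : Set (Zd d) | Percolates V} = ⋃ x, {V | InInfiniteComponent V x} := by
    ext V
    simp only [mem_ofPred_eq, percolates_iff, mem_iUnion]
  rw [e]
  exact MeasurableSet.iUnion measurableSet_inInfiniteComponent

/-- The translation of subsets of `ℤ^d` by `-a`. -/
def shiftSet (a : Zd d) (V : Set (Zd d)) : Set (Zd d) := {x | x + a ∈ V}

lemma measurable_shiftSet (a : Zd d) : Measurable (shiftSet a) :=
  measurable_set_iff.2 fun x => measurable_set_mem (x + a)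

lemma subset_shiftSet_iff {F : Finset (Zd d)} {a : Zd d} {V : Set (Zd d)} :
    (F : Set (Zd d)) ⊆ shiftSet a V ↔ (translate F a : Set (Zd d)) ⊆ V := by
  simp only [translate, shiftSet, subset_def]
  refine ⟨fun h x hx => ?_, fun h x hx => h (x + a) (by simpa using hx)⟩
  simp only [Finset.coe_map, mem_image] at hx
  obtain ⟨y, hy, rfl⟩ := hx
  exact h y hy

lemma Percolates.shiftSet {V : Set (Zd d)} (h : Percolates V) (a : Zd d) :
    Percolates (shiftSet a V) := by
  simp only [percolates_iff, inInfiniteComponent_iff] at h ⊢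
  obtain ⟨x, hx, hinf⟩ := h
  refine ⟨x - a, by simpa [Interlacement.shiftSet] using hx, ?_⟩
  refine (hinf.image (sub_left_injective (b := a)).injOn).mono ?_
  rintro _ ⟨y, hy, rfl⟩
  refine Relation.ReflTransGen.lift (fun z => z - a) (fun b c hbc => ⟨?_, ?_⟩) _ _ hy
  · have := hbc.1
    simpa [lattice] using this
  · simpa [Interlacement.shiftSet] using hbc.2

lemma percolates_shiftSet_iff {V : Set (Zd d)} {a : Zd d} :
    Percolates (shiftSet a V) ↔ Percolates V := by
  refine ⟨fun h => ?_, fun h => h.shiftSet a⟩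
  have e : shiftSet (-a) (shiftSet a V) = V := by
    ext x
    simp [shiftSet]
  exact e ▸ h.shiftSet (-a)

variable [NeZero d] {P : Measure (Config d)} [IsProbabilityMeasure P]

/-- The zero-one law for percolation of the vacant set. -/
lemma prob_perc_eq_zero_or_one (hd : 7 ≤ d) (hP : IsInterlacementLaw P) (u : ℝ≥0) :
    P (Perc d u) = 0 ∨ P (Perc d u) = 1 := by
  set μ : Measure (Set (Zd d)) := P.map fun ω => vacant ω u with hμ
  have : IsProbabilityMeasure μ :=
    Measure.isProbabilityMeasure_map (measurable_vacant u).aemeasurable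
  have hF : ∀ F : Finset (Zd d), μ {V | (F : Set (Zd d)) ⊆ V} =
      ENNReal.ofReal (Real.exp (-((capacity F).toReal * u))) := fun F => by
    rw [hμ, Measure.map_apply (measurable_vacant u) (measurableSet_subset F)]
    exact prob_subset_vacant hd hP F u
  have hpre : ∀ (F : Finset (Zd d)) (a : Zd d), shiftSet a ⁻¹' {V | (F : Set (Zd d)) ⊆ V} =
      {V | (translate F a : Set (Zd d)) ⊆ V} := fun F a => by
    ext V
    exact subset_shiftSet_iff
  have hT : ∀ a : Zd d, MeasurePreserving (shiftSet a) μ μ := by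
    refine fun a => ⟨measurable_shiftSet a, ?_⟩
    have := Measure.isProbabilityMeasure_map (μ := μ) (measurable_shiftSet a).aemeasurable
    refine setMeasure_ext fun F => ?_
    rw [Measure.map_apply (measurable_shiftSet a) (measurableSet_subset F), hpre, hF, hF,
      capacity_translate]
  have key := measure_eq_zero_or_one_of_mixing (setMeasurableSpace_eq_generateFrom (Zd d))
    (isPiSystem_subset _) (T := fun n : ℕ => shiftSet (planeEmb d ((n : ℤ), 0))) (fun n => hT _)
    (by
      rintro _ ⟨F, rfl⟩ _ ⟨F', rfl⟩
      have e : ∀ n : ℕ, {V : Set (Zd d) | (F : Set (Zd d)) ⊆ V} ∩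
          shiftSet (planeEmb d ((n : ℤ), 0)) ⁻¹' {V | (F' : Set (Zd d)) ⊆ V} =
          {V | ((F ∪ translate F' (planeEmb d ((n : ℤ), 0)) : Finset (Zd d)) : Set (Zd d)) ⊆
            V} := by
        intro n
        rw [hpre]
        ext V
        simp only [Finset.coe_union, union_subset_iff, mem_inter_iff, mem_ofPred_eq]
      simp_rw [e, hF]
      rw [← ENNReal.ofReal_mul (Real.exp_pos _).le, ← Real.exp_add]
      have h1 := (ENNReal.tendsto_toReal (ENNReal.add_ne_top.2
        ⟨capacity_ne_top F, capacity_ne_top F'⟩)).comp (tendsto_capacity_union hd F F')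
      have h2 : -((capacity F).toReal * (u : ℝ)) + -((capacity F').toReal * u) =
          -((capacity F + capacity F').toReal * u) := by
        rw [ENNReal.toReal_add (capacity_ne_top F) (capacity_ne_top F')]
        ring
      rw [h2]
      exact (ENNReal.continuous_ofReal.tendsto _).comp
        ((Real.continuous_exp.tendsto _).comp ((h1.mul_const _).neg)))
    measurableSet_percolates (fun n => by
      ext V
      exact percolates_shiftSet_iff)
  rw [hμ, Measure.map_apply (measurable_vacant u) measurableSet_percolates] at key
  exact key

end Event

end Interlacement

theorem theorem4p3 (d : ℕ) [NeZero d] (hd : 7 ≤ d)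
    (P : Measure (Interlacement.Config d)) [IsProbabilityMeasure P]
    (hP : Interlacement.IsInterlacementLaw P) :
    0 < Interlacement.criticalLevel P ∧
    (∀ u : ℝ≥0, (u : ℝ≥0∞) < Interlacement.criticalLevel P → P (Interlacement.Perc d u) = 1) ∧
    ∃ u₀ : ℝ≥0, 0 < u₀ ∧ ∀ u : ℝ≥0, 0 < u → u ≤ u₀ →
      ∀ᵐ ω ∂P, Interlacement.Percolates (Interlacement.vacant ω u) ∧
        Interlacement.Percolates (Interlacement.vacant ω u ∩ Interlacement.plane d) := by
  obtain ⟨u₀, hu₀, h⟩ := Interlacement.exists_percolation_level hd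
  refine ⟨?_, fun u hu => ?_, u₀, hu₀, fun u _ hu => ?_⟩
  · refine lt_of_lt_of_le (ENNReal.coe_pos.2 hu₀) (le_sInf ?_)
    rintro _ ⟨u, hu, rfl⟩
    by_contra! hlt
    exact (h P hP u (by exact_mod_cast hlt.le)).1 hu
  · refine (Interlacement.prob_perc_eq_zero_or_one hd hP u).resolve_left fun h0 => ?_
    refine hu.not_ge (sInf_le ⟨u, ?_, rfl⟩)
    refine measure_mono_null (fun ω hω => ?_) h0
    exact Interlacement.percolates_iff.2 ⟨0, hω⟩
  · filter_upwards [(h P hP u hu).2] with ω hω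
    exact ⟨hω.mono inter_subset_left, hω⟩

end
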